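/- **Setting.** There are $K$ arms. For each arm $k$ a function $\mu_k:\Theta\to\mathbb R$ on an arbitrary set $\Theta$ is known, and the true parameter is $\theta^*\in\Theta$. The successive rewards of arm $k$ are i.i.d. with mean $\mu_k(\theta^*)$ and sub-Gaussian with variance proxy $\sigma^2>0$, and the rewards of different arms are independent. Let $k^*$ be the unique optimal arm, $\Delta_k=\mu_{k^*}(\theta^*)-\mu_k(\theta^*)$ and $\Delta_{\min}=\min_{k\ne k^*}\Delta_k>0$. Arm $k$ is *non-competitive* if for some $\epsilon>0$ one has $\mu_k(\theta)<\max_\ell\mu_\ell(\theta)$ for all $\theta$ with $|\mu_{k^*}(\theta^*)-\mu_{k^*}(\theta)|<\epsilon$; the largest such $\epsilon\in(0,\infty]$ is its degree of non-competitiveness $\epsilon_k$. **Algorithms.** Let $n_k(t)$ be the number of pulls of arm $k$ in the first $t$ rounds and $\hat\mu_k(t)$ the empirical mean of its rewards. In round $t+1$ (for $t\ge 0$), let $$\hat\Theta_t=\Big\{\theta:\ |\mu_k(\theta)-\hat\mu_k(t)|<\sqrt{2\alpha\sigma^2\log t/n_k(t)}\ \text{ for all } k\Big\},$$ where $\alpha>0$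 and an arm with $n_k(t)=0$ imposes no constraint. Let $\mathcal C_t$ be the set of arms $k$ with $\mu_k(\theta)=\max_\ell\mu_\ell(\theta)$ for some $\theta\in\hat\Theta_t$, or the set of all arms if $\hat\Theta_t=\emptyset$. UCB-C pulls an arm of $\mathcal C_t$ that maximizes $\hat\mu_k(t)+\sqrt{2\alpha\sigma^2\log t/n_k(t)}$. TS-C pulls an arm of $\mathcal C_t$ that maximizes $S_{k,t}$, where the $S_{k,t}\sim\mathcal N(\hat\mu_k(t),\beta\sigma^2/n_k(t))$ are drawn independently given the past. In both algorithms the index of an arm with $n_k(t)=0$ is $+\infty$. **Theorem.** Let arm $k$ be non-competitive and $\alpha>0$. (i) For UCB-C and every horizon $T$, $$\mathbb E[n_k(T)]\le Kt_0+\sum_{t=1}^{T}2Kt^{1-\alpha}+K^3\sum_{t=Kt_0}^{T}6\Big(\frac tK\Big)^{2-\alpha},$$ where $t_0$ is the least integer $\tau\ge 2$ such that $\Delta_{\min}$ and $\epsilon_k$ are both at least $4\sqrt{K\alpha\sigma^2\log\tau/\tau}$. If $\alpha>3$, the right-hand side, and hence $\mathbb E[n_k(T)]$, is $O(1)$ as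 $T\to\infty$. (ii) For TS-C with $\beta>1$ and every horizon $T$, $$\mathbb E[n_k(T)]\le Kt_b+\sum_{t=1}^{T}2Kt^{1-\alpha}+K^3\sum_{t=Kt_b}^{T}4\Big(\frac tK\Big)^{2-\alpha}+K^2\sum_{t=Kt_b}^{T}\Big(\frac tK\Big)^{1-2\beta},$$ where $t_b$ is the least integer $\tau\ge\exp(11\beta\sigma^2)$ such that $\Delta_{\min}$ and $\epsilon_k$ are both at least $3\sqrt{3K\alpha\sigma^2\log\tau/\tau}$. If $\alpha>3$, the right-hand side, and hence $\mathbb E[n_k(T)]$, is $O(1)$ as $T\to\infty$. -/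

import Mathlib

open MeasureTheory ProbabilityTheory Filter Asymptotics

noncomputable section

namespace StructuredBandit

/-! ### Structured bandits: arms `Fin K`, known mean-reward functions `μ k : Θ → ℝ` -/

/-- Arm `k` is optimal under the parameter `θ`: `μ_k(θ) = max_ℓ μ_ℓ(θ)`. -/
def IsOptimal {Θ : Type*} {K : ℕ} (μ : Fin K → Θ → ℝ) (θ : Θ) (k : Fin K) : Prop :=
  ∀ l, μ l θ ≤ μ k θ

/-- Arm `k` is non-competitive (true parameter `θs`, optimal arm `ks`): for some `ε > 0` it is
not optimal for any `θ` with `|μ_{ks}(θs) - μ_{ks}(θ)| < ε`. -/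
def NonCompetitive {Θ : Type*} {K : ℕ} (μ : Fin K → Θ → ℝ) (θs : Θ) (ks k : Fin K) : Prop :=
  ∃ ε : ℝ, 0 < ε ∧ ∀ θ, |μ ks θs - μ ks θ| < ε → ¬ IsOptimal μ θ k

/-- The degree of non-competitiveness `ε_k`: the largest `ε` such that arm `k` is not optimal for
any `θ` with `|μ_{ks}(θs) - μ_{ks}(θ)| < ε`. It is `∞` if arm `k` is optimal for no `θ`. -/
def degree {Θ : Type*} {K : ℕ} (μ : Fin K → Θ → ℝ) (θs : Θ) (ks k : Fin K) : ENNReal :=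
  sSup {ε : ENNReal | ∀ θ, ENNReal.ofReal |μ ks θs - μ ks θ| < ε → ¬ IsOptimal μ θ k}

/-- The smallest sub-optimality gap `Δ_min`, the minimum of `μ_{ks}(θs) - μ_l(θs)` over the arms
`l` other than the optimal arm `ks`. -/
def gapMin {Θ : Type*} {K : ℕ} (μ : Fin K → Θ → ℝ) (θs : Θ) (ks : Fin K) : ℝ :=
  ⨅ l : {l : Fin K // l ≠ ks}, (μ ks θs - μ l.1 θs)

/-! ### Rewards -/

/-- `X k i` is the reward that arm `k` gives when it is pulled for the `(i+1)`-st time. The rewards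
are independent, identically distributed for each arm, with mean `m k`, and sub-Gaussian with
variance proxy `σ ^ 2`. -/
structure IsRewardTable {Ω : Type*} [MeasurableSpace Ω] {K : ℕ} (P : Measure Ω)
    (X : Fin K → ℕ → Ω → ℝ) (m : Fin K → ℝ) (σ : ℝ) : Prop where
  measurable : ∀ k i, Measurable (X k i)
  indep : iIndepFun (fun p : Fin K × ℕ => X p.1 p.2) P
  identDistrib : ∀ k i, IdentDistrib (X k i) (X k 0) P P
  integrable : ∀ k, Integrable (X k 0) P
  mean : ∀ k, ∫ ω, X k 0 ω ∂P = m k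
  subgaussian : ∀ k, HasSubgaussianMGF (fun ω => X k 0 ω - m k) (Real.toNNReal (σ ^ 2)) P

/-! ### Histories

`arm t ω` is the arm pulled in round `t + 1`, for `t = 0, 1, 2, …`. -/

/-- `n_k(t)`: the number of pulls of arm `k` in the first `t` rounds. -/
def pulls {Ω : Type*} {K : ℕ} (arm : ℕ → Ω → Fin K) (k : Fin K) (t : ℕ) (ω : Ω) : ℕ :=
  ((Finset.range t).filter (fun s => arm s ω = k)).card

/-- The empirical mean of the rewards from arm `k` in the first `t` rounds
(only used when arm `k` has been pulled). -/
def empMean {Ω : Type*} {K : ℕ} (X : Fin K → ℕ → Ω → ℝ) (arm : ℕ → Ω → Fin K)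
    (k : Fin K) (t : ℕ) (ω : Ω) : ℝ :=
  (∑ i ∈ Finset.range (pulls arm k t ω), X k i ω) / (pulls arm k t ω : ℝ)

/-- The width `√(2 α σ² log t / n)` of the confidence interval of an arm pulled `n ≥ 1` times in
the first `t` rounds. -/
def width (α σ : ℝ) (t n : ℕ) : ℝ :=
  Real.sqrt (2 * α * σ ^ 2 * Real.log t / n)

/-- The confidence set after `t` rounds. An arm that has not been pulled has an infinite
confidence width, so it imposes no constraint. -/
def confSet {Θ Ω : Type*} {K : ℕ} (μ : Fin K → Θ → ℝ) (α σ : ℝ) (X : Fin K → ℕ → Ω → ℝ)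
    (arm : ℕ → Ω → Fin K) (t : ℕ) (ω : Ω) : Set Θ :=
  {θ | ∀ k, 0 < pulls arm k t ω →
    |μ k θ - empMean X arm k t ω| < width α σ t (pulls arm k t ω)}

/-- The set `C_t` of arms that are competitive with respect to the confidence set: the arms that
are optimal for some `θ` in it, and all arms if it is empty. -/
def competitiveSet {Θ Ω : Type*} {K : ℕ} (μ : Fin K → Θ → ℝ) (α σ : ℝ)
    (X : Fin K → ℕ → Ω → ℝ) (arm : ℕ → Ω → Fin K) (t : ℕ) (ω : Ω) : Set (Fin K) :=
  {k | confSet μ α σ X arm t ω = ∅ ∨ ∃ θ ∈ confSet μ α σ X arm t ω, IsOptimal μ θ k}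

/-! ### UCB-C and TS-C -/

/-- The UCB index after `t` rounds; it is `+∞` for an arm that has not been pulled. -/
def ucbIndex {Ω : Type*} {K : ℕ} (α σ : ℝ) (X : Fin K → ℕ → Ω → ℝ)
    (arm : ℕ → Ω → Fin K) (k : Fin K) (t : ℕ) (ω : Ω) : EReal :=
  if pulls arm k t ω = 0 then ⊤
  else ((empMean X arm k t ω + width α σ t (pulls arm k t ω) : ℝ) : EReal)

/-- The arms are chosen by UCB-C: every round pulls an arm of largest UCB index among the arms of
`C_t`. Ties are broken in an arbitrary measurable way. -/
structure IsUCBC {Θ Ω : Type*} [MeasurableSpace Ω] {K : ℕ} (μ : Fin K → Θ → ℝ) (α σ : ℝ)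
    (X : Fin K → ℕ → Ω → ℝ) (arm : ℕ → Ω → Fin K) : Prop where
  measurable : ∀ t, Measurable (arm t)
  mem : ∀ t ω, arm t ω ∈ competitiveSet μ α σ X arm t ω
  argmax : ∀ t ω, ∀ l ∈ competitiveSet μ α σ X arm t ω,
    ucbIndex α σ X arm l t ω ≤ ucbIndex α σ X arm (arm t ω) t ω

/-- The Thompson sample `S_{k,t} = μ̂_k(t) + √(β σ² / n_k(t)) · G_{t,k}`. For a standard Gaussian
`G_{t,k}` independent of the past it has the law `N(μ̂_k(t), β σ² / n_k(t))` given the past. For an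
arm that has not been pulled (infinite variance) it is `+∞`, so that such an arm, if it is in `C_t`,
is tried before the arms already pulled. -/
def tsSample {Ω : Type*} {K : ℕ} (β σ : ℝ) (X : Fin K → ℕ → Ω → ℝ) (G : ℕ → Fin K → Ω → ℝ)
    (arm : ℕ → Ω → Fin K) (k : Fin K) (t : ℕ) (ω : Ω) : EReal :=
  if pulls arm k t ω = 0 then ⊤
  else ((empMean X arm k t ω +
    Real.sqrt (β * σ ^ 2 / (pulls arm k t ω : ℝ)) * G t k ω : ℝ) : EReal)

/-- The arms are chosen by TS-C: every round pulls an arm of largest Thompson sample among the arms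
of `C_t`. The Gaussian variables of a round are i.i.d. standard and independent of the rewards
and of the Gaussian variables and choices of all earlier rounds. -/
structure IsTSC {Θ Ω : Type*} [MeasurableSpace Ω] {K : ℕ} (P : Measure Ω) (μ : Fin K → Θ → ℝ)
    (α β σ : ℝ) (X : Fin K → ℕ → Ω → ℝ) (G : ℕ → Fin K → Ω → ℝ) (arm : ℕ → Ω → Fin K) :
    Prop where
  measurable : ∀ t, Measurable (arm t)
  measurable_gauss : ∀ t k, Measurable (G t k)
  gauss : ∀ t k, P.map (G t k) = gaussianReal 0 1
  indep_arms : ∀ t, iIndepFun (G t) P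
  indep_past : ∀ t, IndepFun (fun ω k => G t k ω)
    (fun ω => ((fun (k : Fin K) (i : ℕ) => X k i ω),
      (fun s : Fin t => (arm s ω, fun k : Fin K => G s k ω)))) P
  mem : ∀ t ω, arm t ω ∈ competitiveSet μ α σ X arm t ω
  argmax : ∀ t ω, ∀ l ∈ competitiveSet μ α σ X arm t ω,
    tsSample β σ X G arm l t ω ≤ tsSample β σ X G arm (arm t ω) t ω

/-! ### The bounds -/

/-- `t_0`: the least integer `τ ≥ 2` with `Δ_min, ε_k ≥ 4 √(K α σ² log τ / τ)`. -/
def tZero {Θ : Type*} {K : ℕ} (μ : Fin K → Θ → ℝ) (θs : Θ) (ks k : Fin K) (α σ : ℝ) : ℕ :=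
  sInf {τ : ℕ | 2 ≤ τ ∧
    4 * Real.sqrt (K * α * σ ^ 2 * Real.log τ / τ) ≤ gapMin μ θs ks ∧
    ENNReal.ofReal (4 * Real.sqrt (K * α * σ ^ 2 * Real.log τ / τ)) ≤ degree μ θs ks k}

/-- `t_b`: the least integer `τ ≥ exp(11 β σ²)` with `Δ_min, ε_k ≥ 3 √(3 K α σ² log τ / τ)`. -/
def tB {Θ : Type*} {K : ℕ} (μ : Fin K → Θ → ℝ) (θs : Θ) (ks k : Fin K) (α β σ : ℝ) : ℕ :=
  sInf {τ : ℕ | Real.exp (11 * β * σ ^ 2) ≤ τ ∧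
    3 * Real.sqrt (3 * (K * α * σ ^ 2 * Real.log τ / τ)) ≤ gapMin μ θs ks ∧
    ENNReal.ofReal (3 * Real.sqrt (3 * (K * α * σ ^ 2 * Real.log τ / τ))) ≤ degree μ θs ks k}

/-- The bound for UCB-C, as a function of `K`, `α`, `t_0` and the horizon `T`. -/
def ucbBound (K : ℕ) (α : ℝ) (t₀ T : ℕ) : ℝ :=
  K * t₀ + ∑ t ∈ Finset.Icc 1 T, 2 * K * (t : ℝ) ^ (1 - α)
    + (K : ℝ) ^ 3 * ∑ t ∈ Finset.Icc (K * t₀) T, 6 * ((t : ℝ) / K) ^ (2 - α)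

/-- The bound for TS-C, as a function of `K`, `α`, `β`, `t_b` and the horizon `T`. -/
def tsBound (K : ℕ) (α β : ℝ) (tb T : ℕ) : ℝ :=
  K * tb + ∑ t ∈ Finset.Icc 1 T, 2 * K * (t : ℝ) ^ (1 - α)
    + (K : ℝ) ^ 3 * ∑ t ∈ Finset.Icc (K * tb) T, 4 * ((t : ℝ) / K) ^ (2 - α)
    + (K : ℝ) ^ 2 * ∑ t ∈ Finset.Icc (K * tb) T, ((t : ℝ) / K) ^ (1 - 2 * β)

end StructuredBandit

end

/-!
Call round `t` good if `θs` lies in the confidence set; by a Chernoff bound and a union bound over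
the number of pulls of each arm, round `t` is bad with probability at most `2 K t ^ (1 - α)`. In a
good round the optimal arm is competitive, and pulling the non-competitive arm `k` forces the
confidence width of the optimal arm to exceed half the degree of `k`, so the optimal arm has been
pulled rarely.

For UCB-C some suboptimal arm has then been pulled more than `t / K` times; if the rounds from
`t / K` on are good, its index at the pull of number `t / K` was already too small to win.

For TS-C a pull of a suboptimal arm that has been observed often is charged to the optimal arm: the
conditional probability of the former is at most a cost, depending only on the empirical mean of the
optimal arm, times that of pulling the optimal arm. Since every pull of the optimal arm refreshes
its empirical mean, the total cost is the sum over `j` of the expected costs at the mean of the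
first `j` rewards, and a Mills ratio bound makes it at most `t_b / 2`. Markov's inequality in blocks
of rounds of doubling length then bounds the probability that the optimal arm is still rarely pulled
at the end of a block.
-/

namespace StructuredBandit

section EventCounts

variable {Ω ι : Type*} {E : ι → Set Ω} {A : Set Ω} {S : Finset ι} {c : ℝ}

open scoped Classical in
lemma card_filter_mem_eq_sum_indicator (E : ι → Set Ω) (S : Finset ι) (ω : Ω) :
    ((S.filter (ω ∈ E ·)).card : ℝ) = ∑ i ∈ S, (E i).indicator (fun _ => (1 : ℝ)) ω := by
  simp [Set.indicator_apply, Finset.sum_boole]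

variable [MeasurableSpace Ω] {P : Measure Ω} [IsFiniteMeasure P]

open scoped Classical in
lemma integral_card_filter_mem (hE : ∀ i, MeasurableSet (E i)) (S : Finset ι) :
    ∫ ω, ((S.filter (ω ∈ E ·)).card : ℝ) ∂P = ∑ i ∈ S, P.real (E i) := by
  simp_rw [card_filter_mem_eq_sum_indicator]
  rw [integral_finsetSum _ fun i _ => (integrable_const (1 : ℝ)).indicator (hE i)]
  exact Finset.sum_congr rfl fun i _ => integral_indicator_one (hE i)

open scoped Classical in
lemma integrable_card_filter_mem (hE : ∀ i, MeasurableSet (E i)) (S : Finset ι) :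
    Integrable (fun ω => ((S.filter (ω ∈ E ·)).card : ℝ)) P := by
  simp_rw [card_filter_mem_eq_sum_indicator]
  exact integrable_finsetSum _ fun i _ => (integrable_const (1 : ℝ)).indicator (hE i)

open scoped Classical in
lemma sum_measureReal_le_mul (hE : ∀ i, MeasurableSet (E i)) (hA : MeasurableSet A)
    (hsub : ∀ i ∈ S, E i ⊆ A) (hcard : ∀ ω, ((S.filter (ω ∈ E ·)).card : ℝ) ≤ c) :
    ∑ i ∈ S, P.real (E i) ≤ c * P.real A := by
  have hA_integral : ∫ ω, A.indicator (fun _ => c) ω ∂P = c * P.real A := by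
    rw [integral_indicator_const _ hA, smul_eq_mul, mul_comm]
  rw [← integral_card_filter_mem hE, ← hA_integral]
  refine integral_mono (integrable_card_filter_mem hE S) ((integrable_const c).indicator hA)
    fun ω => ?_
  by_cases hω : ω ∈ A
  · simpa [hω] using hcard ω
  · simp [hω, Finset.filter_false_of_mem fun i hi h => hω (hsub i hi h)]

open scoped Classical in
lemma mul_measureReal_le_sum (hE : ∀ i, MeasurableSet (E i))
    (hcard : ∀ ω ∈ A, c ≤ (S.filter (ω ∈ E ·)).card) :
    c * P.real A ≤ ∑ i ∈ S, P.real (E i) := by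
  rw [← integral_card_filter_mem hE]
  rcases le_or_gt c 0 with hc | hc
  · exact (mul_nonpos_of_nonpos_of_nonneg hc measureReal_nonneg).trans
      (integral_nonneg fun ω => Nat.cast_nonneg _)
  · exact (mul_le_mul_of_nonneg_left (measureReal_mono hcard) hc.le).trans
      (mul_meas_ge_le_integral_of_nonneg (Eventually.of_forall fun ω => Nat.cast_nonneg _)
        (integrable_card_filter_mem hE S) c)

end EventCounts

section Counting

variable {Ω : Type*} {K : ℕ} {arm : ℕ → Ω → Fin K} {k l : Fin K} {s t : ℕ} {ω : Ω}

lemma pulls_succ :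
    pulls arm k (t + 1) ω = pulls arm k t ω + if arm t ω = k then 1 else 0 := by
  unfold pulls
  rw [Finset.range_add_one, Finset.filter_insert]
  split_ifs with h
  · exact Finset.card_insert_of_notMem (by simp)
  · rfl

lemma pulls_mono (h : s ≤ t) : pulls arm k s ω ≤ pulls arm k t ω :=
  Finset.card_le_card (Finset.filter_subset_filter _ (Finset.range_mono h))

lemma pulls_le : pulls arm k t ω ≤ t :=
  (Finset.card_filter_le _ _).trans_eq (Finset.card_range t)

lemma pulls_lt (hs : arm s ω = k) (hst : s < t) : pulls arm k s ω < pulls arm k t ω :=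
  calc pulls arm k s ω < pulls arm k (s + 1) ω := by simp [pulls_succ, hs]
    _ ≤ pulls arm k t ω := pulls_mono hst

lemma pulls_inj (hs : arm s ω = k) (ht : arm t ω = k)
    (h : pulls arm k s ω = pulls arm k t ω) : s = t := by
  rcases lt_trichotomy s t with hst | hst | hst
  · exact absurd h (pulls_lt hs hst).ne
  · exact hst
  · exact absurd h (pulls_lt ht hst).ne'

lemma sum_pulls (arm : ℕ → Ω → Fin K) (t : ℕ) (ω : Ω) : ∑ k, pulls arm k t ω = t := by
  unfold pulls
  rw [← Finset.card_eq_sum_card_fiberwise (by simp), Finset.card_range]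

lemma exists_lt_arm_eq_and_pulls_eq {m : ℕ} (h : m < pulls arm l t ω) :
    ∃ s < t, arm s ω = l ∧ pulls arm l s ω = m := by
  induction t with
  | zero => simp [pulls] at h
  | succ t ih =>
    by_cases h' : m < pulls arm l t ω
    · obtain ⟨s, hs, hsl, hsm⟩ := ih h'
      exact ⟨s, by omega, hsl, hsm⟩
    · rw [pulls_succ] at h
      split_ifs at h with ha
      · exact ⟨t, by omega, ha, by omega⟩
      · omega

lemma card_filter_arm_eq_and_pulls_mem_Ico_le (arm : ℕ → Ω → Fin K) (l : Fin K) (ω : Ω)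
    (S : Finset ℕ) (a b : ℕ) :
    (S.filter (fun s => arm s ω = l ∧ a ≤ pulls arm l s ω ∧ pulls arm l s ω < b)).card
      ≤ b - a := by
  rw [← Nat.card_Ico]
  refine Finset.card_le_card_of_injOn (fun s => pulls arm l s ω) (fun s hs => ?_)
    fun s hs t ht hst => ?_
  · simp only [Finset.coe_filter, Set.mem_ofPred_eq] at hs
    simp [hs.2.2.1, hs.2.2.2]
  · simp only [Finset.coe_filter, Set.mem_ofPred_eq] at hs ht
    exact pulls_inj hs.2.1 ht.2.1 hst

variable [MeasurableSpace Ω] {P : Measure Ω}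

lemma measurable_pulls (harm : ∀ r < t, Measurable (arm r)) (k : Fin K) :
    Measurable (pulls arm k t) := by
  have h : pulls arm k t = fun ω => ∑ r ∈ Finset.range t, if arm r ω = k then 1 else 0 := by
    ext ω; simp [pulls]
  rw [h]
  refine Finset.measurable_sum _ fun r hr => ?_
  exact Measurable.ite (harm r (Finset.mem_range.1 hr) (measurableSet_singleton k))
    measurable_const measurable_const

lemma integral_pulls [IsFiniteMeasure P] (harm : ∀ t, Measurable (arm t)) (k : Fin K) (T : ℕ) :
    ∫ ω, (pulls arm k T ω : ℝ) ∂P = ∑ t ∈ Finset.range T, P.real {ω | arm t ω = k} := by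
  have hpulled : ∀ t, MeasurableSet {ω | arm t ω = k} :=
    fun t => harm t (measurableSet_singleton k)
  rw [← integral_card_filter_mem hpulled]
  refine integral_congr_ae (ae_of_all _ fun ω => ?_)
  simp only [pulls, Set.mem_ofPred_eq]

lemma measurableSet_pulls (harm : ∀ t, Measurable (arm t)) (k : Fin K) (t : ℕ) (S : Set ℕ) :
    MeasurableSet {ω | pulls arm k t ω ∈ S} :=
  measurable_pulls (fun r _ => harm r) k S.to_countable.measurableSet

end Counting

section Width

variable {α σ : ℝ}

lemma width_nonneg (α σ : ℝ) (t n : ℕ) : 0 ≤ width α σ t n := Real.sqrt_nonneg _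

lemma width_sq (hα : 0 ≤ α) (t n : ℕ) :
    width α σ t n ^ 2 = 2 * α * σ ^ 2 * Real.log t / n := by
  have := Real.log_natCast_nonneg t
  exact Real.sq_sqrt (by positivity)

lemma log_natCast_mono {s t : ℕ} (h : s ≤ t) : Real.log s ≤ Real.log t := by
  rcases Nat.eq_zero_or_pos s with rfl | hs
  · simpa using Real.log_natCast_nonneg t
  · exact Real.log_le_log (by exact_mod_cast hs) (by exact_mod_cast h)

lemma width_mono (hα : 0 ≤ α) {s t : ℕ} (h : s ≤ t) (n : ℕ) :
    width α σ s n ≤ width α σ t n := by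
  unfold width
  have := log_natCast_mono h
  gcongr

end Width

section Competitive

variable {Θ Ω : Type*} {K : ℕ} {μ : Fin K → Θ → ℝ} {θs : Θ} {ks k l : Fin K} {α σ D : ℝ}
  {X : Fin K → ℕ → Ω → ℝ} {arm : ℕ → Ω → Fin K} {t : ℕ} {ω : Ω}

lemma IsOptimal.mem_competitiveSet (hopt : IsOptimal μ θs ks)
    (hg : θs ∈ confSet μ α σ X arm t ω) : ks ∈ competitiveSet μ α σ X arm t ω :=
  Or.inr ⟨θs, hg, hopt⟩

lemma NonCompetitive.ne (hopt : IsOptimal μ θs ks) (hk : NonCompetitive μ θs ks k) :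
    k ≠ ks := by
  rintro rfl
  obtain ⟨ε, hε, h⟩ := hk
  exact h θs (by simpa using hε) hopt

lemma not_isOptimal_of_abs_sub_lt_degree {θ : Θ}
    (h : ENNReal.ofReal |μ ks θs - μ ks θ| < degree μ θs ks k) : ¬ IsOptimal μ θ k := by
  obtain ⟨ε, hε, hlt⟩ := lt_sSup_iff.1 h
  exact hε θ hlt

lemma lt_two_mul_width_of_mem_competitiveSet (hD : ENNReal.ofReal D ≤ degree μ θs ks k)
    (hg : θs ∈ confSet μ α σ X arm t ω) (hk : k ∈ competitiveSet μ α σ X arm t ω)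
    (hn : 0 < pulls arm ks t ω) : D < 2 * width α σ t (pulls arm ks t ω) := by
  rcases hk with h | ⟨θ, hθ, hopt⟩
  · rw [h] at hg
    exact hg.elim
  by_contra! hlt
  have hclose : |μ ks θs - μ ks θ| < D := by
    have h1 := abs_lt.1 (hg ks hn)
    have h2 := abs_lt.1 (hθ ks hn)
    rw [abs_lt]
    constructor <;> linarith
  have hD0 : 0 < D := (abs_nonneg _).trans_lt hclose
  exact not_isOptimal_of_abs_sub_lt_degree
    (((ENNReal.ofReal_lt_ofReal_iff hD0).2 hclose).trans_le hD) hopt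

lemma gapMin_le (hl : l ≠ ks) : gapMin μ θs ks ≤ μ ks θs - μ l θs :=
  ciInf_le (f := fun l : {l : Fin K // l ≠ ks} => μ ks θs - μ l.1 θs)
    (Set.finite_range _).bddBelow ⟨l, hl⟩

lemma gapMin_pos (hks : ∀ l, l ≠ ks → μ l θs < μ ks θs) (hk : k ≠ ks) :
    0 < gapMin μ θs ks := by
  have : Nonempty {l : Fin K // l ≠ ks} := ⟨⟨k, hk⟩⟩
  obtain ⟨l, hl⟩ := exists_eq_ciInf_of_finite
    (f := fun l : {l : Fin K // l ≠ ks} => μ ks θs - μ l.1 θs)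
  exact (sub_pos.2 (hks l.1 l.2)).trans_eq hl

lemma degree_pos (hk : NonCompetitive μ θs ks k) : 0 < degree μ θs ks k := by
  obtain ⟨ε, hε, h⟩ := hk
  refine (ENNReal.ofReal_pos.2 hε).trans_le (le_sSup fun θ hθ => ?_)
  exact h θ ((ENNReal.ofReal_lt_ofReal_iff hε).1 hθ)

lemma two_le_of_ne (hk : k ≠ ks) : 2 ≤ K := by
  have := Fin.val_ne_of_ne hk
  omega

lemma isOptimal_of_forall_ne_lt (hks : ∀ l, l ≠ ks → μ l θs < μ ks θs) :
    IsOptimal μ θs ks := fun l => by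
  rcases eq_or_ne l ks with rfl | h
  · exact le_rfl
  · exact (hks l h).le

end Competitive

section Concentration

variable {Θ Ω : Type*} [MeasurableSpace Ω] {P : Measure Ω} {K : ℕ}
  {X : Fin K → ℕ → Ω → ℝ} {m : Fin K → ℝ} {σ α : ℝ}

lemma measureReal_le_abs_le_of_hasSubgaussianMGF {Y : Ω → ℝ} {c : NNReal}
    (h : HasSubgaussianMGF Y c P) {ε : ℝ} (hε : 0 ≤ ε) :
    P.real {ω | ε ≤ |Y ω|} ≤ 2 * Real.exp (-ε ^ 2 / (2 * c)) := by
  have hsplit : {ω | ε ≤ |Y ω|} = {ω | ε ≤ Y ω} ∪ {ω | ε ≤ (-Y) ω} := by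
    ext ω
    exact le_abs (a := ε) (b := Y ω)
  rw [hsplit, two_mul]
  exact (measureReal_union_le _ _).trans (add_le_add (h.measure_ge_le hε) (h.neg.measure_ge_le hε))

lemma IsRewardTable.hasSubgaussianMGF_sum (hX : IsRewardTable P X m σ) (k : Fin K) (n : ℕ) :
    HasSubgaussianMGF (fun ω => ∑ i ∈ Finset.range n, (X k i ω - m k))
      (n * Real.toNNReal (σ ^ 2)) P := by
  have hindep : iIndepFun (fun i ω => X k i ω - m k) P :=
    (hX.indep.precomp (g := fun i : ℕ => (k, i)) fun i j h => by simpa using h).comp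
      (fun _ x => x - m k) (fun _ => by fun_prop)
  have hsum := HasSubgaussianMGF.sum_of_iIndepFun (s := Finset.range n) hindep fun i _ =>
    (hX.subgaussian k).congr_identDistrib
      ((hX.identDistrib k i).symm.comp (u := fun x => x - m k) (by fun_prop))
  simpa using hsum

lemma IsRewardTable.measureReal_width_le_abs_le (hX : IsRewardTable P X m σ)
    (hσ : σ ≠ 0) (hα : 0 ≤ α) (k : Fin K) {t n : ℕ} (ht : 0 < t) (hn : 0 < n) :
    P.real {ω | width α σ t n ≤ |m k - (∑ i ∈ Finset.range n, X k i ω) / n|}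
      ≤ 2 * (t : ℝ) ^ (-α) := by
  have hn' : (0 : ℝ) < n := by exact_mod_cast hn
  have ht' : (0 : ℝ) < t := by exact_mod_cast ht
  have hscale : ∀ ω, n * |m k - (∑ i ∈ Finset.range n, X k i ω) / n|
      = |∑ i ∈ Finset.range n, (X k i ω - m k)| := fun ω => by
    rw [← abs_of_pos hn', ← abs_mul, abs_of_pos hn', ← abs_neg]
    congr 1
    simp only [Finset.sum_sub_distrib, Finset.sum_const, Finset.card_range, nsmul_eq_mul]
    field_simp
    ring
  have hset : {ω | width α σ t n ≤ |m k - (∑ i ∈ Finset.range n, X k i ω) / n|}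
      = {ω | n * width α σ t n ≤ |∑ i ∈ Finset.range n, (X k i ω - m k)|} := by
    ext ω
    simp only [Set.mem_ofPred_eq, ← hscale, mul_le_mul_iff_right₀ hn']
  rw [hset]
  refine (measureReal_le_abs_le_of_hasSubgaussianMGF (hX.hasSubgaussianMGF_sum k n)
    (mul_nonneg hn'.le (width_nonneg α σ t n))).trans_eq ?_
  rw [mul_pow, width_sq hα, Real.rpow_def_of_pos ht']
  congr 2
  simp only [NNReal.coe_mul, NNReal.coe_natCast, Real.coe_toNNReal _ (sq_nonneg σ)]
  field_simp

lemma measureReal_not_mem_confSet_le [IsFiniteMeasure P] {μ : Fin K → Θ → ℝ} {θs : Θ}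
    (hX : IsRewardTable P X (fun k => μ k θs) σ) (hσ : σ ≠ 0) (hα : 0 ≤ α)
    (arm : ℕ → Ω → Fin K) {t : ℕ} (ht : 0 < t) :
    P.real {ω | θs ∉ confSet μ α σ X arm t ω} ≤ 2 * K * (t : ℝ) ^ (1 - α) := by
  have hsub : {ω | θs ∉ confSet μ α σ X arm t ω} ⊆
      ⋃ p ∈ (Finset.univ : Finset (Fin K)) ×ˢ Finset.Icc 1 t,
        {ω | width α σ t p.2 ≤ |μ p.1 θs - (∑ i ∈ Finset.range p.2, X p.1 i ω) / p.2|} := by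
    intro ω hω
    simp only [confSet, Set.mem_ofPred_eq, not_forall, not_lt] at hω
    obtain ⟨k, hk, h⟩ := hω
    exact Set.mem_biUnion (x := (k, pulls arm k t ω)) (by simpa using ⟨hk, pulls_le⟩) h
  calc P.real {ω | θs ∉ confSet μ α σ X arm t ω}
      ≤ ∑ p ∈ (Finset.univ : Finset (Fin K)) ×ˢ Finset.Icc 1 t, P.real
          {ω | width α σ t p.2 ≤ |μ p.1 θs - (∑ i ∈ Finset.range p.2, X p.1 i ω) / p.2|} :=
        (measureReal_mono hsub (measure_ne_top _ _)).trans (measureReal_biUnion_finset_le _ _)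
    _ ≤ ∑ _p ∈ (Finset.univ : Finset (Fin K)) ×ˢ Finset.Icc 1 t, 2 * (t : ℝ) ^ (-α) := by
        refine Finset.sum_le_sum fun p hp => ?_
        have hp' : 1 ≤ p.2 := (Finset.mem_Icc.1 (Finset.mem_product.1 hp).2).1
        exact hX.measureReal_width_le_abs_le hσ hα p.1 ht hp'
    _ = 2 * K * (t : ℝ) ^ (1 - α) := by
        rw [sub_eq_add_neg, Real.rpow_add (by exact_mod_cast ht), Real.rpow_one]
        simp only [Finset.sum_const, Finset.card_product, Finset.card_univ, Fintype.card_fin,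
          Nat.card_Icc, add_tsub_cancel_right, nsmul_eq_mul, Nat.cast_mul]
        ring

lemma measureReal_exists_not_mem_confSet_le [IsFiniteMeasure P] {μ : Fin K → Θ → ℝ} {θs : Θ}
    (hX : IsRewardTable P X (fun k => μ k θs) σ) (hσ : σ ≠ 0) (hα : 0 ≤ α)
    (arm : ℕ → Ω → Fin K) (S : Finset ℕ) (hS : ∀ s ∈ S, 0 < s) :
    P.real {ω | ∃ s ∈ S, θs ∉ confSet μ α σ X arm s ω} ≤ ∑ s ∈ S, 2 * K * (s : ℝ) ^ (1 - α) := by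
  have hunion : {ω | ∃ s ∈ S, θs ∉ confSet μ α σ X arm s ω}
      = ⋃ s ∈ S, {ω | θs ∉ confSet μ α σ X arm s ω} := by
    ext
    simp
  rw [hunion]
  exact (measureReal_biUnion_finset_le _ _).trans
    (Finset.sum_le_sum fun s hs => measureReal_not_mem_confSet_le hX hσ hα arm (hS s hs))

end Concentration

section Series

lemma log_div_self_le {τ t : ℕ} (hτ : 2 ≤ τ) (ht : 2 * τ ≤ t) :
    Real.log t / t ≤ Real.log τ / τ := by
  have hanti : ∀ a b : ℕ, 3 ≤ a → a ≤ b → Real.log b / b ≤ Real.log a / a := by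
    intro a b ha hab
    have he : Real.exp 1 ≤ a := Real.exp_one_lt_three.le.trans (by exact_mod_cast ha)
    have hab' : (a : ℝ) ≤ b := by exact_mod_cast hab
    exact Real.log_div_self_antitoneOn he (he.trans hab') hab'
  rcases hτ.eq_or_lt with rfl | h
  -- `log x / x` increases up to `e`, but it takes the same value at `2` and at `4`.
  · have hfour : Real.log (4 : ℕ) / (4 : ℕ) = Real.log (2 : ℕ) / (2 : ℕ) := by
      rw [show ((4 : ℕ) : ℝ) = 2 ^ 2 by norm_num, Real.log_pow]
      push_cast
      ring
    exact (hanti 4 t (by norm_num) (by omega)).trans_eq hfour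
  · exact hanti τ t h (by omega)

lemma tendsto_sqrt_log_div (c d : ℝ) :
    Tendsto (fun τ : ℕ => c * Real.sqrt (d * (Real.log τ / τ))) atTop (nhds 0) := by
  have h : Tendsto (fun x : ℝ => Real.log x / x) atTop (nhds 0) :=
    Real.isLittleO_log_id_atTop.tendsto_div_nhds_zero
  simpa using (((h.comp tendsto_natCast_atTop_atTop).const_mul d).sqrt).const_mul c

lemma sum_Ico_mul_div_le {K a T : ℕ} (hK : 0 < K) {f : ℕ → ℝ} (hf : ∀ t, 0 ≤ f t) :
    ∑ t ∈ Finset.Ico (K * a) T, f (K * (t / K)) ≤ K * ∑ t ∈ Finset.Icc (K * a) T, f t := by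
  have hmaps : ∀ t ∈ Finset.Ico (K * a) T, K * (t / K) ∈ Finset.Icc (K * a) T := by
    intro t ht
    rw [Finset.mem_Ico] at ht
    rw [Finset.mem_Icc]
    refine ⟨Nat.mul_le_mul_left K ((Nat.le_div_iff_mul_le hK).2 ?_), ?_⟩
    · rw [mul_comm]
      exact ht.1
    · exact (Nat.mul_div_le t K).trans ht.2.le
  have hfiber : ∀ u, ((Finset.Ico (K * a) T).filter (fun t => K * (t / K) = u)).card ≤ K := by
    intro u
    refine (Finset.card_le_card (t := Finset.Ico u (u + K)) fun t ht => ?_).trans_eq (by simp)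
    have hu := (Finset.mem_filter.1 ht).2
    have hdiv := Nat.div_add_mod t K
    have hmod := Nat.mod_lt t hK
    rw [Finset.mem_Ico]
    omega
  rw [← Finset.sum_fiberwise_of_maps_to hmaps, Finset.mul_sum]
  refine Finset.sum_le_sum fun u _ => ?_
  rw [Finset.sum_congr rfl fun t ht => congrArg f (Finset.mem_filter.1 ht).2, Finset.sum_const,
    nsmul_eq_mul]
  exact mul_le_mul_of_nonneg_right (by exact_mod_cast hfiber u) (hf u)

lemma sum_rpow_le_tsum {p : ℝ} (hp : p < -1) (S : Finset ℕ) :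
    ∑ t ∈ S, (t : ℝ) ^ p ≤ ∑' t : ℕ, (t : ℝ) ^ p :=
  (Real.summable_nat_rpow.2 hp).sum_le_tsum _ fun t _ => by positivity

lemma sum_div_rpow_le {p : ℝ} (hp : p < -1) (K : ℕ) (S : Finset ℕ) :
    ∑ t ∈ S, ((t : ℝ) / K) ^ p ≤ (∑' t : ℕ, (t : ℝ) ^ p) / (K : ℝ) ^ p := by
  simp_rw [fun t : ℕ => Real.div_rpow (Nat.cast_nonneg' (α := ℝ) t) (Nat.cast_nonneg' K) p]
  rw [← Finset.sum_div]
  gcongr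
  exact sum_rpow_le_tsum hp S

lemma isBigO_one_of_nonneg_of_le {f : ℕ → ℝ} {C : ℝ} (h0 : ∀ T, 0 ≤ f T)
    (hC : ∀ T, f T ≤ C) : f =O[atTop] (fun _ => (1 : ℝ)) :=
  IsBigO.of_bound C (Eventually.of_forall fun T => by
    rw [Real.norm_of_nonneg (h0 T)]
    simpa using hC T)

lemma ucbBound_isBigO_one (K : ℕ) {α : ℝ} (hα : 3 < α) (t₀ : ℕ) :
    (fun T => ucbBound K α t₀ T) =O[atTop] (fun _ => (1 : ℝ)) := by
  refine isBigO_one_of_nonneg_of_le (C := K * t₀ + 2 * K * (∑' t : ℕ, (t : ℝ) ^ (1 - α))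
    + (K : ℝ) ^ 3 * (6 * ((∑' t : ℕ, (t : ℝ) ^ (2 - α)) / (K : ℝ) ^ (2 - α))))
    (fun T => ?_) fun T => ?_
  · unfold ucbBound
    positivity
  · unfold ucbBound
    rw [← Finset.mul_sum, ← Finset.mul_sum]
    gcongr
    · exact sum_rpow_le_tsum (by linarith) _
    · exact sum_div_rpow_le (by linarith) K _

lemma tsBound_isBigO_one (K : ℕ) {α β : ℝ} (hα : 3 < α) (hβ : 1 < β) (tb : ℕ) :
    (fun T => tsBound K α β tb T) =O[atTop] (fun _ => (1 : ℝ)) := by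
  refine isBigO_one_of_nonneg_of_le (C := K * tb + 2 * K * (∑' t : ℕ, (t : ℝ) ^ (1 - α))
    + (K : ℝ) ^ 3 * (4 * ((∑' t : ℕ, (t : ℝ) ^ (2 - α)) / (K : ℝ) ^ (2 - α)))
    + (K : ℝ) ^ 2 * ((∑' t : ℕ, (t : ℝ) ^ (1 - 2 * β)) / (K : ℝ) ^ (1 - 2 * β)))
    (fun T => ?_) fun T => ?_
  · unfold tsBound
    positivity
  · unfold tsBound
    rw [← Finset.mul_sum, ← Finset.mul_sum]
    gcongr
    · exact sum_rpow_le_tsum (by linarith) _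
    · exact sum_div_rpow_le (by linarith) K _
    · exact sum_div_rpow_le (by linarith) K _

end Series

section EventSums

variable {Ω : Type*} [MeasurableSpace Ω] {P : Measure Ω} [IsProbabilityMeasure P]

lemma sum_range_measureReal_le_add_sum_Ico (A : ℕ → Set Ω) (a T : ℕ) :
    ∑ t ∈ Finset.range T, P.real (A t) ≤ a + ∑ t ∈ Finset.Ico a T, P.real (A t) := by
  have hsub : Finset.range T ⊆ Finset.range a ∪ Finset.Ico a T := by
    intro t ht
    simp only [Finset.mem_union, Finset.mem_range, Finset.mem_Ico] at ht ⊢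
    omega
  have hfirst : ∑ t ∈ Finset.range a, P.real (A t) ≤ a := by
    simpa using Finset.sum_le_sum fun t (_ : t ∈ Finset.range a) =>
      measureReal_le_one (μ := P) (s := A t)
  have hdisj : Disjoint (Finset.range a) (Finset.Ico a T) := by
    rw [Finset.range_eq_Ico]
    exact Finset.Ico_disjoint_Ico_consecutive 0 a T
  calc ∑ t ∈ Finset.range T, P.real (A t)
      ≤ ∑ t ∈ Finset.range a ∪ Finset.Ico a T, P.real (A t) :=
        Finset.sum_le_sum_of_subset_of_nonneg hsub fun _ _ _ => measureReal_nonneg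
    _ ≤ a + ∑ t ∈ Finset.Ico a T, P.real (A t) := by
        rw [Finset.sum_union hdisj]
        linarith

lemma one_le_div_rpow {K a t : ℕ} (hK : 0 < K) (ha : 0 < a) (ht : K * a ≤ t) {p : ℝ}
    (hp : 0 ≤ p) : 1 ≤ ((t : ℝ) / K) ^ p := by
  refine Real.one_le_rpow ((one_le_div (by exact_mod_cast hK)).2 ?_) hp
  exact_mod_cast (Nat.le_mul_of_pos_right K ha).trans ht

lemma sum_measureReal_le_of_le_two (A : ℕ → Set Ω) {K a : ℕ} (hK : 0 < K) (ha : 0 < a) {α c : ℝ}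
    (hα : α ≤ 2) (hc : 1 ≤ c) (T : ℕ) :
    ∑ t ∈ Finset.range T, P.real (A t)
      ≤ K * a + (K : ℝ) ^ 3 * ∑ t ∈ Finset.Icc (K * a) T, c * ((t : ℝ) / K) ^ (2 - α) := by
  have hK3 : (1 : ℝ) ≤ (K : ℝ) ^ 3 := one_le_pow₀ (by exact_mod_cast hK)
  refine (sum_range_measureReal_le_add_sum_Ico A (K * a) T).trans ?_
  rw [Finset.mul_sum]
  push_cast
  refine add_le_add_right ?_ _
  calc ∑ t ∈ Finset.Ico (K * a) T, P.real (A t)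
      ≤ ∑ t ∈ Finset.Ico (K * a) T, (K : ℝ) ^ 3 * (c * ((t : ℝ) / K) ^ (2 - α)) := by
        refine Finset.sum_le_sum fun t ht => measureReal_le_one.trans ?_
        have hrpow := one_le_div_rpow hK ha (Finset.mem_Ico.1 ht).1 (sub_nonneg.2 hα)
        exact one_le_mul_of_one_le_of_one_le hK3 (one_le_mul_of_one_le_of_one_le hc hrpow)
    _ ≤ ∑ t ∈ Finset.Icc (K * a) T, (K : ℝ) ^ 3 * (c * ((t : ℝ) / K) ^ (2 - α)) :=
        Finset.sum_le_sum_of_subset_of_nonneg Finset.Ico_subset_Icc_self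
          fun _ _ _ => by positivity

end EventSums

section Thresholds

variable {Θ : Type*} {K : ℕ} {μ : Fin K → Θ → ℝ} {θs : Θ} {ks k : Fin K} {α β σ : ℝ}

/-- Both `Δ_min` and `ε_k` are at least `D`. This is the condition that the thresholds `t_0` and
`t_b` impose on the accuracy `D` of the estimates. -/
def IsSeparated (μ : Fin K → Θ → ℝ) (θs : Θ) (ks k : Fin K) (D : ℝ) : Prop :=
  D ≤ gapMin μ θs ks ∧ ENNReal.ofReal D ≤ degree μ θs ks k

lemma NonCompetitive.eventually_isSeparated (hks : ∀ l, l ≠ ks → μ l θs < μ ks θs)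
    (hk : NonCompetitive μ θs ks k) {f : ℕ → ℝ} (hf : Tendsto f atTop (nhds 0)) :
    ∀ᶠ τ in atTop, IsSeparated μ θs ks k (f τ) := by
  have hne : k ≠ ks := hk.ne (isOptimal_of_forall_ne_lt hks)
  have hf' : Tendsto (fun τ => ENNReal.ofReal (f τ)) atTop (nhds 0) := by
    simpa using ENNReal.tendsto_ofReal hf
  filter_upwards [hf.eventually_le_const (gapMin_pos hks hne),
    hf'.eventually_le_const (degree_pos hk)] with τ hgap hdeg
  exact ⟨hgap, hdeg⟩

lemma tZero_spec (hks : ∀ l, l ≠ ks → μ l θs < μ ks θs) (hk : NonCompetitive μ θs ks k) :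
    2 ≤ tZero μ θs ks k α σ ∧
    IsSeparated μ θs ks k (4 * Real.sqrt (K * α * σ ^ 2 *
      Real.log (tZero μ θs ks k α σ) / (tZero μ θs ks k α σ))) := by
  have hlim := tendsto_sqrt_log_div 4 (K * α * σ ^ 2)
  simp only [← mul_div_assoc] at hlim
  exact Nat.sInf_mem
    ((eventually_ge_atTop 2).and (hk.eventually_isSeparated hks hlim)).exists

lemma tB_spec (hks : ∀ l, l ≠ ks → μ l θs < μ ks θs) (hk : NonCompetitive μ θs ks k)
    (hβ : 0 < β) (hσ : σ ≠ 0) :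
    2 ≤ tB μ θs ks k α β σ ∧
    IsSeparated μ θs ks k (3 * Real.sqrt (3 * (K * α * σ ^ 2 *
      Real.log (tB μ θs ks k α β σ) / (tB μ θs ks k α β σ)))) := by
  have hlim := tendsto_sqrt_log_div 3 (3 * (K * α * σ ^ 2))
  simp only [mul_assoc (3 : ℝ) (K * α * σ ^ 2), ← mul_div_assoc (K * α * σ ^ 2)] at hlim
  have hmem := Nat.sInf_mem ((tendsto_natCast_atTop_atTop.eventually_ge_atTop
    (Real.exp (11 * β * σ ^ 2))).and (hk.eventually_isSeparated hks hlim)).exists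
  have hone : (1 : ℝ) < tB μ θs ks k α β σ :=
    (Real.one_lt_exp_iff.2 (by positivity)).trans_le hmem.1
  exact ⟨by exact_mod_cast hone, hmem.2⟩

end Thresholds

section UCB

variable {Θ Ω : Type*} {K : ℕ} {μ : Fin K → Θ → ℝ} {θs : Θ} {ks k l : Fin K} {α σ : ℝ}
  {X : Fin K → ℕ → Ω → ℝ} {arm : ℕ → Ω → Fin K} {t : ℕ} {ω : Ω}

lemma exists_ne_and_lt_mul_pulls (h : K * pulls arm ks t ω < t) :
    ∃ l, l ≠ ks ∧ t < K * pulls arm l t ω := by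
  by_contra! hcon
  have hlt : ∑ l, K * pulls arm l t ω < ∑ _l : Fin K, t := by
    refine Finset.sum_lt_sum (fun l _ => ?_) ⟨ks, Finset.mem_univ _, h⟩
    rcases eq_or_ne l ks with rfl | hl
    · exact h.le
    · exact hcon l hl
  rw [← Finset.mul_sum, sum_pulls] at hlt
  simp at hlt

lemma two_mul_width_le {t₀ n : ℕ} (hα : 0 ≤ α) (ht₀ : 2 ≤ t₀) (ht : 2 * t₀ ≤ t)
    (hn : t ≤ 2 * K * n) :
    2 * width α σ t n ≤ 4 * Real.sqrt (K * α * σ ^ 2 * Real.log t₀ / t₀) := by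
  have htp : (0 : ℝ) < t := by
    exact_mod_cast (show 0 < t by omega)
  have hnp : (0 : ℝ) < n := by
    exact_mod_cast Nat.pos_of_ne_zero fun h => by simp [h] at hn; omega
  have hlog := Real.log_natCast_nonneg t
  have hlogn : Real.log t / n ≤ 2 * K * (Real.log t₀ / t₀) :=
    calc Real.log t / n ≤ 2 * K * (Real.log t / t) := by
          rw [div_le_iff₀ hnp, mul_div_assoc', div_mul_eq_mul_div, le_div_iff₀ htp]
          nlinarith [mul_le_mul_of_nonneg_left (by exact_mod_cast hn : (t : ℝ) ≤ 2 * K * n) hlog]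
      _ ≤ 2 * K * (Real.log t₀ / t₀) := by
          gcongr ?_ * ?_
          exact log_div_self_le ht₀ ht
  refine abs_le_of_sq_le_sq' ?_ (by positivity) |>.2
  rw [mul_pow, width_sq hα, mul_pow, Real.sq_sqrt (by positivity)]
  calc 2 ^ 2 * (2 * α * σ ^ 2 * Real.log t / n) = 8 * α * σ ^ 2 * (Real.log t / n) := by ring
    _ ≤ 8 * α * σ ^ 2 * (2 * K * (Real.log t₀ / t₀)) := by gcongr
    _ = 4 ^ 2 * (K * α * σ ^ 2 * Real.log t₀ / t₀) := by ring

lemma le_two_mul_mul_div (hK : 0 < K) (h : K ≤ t) : t ≤ 2 * K * (t / K) := by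
  have hdiv := Nat.div_add_mod t K
  have hmod := Nat.mod_lt t hK
  have hle : K * 1 ≤ K * (t / K) := Nat.mul_le_mul_left K (Nat.div_pos h hK)
  rw [mul_assoc]
  omega

lemma sum_Ico_div_rpow_le (hK : 0 < K) (h : K ≤ t) (hα : 1 ≤ α) :
    ∑ s ∈ Finset.Ico (t / K) t, 2 * K * (s : ℝ) ^ (1 - α)
      ≤ 4 * K ^ 2 * ((t / K : ℕ) : ℝ) ^ (2 - α) := by
  have hm : (0 : ℝ) < ((t / K : ℕ) : ℝ) := by exact_mod_cast Nat.div_pos h hK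
  have hcard : ((t - t / K : ℕ) : ℝ) ≤ 2 * K * ((t / K : ℕ) : ℝ) := by
    exact_mod_cast (Nat.sub_le _ _).trans (le_two_mul_mul_div hK h)
  calc ∑ s ∈ Finset.Ico (t / K) t, 2 * K * (s : ℝ) ^ (1 - α)
      ≤ ∑ _s ∈ Finset.Ico (t / K) t, 2 * K * ((t / K : ℕ) : ℝ) ^ (1 - α) := by
        refine Finset.sum_le_sum fun s hs => ?_
        have hs' : ((t / K : ℕ) : ℝ) ≤ s := by exact_mod_cast (Finset.mem_Ico.1 hs).1
        exact mul_le_mul_of_nonneg_left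
          (Real.rpow_le_rpow_of_nonpos hm hs' (by linarith)) (by positivity)
    _ = ((t - t / K : ℕ) : ℝ) * (2 * K * ((t / K : ℕ) : ℝ) ^ (1 - α)) := by
        rw [Finset.sum_const, nsmul_eq_mul, Nat.card_Ico]
    _ ≤ 2 * K * ((t / K : ℕ) : ℝ) * (2 * K * ((t / K : ℕ) : ℝ) ^ (1 - α)) := by gcongr
    _ = 4 * K ^ 2 * ((t / K : ℕ) : ℝ) ^ (2 - α) := by
        rw [show (2 : ℝ) - α = 1 + (1 - α) by ring, Real.rpow_add hm, Real.rpow_one]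
        ring

variable [MeasurableSpace Ω] {P : Measure Ω}

lemma IsUCBC.gap_lt_two_mul_width (harm : IsUCBC μ α σ X arm) (hopt : IsOptimal μ θs ks)
    (hg : θs ∈ confSet μ α σ X arm t ω) (hl : arm t ω = l) (hn : 0 < pulls arm l t ω) :
    μ ks θs - μ l θs < 2 * width α σ t (pulls arm l t ω) := by
  have hidx := harm.argmax t ω ks (hopt.mem_competitiveSet hg)
  rw [hl, ucbIndex, ucbIndex, if_neg hn.ne'] at hidx
  split_ifs at hidx with hks
  · exact absurd hidx (not_le.2 (EReal.coe_lt_top _))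
  · rw [EReal.coe_le_coe_iff] at hidx
    have hdev := abs_lt.1 (hg ks (Nat.pos_of_ne_zero hks))
    have hdev' := abs_lt.1 (hg l hn)
    linarith

lemma IsUCBC.arm_ne_of_forall_mem_confSet (harm : IsUCBC μ α σ X arm) (hopt : IsOptimal μ θs ks)
    (hα : 0 ≤ α) {t₀ : ℕ} (ht₀ : 2 ≤ t₀) (hne : k ≠ ks)
    (hsep : IsSeparated μ θs ks k (4 * Real.sqrt (K * α * σ ^ 2 * Real.log t₀ / t₀)))
    (ht : K * t₀ ≤ t) (hg : ∀ s ∈ Finset.Icc (t / K) t, θs ∈ confSet μ α σ X arm s ω) :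
    arm t ω ≠ k := by
  intro hk
  have hK := two_le_of_ne hne
  have ht2 : 2 * t₀ ≤ t := (Nat.mul_le_mul_right t₀ hK).trans ht
  rcases le_or_gt t (K * pulls arm ks t ω) with hn | hn
  · have hpos : 0 < pulls arm ks t ω := Nat.pos_of_ne_zero fun h => by simp [h] at hn; omega
    have hwide := lt_two_mul_width_of_mem_competitiveSet hsep.2
      (hg t (Finset.mem_Icc.2 ⟨Nat.div_le_self t K, le_rfl⟩)) (hk ▸ harm.mem t ω) hpos
    have hnarrow := two_mul_width_le (σ := σ) (K := K) hα ht₀ ht2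
      (n := pulls arm ks t ω) (by nlinarith)
    linarith
  · obtain ⟨l, hl, hlt⟩ := exists_ne_and_lt_mul_pulls hn
    have hm : t / K < pulls arm l t ω := by
      rw [Nat.div_lt_iff_lt_mul (by omega)]
      linarith
    obtain ⟨s, hst, hsl, hsm⟩ := exists_lt_arm_eq_and_pulls_eq hm
    have hKt : K ≤ t := (Nat.le_mul_of_pos_right K (by omega)).trans ht
    have hwide := harm.gap_lt_two_mul_width hopt
      (hg s (Finset.mem_Icc.2 ⟨hsm ▸ pulls_le, hst.le⟩)) hsl
      (hsm ▸ Nat.div_pos hKt (by omega))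
    have hmono := width_mono (σ := σ) hα hst.le (pulls arm l s ω)
    have hnarrow := two_mul_width_le (σ := σ) (K := K) hα ht₀ ht2 (n := pulls arm l s ω)
      (hsm ▸ le_two_mul_mul_div (by omega) hKt)
    linarith [hsep.1, gapMin_le (μ := μ) (θs := θs) hl]

variable [IsProbabilityMeasure P]

lemma IsUCBC.measureReal_arm_eq_le (harm : IsUCBC μ α σ X arm)
    (hX : IsRewardTable P X (fun k => μ k θs) σ) (hopt : IsOptimal μ θs ks) (hσ : σ ≠ 0)
    (hα : 1 ≤ α) {t₀ : ℕ} (ht₀ : 2 ≤ t₀) (hne : k ≠ ks)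
    (hsep : IsSeparated μ θs ks k (4 * Real.sqrt (K * α * σ ^ 2 * Real.log t₀ / t₀)))
    (ht : K * t₀ ≤ t) :
    P.real {ω | arm t ω = k} ≤
      2 * K * (t : ℝ) ^ (1 - α) + 4 * K ^ 2 * ((t / K : ℕ) : ℝ) ^ (2 - α) := by
  have hK := two_le_of_ne hne
  have hKt : K ≤ t := (Nat.le_mul_of_pos_right K (by omega)).trans ht
  have hα0 : 0 ≤ α := zero_le_one.trans hα
  have hbad : {ω | arm t ω = k} ⊆ {ω | θs ∉ confSet μ α σ X arm t ω} ∪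
      {ω | ∃ s ∈ Finset.Ico (t / K) t, θs ∉ confSet μ α σ X arm s ω} := by
    intro ω hω
    by_contra hcon
    simp only [Set.mem_union, Set.mem_ofPred_eq, not_or, not_not, not_exists, not_and] at hcon
    refine harm.arm_ne_of_forall_mem_confSet hopt hα0 ht₀ hne hsep ht (fun s hs => ?_) hω
    rw [Finset.mem_Icc] at hs
    rcases hs.2.lt_or_eq with h | rfl
    · exact hcon.2 s (Finset.mem_Ico.2 ⟨hs.1, h⟩)
    · exact hcon.1
  refine (measureReal_mono hbad (measure_ne_top _ _)).trans
    ((measureReal_union_le _ _).trans (add_le_add ?_ ?_))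
  · exact measureReal_not_mem_confSet_le hX hσ hα0 arm (by omega)
  · refine (measureReal_exists_not_mem_confSet_le hX hσ hα0 arm _ fun s hs => ?_).trans
      (sum_Ico_div_rpow_le (by omega) hKt hα)
    exact (Nat.div_pos hKt (by omega)).trans_le (Finset.mem_Ico.1 hs).1

lemma IsUCBC.integral_pulls_le (harm : IsUCBC μ α σ X arm)
    (hX : IsRewardTable P X (fun k => μ k θs) σ) (hopt : IsOptimal μ θs ks) (hσ : σ ≠ 0)
    {t₀ : ℕ} (ht₀ : 2 ≤ t₀) (hne : k ≠ ks)
    (hsep : IsSeparated μ θs ks k (4 * Real.sqrt (K * α * σ ^ 2 * Real.log t₀ / t₀)))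
    (T : ℕ) :
    ∫ ω, (pulls arm k T ω : ℝ) ∂P ≤ ucbBound K α t₀ T := by
  have hK := two_le_of_ne hne
  rw [integral_pulls fun t => harm.measurable t, ucbBound]
  rcases le_or_gt α 2 with hα2 | hα2
  · have htriv := sum_measureReal_le_of_le_two (P := P) (fun t => {ω | arm t ω = k})
      (K := K) (a := t₀) (by omega) (by omega) hα2 (c := 6) (by norm_num) T
    have hpos : 0 ≤ ∑ t ∈ Finset.Icc 1 T, 2 * K * (t : ℝ) ^ (1 - α) := by positivity
    linarith
  have hround : ∀ t ∈ Finset.Ico (K * t₀) T, P.real {ω | arm t ω = k} ≤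
      2 * K * (t : ℝ) ^ (1 - α) + 4 * K ^ 2 * (((K * (t / K) : ℕ) : ℝ) / K) ^ (2 - α) := by
    intro t ht
    rw [Nat.cast_mul, mul_div_cancel_left₀ _ (by exact_mod_cast (show K ≠ 0 by omega))]
    exact harm.measureReal_arm_eq_le hX hopt hσ (by linarith) ht₀ hne hsep (Finset.mem_Ico.1 ht).1
  have hcurrent : ∑ t ∈ Finset.Ico (K * t₀) T, 2 * K * (t : ℝ) ^ (1 - α) ≤
      ∑ t ∈ Finset.Icc 1 T, 2 * K * (t : ℝ) ^ (1 - α) := by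
    refine Finset.sum_le_sum_of_subset_of_nonneg (fun t ht => ?_) fun _ _ _ => by positivity
    rw [Finset.mem_Ico] at ht
    rw [Finset.mem_Icc]
    exact ⟨by nlinarith, ht.2.le⟩
  have hearlier : ∑ t ∈ Finset.Ico (K * t₀) T,
      4 * K ^ 2 * (((K * (t / K) : ℕ) : ℝ) / K) ^ (2 - α) ≤
      (K : ℝ) ^ 3 * ∑ t ∈ Finset.Icc (K * t₀) T, 6 * ((t : ℝ) / K) ^ (2 - α) := by
    refine (sum_Ico_mul_div_le (by omega) (f := fun t => 4 * K ^ 2 * ((t : ℝ) / K) ^ (2 - α))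
      fun t => by positivity).trans ?_
    rw [Finset.mul_sum, Finset.mul_sum]
    refine Finset.sum_le_sum fun t _ => ?_
    have : 0 ≤ (K : ℝ) ^ 3 * ((t : ℝ) / K) ^ (2 - α) := by positivity
    linarith
  have hsplit := sum_range_measureReal_le_add_sum_Ico (P := P) (fun t => {ω | arm t ω = k})
    (K * t₀) T
  have hsum := Finset.sum_le_sum hround
  rw [Finset.sum_add_distrib] at hsum
  push_cast at hsplit
  linarith

end UCB

section Gaussian

/-- The standard Gaussian measure on the line. -/
noncomputable abbrev stdGauss : Measure ℝ := gaussianReal 0 1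

/-- The law of two independent standard Gaussian variables: the noise of the two samples that are
compared in a duel. -/
noncomputable abbrev stdGaussPair : Measure (ℝ × ℝ) := stdGauss.prod stdGauss

lemma measurePreserving_neg_stdGauss : MeasurePreserving (fun x : ℝ => -x) stdGauss stdGauss :=
  ⟨by fun_prop, by simpa using gaussianReal_map_neg (μ := 0) (v := 1)⟩

lemma half_le_stdGauss_Iic {x : ℝ} (hx : 0 ≤ x) : 1 / 2 ≤ stdGauss (Set.Iic x) := by
  have hsymm : stdGauss (Set.Ici 0) = stdGauss (Set.Iic 0) := by
    rw [← measurePreserving_neg_stdGauss.measure_preimage measurableSet_Ici.nullMeasurableSet]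
    congr 1
    ext y
    simp
  have hcover : 1 ≤ stdGauss (Set.Iic 0) + stdGauss (Set.Ici 0) := by
    rw [← measure_univ (μ := stdGauss), ← Set.Iic_union_Ici (a := (0 : ℝ))]
    exact measure_union_le _ _
  rw [hsymm, ← two_mul] at hcover
  refine le_trans ?_ (measure_mono (Set.Iic_subset_Iic.2 hx))
  rwa [ENNReal.div_le_iff_le_mul (by simp) (by simp), mul_comm]

lemma stdGauss_Ioi_pos (x : ℝ) : 0 < stdGauss (Set.Ioi x) := by
  rw [pos_iff_ne_zero]
  intro h
  have := gaussianReal_absolutelyContinuous' (0 : ℝ) (v := 1) one_ne_zero h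
  simp at this

lemma map_stdGaussPair_add {c d : ℝ} (h : c ^ 2 + d ^ 2 = 1) :
    stdGaussPair.map (fun g => c * g.1 + d * g.2) = stdGauss := by
  have hind : IndepFun (fun g : ℝ × ℝ => c * g.1) (fun g : ℝ × ℝ => d * g.2) stdGaussPair :=
    indepFun_prod (X := fun x : ℝ => c * x) (Y := fun x : ℝ => d * x) (by fun_prop) (by fun_prop)
  have hfst : stdGaussPair.map (fun g : ℝ × ℝ => c * g.1)
      = gaussianReal 0 (NNReal.mk (c ^ 2) (sq_nonneg _) * 1) := by
    rw [show (fun g : ℝ × ℝ => c * g.1) = (fun x : ℝ => c * x) ∘ Prod.fst from rfl,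
      ← Measure.map_map (by fun_prop) (by fun_prop), Measure.map_fst_prod,
      measure_univ, one_smul, gaussianReal_map_const_mul, mul_zero]
  have hsnd : stdGaussPair.map (fun g : ℝ × ℝ => d * g.2)
      = gaussianReal 0 (NNReal.mk (d ^ 2) (sq_nonneg _) * 1) := by
    rw [show (fun g : ℝ × ℝ => d * g.2) = (fun x : ℝ => d * x) ∘ Prod.snd from rfl,
      ← Measure.map_map (by fun_prop) (by fun_prop), Measure.map_snd_prod,
      measure_univ, one_smul, gaussianReal_map_const_mul, mul_zero]
  refine (gaussianReal_add_gaussianReal_of_indepFun hind hfst hsnd).trans ?_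
  rw [add_zero]
  congr 1
  ext
  simpa using h

-- A half-plane at distance `√(A² + x²)` from the origin contains the quadrant with corner `(A, x)`.
lemma stdGauss_Ici_mul_Ioi_le {A x B : ℝ} (hA : 0 ≤ A) (hx : 0 < x) (hB : B ^ 2 ≤ A ^ 2 + x ^ 2) :
    stdGauss (Set.Ici A) * stdGauss (Set.Ioi x) ≤ stdGauss (Set.Ici B) := by
  set N := Real.sqrt (A ^ 2 + x ^ 2)
  have hN2 : N ^ 2 = A ^ 2 + x ^ 2 := Real.sq_sqrt (by positivity)
  have hN : 0 < N := Real.sqrt_pos.2 (by positivity)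
  have hBN : B ≤ N := Real.le_sqrt_of_sq_le hB
  have hmap := map_stdGaussPair_add (c := A / N) (d := x / N) (by field_simp; linarith)
  rw [← Measure.prod_prod]
  conv_rhs => rw [← hmap, Measure.map_apply (by fun_prop) measurableSet_Ici]
  refine measure_mono ?_
  rintro ⟨g₁, g₂⟩ ⟨h₁ : A ≤ g₁, h₂ : x < g₂⟩
  change B ≤ A / N * g₁ + x / N * g₂
  calc B ≤ N := hBN
    _ = A / N * A + x / N * x := by field_simp; linarith
    _ ≤ A / N * g₁ + x / N * g₂ := by gcongr

end Gaussian

section Duel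

/-- The noise pairs for which the first of the samples `u + s₁ g₁` and `v + s₂ g₂` is at least the
second one and at least the best competing sample `a`. Ties count as wins. -/
def firstWins (u s₁ v s₂ : ℝ) (a : EReal) : Set (ℝ × ℝ) :=
  {g | v + s₂ * g.2 ≤ u + s₁ * g.1 ∧ a ≤ ((u + s₁ * g.1 : ℝ) : EReal)}

/-- The noise pairs for which the second of the samples `u + s₁ g₁` and `v + s₂ g₂` is larger than
the first one and the best competing sample `a`. Ties do not count as wins. -/
def secondWins (u s₁ v s₂ : ℝ) (a : EReal) : Set (ℝ × ℝ) :=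
  {g | u + s₁ * g.1 < v + s₂ * g.2 ∧ a < ((v + s₂ * g.2 : ℝ) : EReal)}

variable {u s₁ v s₂ y : ℝ} {a : EReal}

lemma measurableSet_firstWins : MeasurableSet (firstWins u s₁ v s₂ a) := by
  rw [firstWins, Set.ofPred_and]
  exact (measurableSet_le (by fun_prop) (by fun_prop)).inter
    (measurableSet_le measurable_const (by fun_prop))

lemma stdGaussPair_eq_snd_eq_zero {f : ℝ → ℝ} (hf : Measurable f) (hs₂ : s₂ ≠ 0) :
    stdGaussPair {g | f g.1 = v + s₂ * g.2} = 0 := by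
  have : NullSingletonClass stdGauss := nullSingletonClass_gaussianReal one_ne_zero
  rw [Measure.measure_prod_null (measurableSet_eq_fun (by fun_prop) (by fun_prop))]
  refine Eventually.of_forall fun x => ?_
  refine measure_mono_null (t := {(f x - v) / s₂}) (fun z hz => ?_) (measure_singleton _)
  simp only [Set.mem_preimage, Set.mem_ofPred_eq] at hz
  rw [Set.mem_singleton_iff, eq_div_iff hs₂]
  linarith

lemma measure_firstWins_swap_le (hs₂ : s₂ ≠ 0) :
    stdGaussPair (firstWins v s₂ u s₁ a) ≤ stdGaussPair (secondWins u s₁ v s₂ a) := by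
  have hsub : Prod.swap ⁻¹' firstWins v s₂ u s₁ a ⊆ secondWins u s₁ v s₂ a ∪
      ({g | u + s₁ * g.1 = v + s₂ * g.2} ∪ {g | a.toReal = v + s₂ * g.2}) := by
    rintro g ⟨hrival, hbest⟩
    rcases hrival.lt_or_eq with hlt | heq
    · rcases hbest.lt_or_eq with hlt' | heq'
      · exact Or.inl ⟨hlt, hlt'⟩
      · refine Or.inr (Or.inr ?_)
        rw [Set.mem_ofPred_eq, heq', EReal.toReal_coe]
        rfl
    · exact Or.inr (Or.inl heq)
  have hswap : MeasurePreserving Prod.swap stdGaussPair stdGaussPair :=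
    Measure.measurePreserving_swap
  rw [← hswap.measure_preimage measurableSet_firstWins.nullMeasurableSet]
  refine (measure_mono hsub).trans ((measure_union_le _ _).trans ?_)
  rw [measure_union_null (stdGaussPair_eq_snd_eq_zero (f := fun x => u + s₁ * x) (by fun_prop) hs₂)
    (stdGaussPair_eq_snd_eq_zero (f := fun _ => a.toReal) (by fun_prop) hs₂), add_zero]

lemma firstWins_subset_union (hs₁ : 0 < s₁) (hs : s₁ ≤ s₂) (huv : u ≤ v) :
    firstWins u s₁ v s₂ a ⊆ firstWins v s₂ u s₁ a ∪
      (fun g => (-g.2, g.1)) ⁻¹' firstWins v s₂ u s₁ a := by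
  rintro ⟨g₁, g₂⟩ ⟨hrival : v + s₂ * g₂ ≤ u + s₁ * g₁,
    hbest : a ≤ ((u + s₁ * g₁ : ℝ) : EReal)⟩
  rcases le_or_gt 0 g₁ with hg | hg
  · have hscale : s₁ * g₁ ≤ s₂ * g₁ := by gcongr
    have hwin : u + s₁ * g₂ ≤ v + s₂ * g₁ := by
      rcases le_or_gt g₂ g₁ with h | h
      · nlinarith [mul_le_mul_of_nonneg_left h hs₁.le]
      · nlinarith [mul_le_mul_of_nonneg_right hs (hg.trans h.le)]
    exact Or.inl ⟨hwin, hbest.trans (EReal.coe_le_coe_iff.2 (by simp only; linarith))⟩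
  · have hneg : s₁ * g₁ < 0 := mul_neg_of_pos_of_neg hs₁ hg
    exact Or.inr ⟨by simp only; linarith,
      hbest.trans (EReal.coe_le_coe_iff.2 (by simp only; linarith))⟩

lemma measure_firstWins_le_two_mul (hs₁ : 0 < s₁) (hs : s₁ ≤ s₂) (huv : u ≤ v) :
    stdGaussPair (firstWins u s₁ v s₂ a) ≤ 2 * stdGaussPair (secondWins u s₁ v s₂ a) := by
  have hrot : MeasurePreserving (fun g : ℝ × ℝ => (-g.2, g.1)) stdGaussPair stdGaussPair :=
    (measurePreserving_neg_stdGauss.prod (.id _)).comp Measure.measurePreserving_swap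
  refine (measure_mono (firstWins_subset_union hs₁ hs huv)).trans ((measure_union_le _ _).trans ?_)
  rw [hrot.measure_preimage measurableSet_firstWins.nullMeasurableSet, ← two_mul]
  exact mul_le_mul_right (measure_firstWins_swap_le (hs₁.trans_le hs).ne') 2

lemma measure_firstWins_bot_le (hs₂ : s₂ ≠ 0) (huv : u ≤ v) :
    stdGaussPair (firstWins u s₁ v s₂ ⊥) ≤ stdGaussPair (secondWins u s₁ v s₂ ⊥) := by
  have hreflect : MeasurePreserving (fun g : ℝ × ℝ => (-g.2, -g.1)) stdGaussPair stdGaussPair :=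
    (measurePreserving_neg_stdGauss.prod measurePreserving_neg_stdGauss).comp
      Measure.measurePreserving_swap
  refine le_trans ?_ (measure_firstWins_swap_le hs₂)
  rw [← hreflect.measure_preimage measurableSet_firstWins.nullMeasurableSet]
  refine measure_mono ?_
  rintro ⟨g₁, g₂⟩ ⟨hrival, -⟩
  simp only at hrival
  exact ⟨by simp only; linarith, bot_le⟩

lemma setOf_lt_add_mul (hs : 0 < s₂) (r : ℝ) :
    {g : ℝ | r < v + s₂ * g} = Set.Ioi ((r - v) / s₂) := by
  ext g
  rw [Set.mem_ofPred_eq, Set.mem_Ioi, div_lt_iff₀ hs, sub_lt_iff_lt_add', mul_comm]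

lemma stdGauss_lt_add_mul_le_two_mul (hs₁ : 0 < s₁) {r : ℝ} (hu : u ≤ r) (ha : a ≤ r) :
    stdGauss {g | r < v + s₂ * g} ≤ 2 * stdGaussPair (secondWins u s₁ v s₂ a) := by
  have hhalf : 1 / 2 ≤ stdGauss {g | u + s₁ * g ≤ r} := by
    refine (half_le_stdGauss_Iic (div_nonneg (sub_nonneg.2 hu) hs₁.le)).trans
      (measure_mono fun g hg => ?_)
    rw [Set.mem_Iic, le_div_iff₀ hs₁] at hg
    simp only [Set.mem_ofPred_eq]
    linarith
  have hsub : {g : ℝ | u + s₁ * g ≤ r} ×ˢ {g | r < v + s₂ * g} ⊆ secondWins u s₁ v s₂ a :=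
    fun g hg => ⟨lt_of_le_of_lt hg.1 hg.2, ha.trans_lt (EReal.coe_lt_coe_iff.2 hg.2)⟩
  calc stdGauss {g | r < v + s₂ * g} = 2 * (1 / 2 * stdGauss {g | r < v + s₂ * g}) := by
        rw [← mul_assoc, one_div, ENNReal.mul_inv_cancel (by simp) (by simp), one_mul]
    _ ≤ 2 * (stdGauss {g | u + s₁ * g ≤ r} * stdGauss {g | r < v + s₂ * g}) := by gcongr
    _ = 2 * stdGaussPair ({g : ℝ | u + s₁ * g ≤ r} ×ˢ {g | r < v + s₂ * g}) := by
        rw [Measure.prod_prod]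
    _ ≤ 2 * stdGaussPair (secondWins u s₁ v s₂ a) := by gcongr

lemma measure_firstWins_coe_le (hs₁ : 0 < s₁) (r : ℝ) :
    stdGaussPair (firstWins u s₁ v s₂ r) ≤ stdGauss (Set.Ici ((r - u) / s₁)) := by
  have hsub : firstWins u s₁ v s₂ r ⊆ Set.Ici ((r - u) / s₁) ×ˢ Set.univ := by
    rintro g ⟨-, hbest⟩
    rw [EReal.coe_le_coe_iff] at hbest
    exact ⟨by rw [Set.mem_Ici, div_le_iff₀ hs₁]; linarith, trivial⟩
  simpa using measure_mono (μ := stdGaussPair) hsub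

lemma div_sq_le_add_div_sq {r : ℝ} (hs₁ : 0 < s₁) (hs : s₁ ≤ s₂) (hr : y ≤ r)
    (hratio : (y - v) / s₂ ^ 2 ≤ (y - u) / s₁ ^ 2) :
    ((r - v) / s₂) ^ 2 ≤ ((r - u) / s₁) ^ 2 + ((y - v) / s₂) ^ 2 := by
  have hs₂ : 0 < s₂ := hs₁.trans_le hs
  have hinv : 1 / s₂ ^ 2 ≤ 1 / s₁ ^ 2 := by gcongr
  have hexpand : ∀ {s : ℝ}, 0 < s → ∀ w, ((r - w) / s) ^ 2 =
      ((y - w) / s) ^ 2 + 2 * (r - y) * ((y - w) / s ^ 2) + (r - y) ^ 2 * (1 / s ^ 2) := by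
    intro s hs w
    field_simp
    ring
  rw [hexpand hs₁, hexpand hs₂]
  have hlin := mul_le_mul_of_nonneg_left hratio (show 0 ≤ 2 * (r - y) by linarith)
  have hquad := mul_le_mul_of_nonneg_left hinv (sq_nonneg (r - y))
  linarith [sq_nonneg ((y - u) / s₁)]

lemma measure_firstWins_coe_mul_le (hs₁ : 0 < s₁) (hs : s₁ ≤ s₂) (hu : u ≤ y) (hv : v < y)
    (hratio : (y - v) / s₂ ^ 2 ≤ (y - u) / s₁ ^ 2) {r : ℝ} (hr : y ≤ r) :
    stdGaussPair (firstWins u s₁ v s₂ r) * stdGauss {g | y < v + s₂ * g} ≤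
      2 * stdGaussPair (secondWins u s₁ v s₂ r) := by
  have : NullSingletonClass stdGauss := nullSingletonClass_gaussianReal one_ne_zero
  have hs₂ : 0 < s₂ := hs₁.trans_le hs
  calc stdGaussPair (firstWins u s₁ v s₂ r) * stdGauss {g | y < v + s₂ * g}
      ≤ stdGauss (Set.Ici ((r - u) / s₁)) * stdGauss (Set.Ioi ((y - v) / s₂)) := by
        rw [setOf_lt_add_mul hs₂]
        gcongr
        exact measure_firstWins_coe_le hs₁ r
    _ ≤ stdGauss (Set.Ici ((r - v) / s₂)) :=
        stdGauss_Ici_mul_Ioi_le (div_nonneg (by linarith) hs₁.le) (div_pos (by linarith) hs₂)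
          (div_sq_le_add_div_sq hs₁ hs hr hratio)
    _ = stdGauss {g | r < v + s₂ * g} := by
        rw [setOf_lt_add_mul hs₂]
        exact measure_congr Ioi_ae_eq_Ici.symm
    _ ≤ 2 * stdGaussPair (secondWins u s₁ v s₂ r) :=
        stdGauss_lt_add_mul_le_two_mul hs₁ (hu.trans hr) le_rfl

lemma measure_firstWins_mul_le (hs₁ : 0 < s₁) (hu : u ≤ y) (hv : v < y)
    (h : a = ⊥ ∨ (s₁ ≤ s₂ ∧ (y - v) / s₂ ^ 2 ≤ (y - u) / s₁ ^ 2)) :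
    stdGaussPair (firstWins u s₁ v s₂ a) * stdGauss {g | y < v + s₂ * g} ≤
      2 * stdGaussPair (secondWins u s₁ v s₂ a) := by
  rcases le_or_gt a (y : EReal) with hay | hay
  · calc stdGaussPair (firstWins u s₁ v s₂ a) * stdGauss {g | y < v + s₂ * g}
        ≤ 1 * stdGauss {g | y < v + s₂ * g} := by gcongr; exact prob_le_one
      _ ≤ 2 * stdGaussPair (secondWins u s₁ v s₂ a) := by
        rw [one_mul]
        exact stdGauss_lt_add_mul_le_two_mul hs₁ hu hay
  obtain ⟨hs, hratio⟩ := h.resolve_left hay.ne_bot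
  induction a using EReal.rec with
  | bot => exact absurd hay not_lt_bot
  | top =>
    have hempty : firstWins u s₁ v s₂ ⊤ = ∅ :=
      Set.eq_empty_of_forall_notMem fun g hg => hg.2.not_gt (EReal.coe_lt_top _)
    simp [hempty]
  | coe r => exact measure_firstWins_coe_mul_le hs₁ hs hu hv hratio (EReal.coe_lt_coe_iff.1 hay).le

lemma measure_firstWins_le_div (hs₁ : 0 < s₁) (hs₂ : 0 < s₂) (hu : u ≤ y) (hv : v < y)
    (h : a = ⊥ ∨ (s₁ ≤ s₂ ∧ (y - v) / s₂ ^ 2 ≤ (y - u) / s₁ ^ 2)) :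
    stdGaussPair (firstWins u s₁ v s₂ a) ≤
      2 / stdGauss {g | y < v + s₂ * g} * stdGaussPair (secondWins u s₁ v s₂ a) := by
  have hpos : stdGauss {g | y < v + s₂ * g} ≠ 0 := by
    rw [setOf_lt_add_mul hs₂]
    exact (stdGauss_Ioi_pos _).ne'
  rw [← ENNReal.mul_div_right_comm,
    ENNReal.le_div_iff_mul_le (Or.inl hpos) (Or.inl (measure_ne_top _ _))]
  exact measure_firstWins_mul_le hs₁ hu hv h

end Duel

section Measurability

variable {Θ Ω : Type*} {K : ℕ} {μ : Fin K → Θ → ℝ} {θs : Θ} {ks k l m : Fin K}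
  {α β σ : ℝ} {X : Fin K → ℕ → Ω → ℝ} {G : ℕ → Fin K → Ω → ℝ} {arm : ℕ → Ω → Fin K} {t : ℕ} {ω : Ω}

lemma tsSample_of_pos (hm : 0 < pulls arm m t ω) :
    tsSample β σ X G arm m t ω =
      ((empMean X arm m t ω + √(β * σ ^ 2 / pulls arm m t ω) * G t m ω : ℝ) : EReal) :=
  if_neg hm.ne'

open Classical in
/-- The best competing sample in a duel between the arms `l` and `ks`: the largest Thompson sample
of the other competitive arms. When the true parameter leaves the confidence set it is `∞`, so that
`ks`, which then need not be competitive, does not win the duel. -/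
noncomputable def rivalSample (μ : Fin K → Θ → ℝ) (θs : Θ) (α β σ : ℝ) (X : Fin K → ℕ → Ω → ℝ)
    (G : ℕ → Fin K → Ω → ℝ) (arm : ℕ → Ω → Fin K) (l ks : Fin K) (t : ℕ) (ω : Ω) : EReal :=
  if θs ∈ confSet μ α σ X arm t ω then
    ⨆ m : {m : Fin K // m ∉ ({l, ks} : Finset (Fin K))},
      if m.1 ∈ competitiveSet μ α σ X arm t ω then tsSample β σ X G arm m.1 t ω else ⊥
  else ⊤

lemma rivalSample_eq_bot (hK : K = 2) (hl : l ≠ ks)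
    (hg : θs ∈ confSet μ α σ X arm t ω) : rivalSample μ θs α β σ X G arm l ks t ω = ⊥ := by
  rw [rivalSample, if_pos hg]
  have : IsEmpty {m : Fin K // m ∉ ({l, ks} : Finset (Fin K))} := by
    subst hK
    refine ⟨fun m => m.2 ?_⟩
    have hne : (l : ℕ) ≠ ks := fun h => hl (Fin.ext h)
    simp only [Finset.mem_insert, Finset.mem_singleton, Fin.ext_iff]
    omega
  exact iSup_of_empty _

variable [MeasurableSpace Ω]

lemma measurable_empMean (harm : ∀ r < t, Measurable (arm r)) (hX : ∀ k i, Measurable (X k i))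
    (k : Fin K) : Measurable (empMean X arm k t) := by
  have hmean : Measurable (fun p : ℕ × Ω => (∑ i ∈ Finset.range p.1, X k i p.2) / (p.1 : ℝ)) :=
    measurable_from_prod_countable_right fun n =>
      (Finset.measurable_sum (Finset.range n) fun i _ => hX k i).div_const (n : ℝ)
  exact hmean.comp ((measurable_pulls harm k).prodMk measurable_id)

-- `Θ` is arbitrary, so the union over `θ ∈ Q` may be uncountable; for given numbers of pulls it is
-- a union of open sets of empirical means.
lemma measurableSet_exists_mem_confSet (harm : ∀ r < t, Measurable (arm r))
    (hX : ∀ k i, Measurable (X k i)) (Q : Set Θ) :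
    MeasurableSet {ω | ∃ θ ∈ Q, θ ∈ confSet μ α σ X arm t ω} := by
  have hunion : {ω | ∃ θ ∈ Q, θ ∈ confSet μ α σ X arm t ω} =
      ⋃ n : Fin K → ℕ, {ω | (fun k => pulls arm k t ω) = n} ∩
        (fun ω k => empMean X arm k t ω) ⁻¹'
          (⋃ θ ∈ Q, ⋂ k, {x | 0 < n k → |μ k θ - x k| < width α σ t (n k)}) := by
    ext ω
    simp only [confSet, Set.mem_ofPred_eq, Set.mem_iUnion, Set.mem_inter_iff, Set.mem_preimage,
      Set.mem_iInter, exists_prop]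
    constructor
    · rintro ⟨θ, hθ, h⟩
      exact ⟨_, rfl, θ, hθ, h⟩
    · rintro ⟨n, rfl, θ, hθ, h⟩
      exact ⟨θ, hθ, h⟩
  rw [hunion]
  refine MeasurableSet.iUnion fun n => ?_
  refine (measurable_pi_lambda _ (fun k => measurable_pulls harm k)
    (measurableSet_singleton n)).inter ?_
  refine (measurable_pi_lambda _ fun k => measurable_empMean harm hX k) ?_
  refine (isOpen_biUnion fun θ _ => isOpen_iInter_of_finite fun k => ?_).measurableSet
  by_cases hn : 0 < n k
  · simp only [hn, true_imp_iff]
    exact isOpen_lt (by fun_prop) continuous_const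
  · simp [hn]

lemma measurableSet_mem_confSet (harm : ∀ r < t, Measurable (arm r))
    (hX : ∀ k i, Measurable (X k i)) (θ : Θ) :
    MeasurableSet {ω | θ ∈ confSet μ α σ X arm t ω} := by
  simpa using measurableSet_exists_mem_confSet (μ := μ) (α := α) (σ := σ) harm hX {θ}

lemma measurableSet_mem_competitiveSet (harm : ∀ r < t, Measurable (arm r))
    (hX : ∀ k i, Measurable (X k i)) (k : Fin K) :
    MeasurableSet {ω | k ∈ competitiveSet μ α σ X arm t ω} := by
  have hsplit : {ω | k ∈ competitiveSet μ α σ X arm t ω} =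
      {ω | ∃ θ ∈ Set.univ, θ ∈ confSet μ α σ X arm t ω}ᶜ ∪
      {ω | ∃ θ ∈ {θ | IsOptimal μ θ k}, θ ∈ confSet μ α σ X arm t ω} := by
    ext ω
    simp only [competitiveSet, Set.mem_ofPred_eq, Set.mem_union, Set.mem_compl_iff, Set.mem_univ,
      true_and, Set.eq_empty_iff_forall_notMem, not_exists]
    exact or_congr Iff.rfl (exists_congr fun θ => and_comm)
  rw [hsplit]
  exact (measurableSet_exists_mem_confSet harm hX _).compl.union
    (measurableSet_exists_mem_confSet harm hX _)

lemma measurable_tsSample (harm : ∀ r < t, Measurable (arm r)) (hX : ∀ k i, Measurable (X k i))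
    (hG : Measurable (G t k)) : Measurable (tsSample β σ X G arm k t) := by
  have hpulls := measurable_pulls harm k
  refine Measurable.ite (hpulls (measurableSet_singleton 0)) measurable_const ?_
  refine measurable_coe_real_ereal.comp ((measurable_empMean harm hX k).add (Measurable.mul ?_ hG))
  exact (measurable_from_top (f := fun n : ℕ => √(β * σ ^ 2 / (n : ℝ)))).comp hpulls

lemma measurable_rivalSample (harm : ∀ r < t, Measurable (arm r))
    (hX : ∀ k i, Measurable (X k i))
    (hG : ∀ m, m ∉ ({l, ks} : Finset (Fin K)) → Measurable (G t m)) :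
    Measurable (rivalSample μ θs α β σ X G arm l ks t) := by
  refine Measurable.ite (measurableSet_mem_confSet harm hX θs) ?_ measurable_const
  exact Measurable.iSup fun m => Measurable.ite (measurableSet_mem_competitiveSet harm hX m.1)
    (measurable_tsSample harm hX (hG m.1 m.2)) measurable_const

end Measurability

section Independence

variable {Ω : Type*} [MeasurableSpace Ω] {P : Measure Ω} [IsProbabilityMeasure P]

lemma indepFun_comp_prodMk_comp {A B C D : Type*} [MeasurableSpace A] [MeasurableSpace B]
    [MeasurableSpace C] [MeasurableSpace D] {Y : Ω → A} {H : Ω → B} {f : A → C} {g : A → D}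
    (hY : Measurable Y) (hH : Measurable H) (hf : Measurable f) (hg : Measurable g)
    (hYH : IndepFun Y H P) (hfg : IndepFun (fun ω => f (Y ω)) (fun ω => g (Y ω)) P) :
    IndepFun (fun ω => f (Y ω)) (fun ω => (H ω, g (Y ω))) P := by
  have hfY : Measurable (fun ω => f (Y ω)) := hf.comp hY
  have hHgY : Measurable (fun ω => (H ω, g (Y ω))) := hH.prodMk (hg.comp hY)
  rw [indepFun_iff_map_prod_eq_prod_map_map hfY.aemeasurable hHgY.aemeasurable]
  have := Measure.isProbabilityMeasure_map (μ := P) hfY.aemeasurable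
  have := Measure.isProbabilityMeasure_map (μ := P) hHgY.aemeasurable
  have := Measure.isProbabilityMeasure_map (μ := P) (hfY.prodMk hHgY).aemeasurable
  refine Measure.ext_prod₃ fun {s t u} hs ht hu => ?_
  rw [Measure.map_apply (hfY.prodMk hHgY) (hs.prod (ht.prod hu)), Measure.prod_prod,
    Measure.map_apply hfY hs, Measure.map_apply hHgY (ht.prod hu)]
  have htriple : (fun ω => (f (Y ω), H ω, g (Y ω))) ⁻¹' s ×ˢ t ×ˢ u
      = Y ⁻¹' (f ⁻¹' s ∩ g ⁻¹' u) ∩ H ⁻¹' t := by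
    ext ω
    simp only [Set.mem_preimage, Set.mem_prod, Set.mem_inter_iff]
    tauto
  have hpair : (fun ω => (H ω, g (Y ω))) ⁻¹' t ×ˢ u = Y ⁻¹' (g ⁻¹' u) ∩ H ⁻¹' t := by
    ext ω
    simp only [Set.mem_preimage, Set.mem_prod, Set.mem_inter_iff]
    tauto
  have hinter : P (Y ⁻¹' (f ⁻¹' s ∩ g ⁻¹' u))
      = P ((fun ω => f (Y ω)) ⁻¹' s) * P (Y ⁻¹' (g ⁻¹' u)) :=
    hfg.measure_inter_preimage_eq_mul _ _ hs hu
  rw [htriple, hpair, hYH.measure_inter_preimage_eq_mul _ _ ((hf hs).inter (hg hu)) ht,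
    hYH.measure_inter_preimage_eq_mul _ _ (hg hu) ht, hinter, mul_assoc]

lemma measure_le_setLIntegral_of_section_le {A B : Type*} [MeasurableSpace A] [MeasurableSpace B]
    {Z : Ω → A} {g : Ω → B} (hZ : Measurable Z) (hg : Measurable g) (hind : IndepFun Z g P)
    {L W : Set (A × B)} (hL : MeasurableSet L) (hW : MeasurableSet W) {ρ : A → ENNReal}
    (hρ : Measurable ρ)
    (h : ∀ z, P.map g (Prod.mk z ⁻¹' L) ≤ ρ z * P.map g (Prod.mk z ⁻¹' W)) :
    P {ω | (Z ω, g ω) ∈ L} ≤ ∫⁻ ω in {ω | (Z ω, g ω) ∈ W}, ρ (Z ω) ∂P := by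
  have := Measure.isProbabilityMeasure_map (μ := P) hg.aemeasurable
  have hmap : P.map (fun ω => (Z ω, g ω)) = (P.map Z).prod (P.map g) :=
    (indepFun_iff_map_prod_eq_prod_map_map hZ.aemeasurable hg.aemeasurable).1 hind
  calc P {ω | (Z ω, g ω) ∈ L} = ((P.map Z).prod (P.map g)) L := by
        rw [← hmap, Measure.map_apply (hZ.prodMk hg) hL]
        rfl
    _ = ∫⁻ z, P.map g (Prod.mk z ⁻¹' L) ∂P.map Z := Measure.prod_apply hL
    _ ≤ ∫⁻ z, ρ z * P.map g (Prod.mk z ⁻¹' W) ∂P.map Z := lintegral_mono h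
    _ = ∫⁻ z, ∫⁻ x, W.indicator (fun p => ρ p.1) (z, x) ∂P.map g ∂P.map Z := by
        refine lintegral_congr fun z => ?_
        rw [← lintegral_indicator_const (measurable_prodMk_left hW)]
        rfl
    _ = ∫⁻ p, W.indicator (fun p => ρ p.1) p ∂(P.map Z).prod (P.map g) :=
        (lintegral_prod _ ((hρ.comp measurable_fst).indicator hW).aemeasurable).symm
    _ = ∫⁻ ω in {ω | (Z ω, g ω) ∈ W}, ρ (Z ω) ∂P := by
        rw [lintegral_indicator hW, ← hmap,
          setLIntegral_map (f := fun p => ρ p.1) hW (by fun_prop) (hZ.prodMk hg)]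
        rfl

end Independence

section DuelRecord

/-- The data deciding a duel of an arm with the optimal arm, up to the Gaussian noise of these two
arms: their numbers of pulls, their empirical means, and the best competing sample. -/
abbrev DuelRecord : Type := ℕ × ℕ × ℝ × ℝ × EReal

/-- The noise pairs for which the optimal arm loses the duel. -/
def duelLost (β σ : ℝ) : DuelRecord → Set (ℝ × ℝ)
  | (n, j, u, v, a) => firstWins u √(β * σ ^ 2 / n) v √(β * σ ^ 2 / j) a

/-- The noise pairs for which the optimal arm wins the duel. -/
def duelWon (β σ : ℝ) : DuelRecord → Set (ℝ × ℝ)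
  | (n, j, u, v, a) => secondWins u √(β * σ ^ 2 / n) v √(β * σ ^ 2 / j) a

lemma measurableSet_duelLost (β σ : ℝ) :
    MeasurableSet {p : DuelRecord × ℝ × ℝ | p.2 ∈ duelLost β σ p.1} := by
  simp only [duelLost, firstWins, Set.ofPred_and]
  exact (measurableSet_le (by fun_prop) (by fun_prop)).inter
    (measurableSet_le (by fun_prop) (by fun_prop))

lemma measurableSet_duelWon (β σ : ℝ) :
    MeasurableSet {p : DuelRecord × ℝ × ℝ | p.2 ∈ duelWon β σ p.1} := by
  simp only [duelWon, secondWins, Set.ofPred_and]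
  exact (measurableSet_lt (by fun_prop) (by fun_prop)).inter
    (measurableSet_lt (by fun_prop) (by fun_prop))

variable {Θ Ω : Type*} [MeasurableSpace Ω] {K : ℕ} {μ : Fin K → Θ → ℝ} {θs : Θ} {ks l : Fin K}
  {α β σ : ℝ} {X : Fin K → ℕ → Ω → ℝ} {G : ℕ → Fin K → Ω → ℝ} {arm : ℕ → Ω → Fin K} {s : ℕ}

/-- The record, after `s` rounds, of the duel between the arms `l` and `ks`. -/
noncomputable def duelRecord (μ : Fin K → Θ → ℝ) (θs : Θ) (α β σ : ℝ) (X : Fin K → ℕ → Ω → ℝ)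
    (G : ℕ → Fin K → Ω → ℝ) (arm : ℕ → Ω → Fin K) (l ks : Fin K) (s : ℕ) (ω : Ω) : DuelRecord :=
  (pulls arm l s ω, pulls arm ks s ω, empMean X arm l s ω, empMean X arm ks s ω,
    rivalSample μ θs α β σ X G arm l ks s ω)

lemma measurable_duelRecord (harm : ∀ r < s, Measurable (arm r)) (hX : ∀ k i, Measurable (X k i))
    (hG : ∀ m, m ∉ ({l, ks} : Finset (Fin K)) → Measurable (G s m)) :
    Measurable (duelRecord μ θs α β σ X G arm l ks s) :=
  (measurable_pulls harm l).prodMk ((measurable_pulls harm ks).prodMk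
    ((measurable_empMean harm hX l).prodMk ((measurable_empMean harm hX ks).prodMk
      (measurable_rivalSample harm hX hG))))

end DuelRecord

section Comparison

variable {Θ Ω : Type*} [MeasurableSpace Ω] {P : Measure Ω} {K : ℕ}
  {μ : Fin K → Θ → ℝ} {θs : Θ} {ks k l : Fin K} {α β σ : ℝ} {X : Fin K → ℕ → Ω → ℝ}
  {G : ℕ → Fin K → Ω → ℝ} {arm : ℕ → Ω → Fin K} {s t : ℕ} {ω : Ω}

lemma IsTSC.map_gauss_pair [IsProbabilityMeasure P] (harm : IsTSC P μ α β σ X G arm) (hl : l ≠ ks)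
    (s : ℕ) : P.map (fun ω => (G s l ω, G s ks ω)) = stdGaussPair := by
  rw [(indepFun_iff_map_prod_eq_prod_map_map (harm.measurable_gauss s l).aemeasurable
    (harm.measurable_gauss s ks).aemeasurable).1 ((harm.indep_arms s).indepFun hl),
    harm.gauss, harm.gauss]

lemma IsTSC.indepFun_gauss_pair_history [IsProbabilityMeasure P]
    (harm : IsTSC P μ α β σ X G arm) (hX : ∀ k i, Measurable (X k i)) (l ks : Fin K) (s : ℕ) :
    IndepFun (fun ω => (G s l ω, G s ks ω)) (fun ω =>
      (((fun k i => X k i ω), (fun r : Fin s => (arm r ω, fun k => G r k ω))),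
        (fun m : (({l, ks} : Finset (Fin K))ᶜ : Finset (Fin K)) => G s m ω))) P := by
  have hhistory : Measurable (fun ω =>
      ((fun k i => X k i ω), (fun r : Fin s => (arm r ω, fun k => G r k ω)))) :=
    (measurable_pi_lambda _ fun k => measurable_pi_lambda _ fun i => hX k i).prodMk
      (measurable_pi_lambda _ fun r => (harm.measurable r).prodMk
        (measurable_pi_lambda _ fun k => harm.measurable_gauss r k))
  have hnoise := (harm.indep_arms s).indepFun_finset {l, ks} _ disjoint_compl_right
    (harm.measurable_gauss s)
  have hf : Measurable fun x : Fin K → ℝ => (x l, x ks) := by fun_prop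
  have hg : Measurable fun (x : Fin K → ℝ) (m : (({l, ks} : Finset (Fin K))ᶜ : Finset (Fin K))) =>
      x m := by fun_prop
  have hφ : Measurable fun x : ({l, ks} : Finset (Fin K)) → ℝ =>
      (x ⟨l, by simp⟩, x ⟨ks, by simp⟩) := by fun_prop
  exact indepFun_comp_prodMk_comp (measurable_pi_lambda _ (harm.measurable_gauss s)) hhistory hf hg
    (harm.indep_past s) (hnoise.comp hφ measurable_id)

lemma IsTSC.indepFun_duelRecord [IsProbabilityMeasure P] (harm : IsTSC P μ α β σ X G arm)
    (hX : ∀ k i, Measurable (X k i)) (s : ℕ) :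
    IndepFun (duelRecord μ θs α β σ X G arm l ks s) (fun ω => (G s l ω, G s ks ω)) P := by
  have hind := (harm.indepFun_gauss_pair_history hX l ks s).symm
  set history := fun ω =>
    (((fun k i => X k i ω), (fun r : Fin s => (arm r ω, fun k => G r k ω))),
      (fun m : (({l, ks} : Finset (Fin K))ᶜ : Finset (Fin K)) => G s m ω))
  rw [IndepFun_iff_Indep] at hind ⊢
  refine indep_of_indep_of_le_left hind (Measurable.comap_le ?_)
  let past : MeasurableSpace Ω := MeasurableSpace.comap history inferInstance
  have hpast : Measurable[past] history := comap_measurable history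
  have harm' : ∀ r < s, Measurable[past] (arm r) := fun r hr =>
    ((measurable_pi_apply (⟨r, hr⟩ : Fin s)).comp hpast.fst.snd).fst
  have hX' : ∀ k i, Measurable[past] (X k i) := fun k i =>
    (measurable_pi_apply i).comp ((measurable_pi_apply k).comp hpast.fst.fst)
  have hG' : ∀ m, m ∉ ({l, ks} : Finset (Fin K)) → Measurable[past] (G s m) := fun m hm =>
    (measurable_pi_apply (⟨m, Finset.mem_compl.2 hm⟩ :
      (({l, ks} : Finset (Fin K))ᶜ : Finset (Fin K)))).comp hpast.snd
  exact @measurable_duelRecord _ _ past _ _ _ _ _ _ _ _ _ _ _ _ harm' hX' hG'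

lemma IsTSC.mem_duelLost (harm : IsTSC P μ α β σ X G arm) (hopt : IsOptimal μ θs ks)
    (hg : θs ∈ confSet μ α σ X arm s ω) (hl : arm s ω = l)
    (hnl : 0 < pulls arm l s ω) (hnk : 0 < pulls arm ks s ω) :
    (G s l ω, G s ks ω) ∈ duelLost β σ (duelRecord μ θs α β σ X G arm l ks s ω) := by
  have hmax := harm.argmax s ω
  rw [hl, tsSample_of_pos hnl] at hmax
  refine ⟨?_, ?_⟩
  · have hks := hmax ks (hopt.mem_competitiveSet hg)
    rw [tsSample_of_pos hnk] at hks
    exact_mod_cast hks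
  · rw [rivalSample, if_pos hg]
    refine iSup_le fun m => ?_
    split_ifs with hm
    · exact hmax m.1 hm
    · exact bot_le

lemma IsTSC.arm_eq_of_mem_duelWon (harm : IsTSC P μ α β σ X G arm) (hopt : IsOptimal μ θs ks)
    (hnl : 0 < pulls arm l s ω) (hnk : 0 < pulls arm ks s ω)
    (h : (G s l ω, G s ks ω) ∈ duelWon β σ (duelRecord μ θs α β σ X G arm l ks s ω)) :
    arm s ω = ks := by
  obtain ⟨hrival, hbest⟩ := h
  have hg : θs ∈ confSet μ α σ X arm s ω := by
    by_contra hg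
    rw [rivalSample, if_neg hg] at hbest
    exact not_top_lt hbest
  by_contra hne
  refine (harm.argmax s ω ks (hopt.mem_competitiveSet hg)).not_gt ?_
  rw [tsSample_of_pos hnk]
  rcases eq_or_ne (arm s ω) l with hl | hl
  · rw [hl, tsSample_of_pos hnl]
    exact_mod_cast hrival
  · refine lt_of_le_of_lt ?_ hbest
    rw [rivalSample, if_pos hg]
    refine le_iSup_of_le ⟨arm s ω, by simp [hl, hne]⟩ ?_
    rw [if_pos (harm.mem s ω)]

lemma IsTSC.measure_arm_eq_le_setLIntegral [IsProbabilityMeasure P]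
    (harm : IsTSC P μ α β σ X G arm)
    (hX : ∀ k i, Measurable (X k i)) (hopt : IsOptimal μ θs ks) (hl : l ≠ ks) (s : ℕ)
    {B : Set DuelRecord} (hB : MeasurableSet B) {ρ : DuelRecord → ENNReal} (hρ : Measurable ρ)
    (hpulls : ∀ z ∈ B, 0 < z.1 ∧ 0 < z.2.1)
    (h : ∀ z ∈ B, stdGaussPair (duelLost β σ z) ≤ ρ z * stdGaussPair (duelWon β σ z)) :
    P {ω | arm s ω = l ∧ θs ∈ confSet μ α σ X arm s ω ∧
        duelRecord μ θs α β σ X G arm l ks s ω ∈ B} ≤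
      ∫⁻ ω in {ω | arm s ω = ks ∧ duelRecord μ θs α β σ X G arm l ks s ω ∈ B},
        ρ (duelRecord μ θs α β σ X G arm l ks s ω) ∂P := by
  classical
  have hsection : ∀ (S : DuelRecord → Set (ℝ × ℝ)) z,
      Prod.mk z ⁻¹' {p | p.1 ∈ B ∧ p.2 ∈ S p.1} = if z ∈ B then S z else ∅ := by
    intro S z
    ext g
    by_cases hz : z ∈ B <;> simp [hz]
  have hcompare := measure_le_setLIntegral_of_section_le
    (L := {p | p.1 ∈ B ∧ p.2 ∈ duelLost β σ p.1}) (W := {p | p.1 ∈ B ∧ p.2 ∈ duelWon β σ p.1})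
    (measurable_duelRecord (fun r _ => harm.measurable r) hX fun m _ => harm.measurable_gauss s m)
    ((harm.measurable_gauss s l).prodMk (harm.measurable_gauss s ks))
    (harm.indepFun_duelRecord (θs := θs) hX s)
    ((measurable_fst hB).inter (measurableSet_duelLost β σ))
    ((measurable_fst hB).inter (measurableSet_duelWon β σ)) hρ fun z => by
      rw [harm.map_gauss_pair hl, hsection, hsection]
      split_ifs with hz
      · exact h z hz
      · simp
  refine (measure_mono ?_).trans (hcompare.trans (lintegral_mono_set ?_))
  · rintro ω ⟨hal, hg, hz⟩
    obtain ⟨hn, hj⟩ := hpulls _ hz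
    exact ⟨hz, harm.mem_duelLost hopt hg hal hn hj⟩
  · rintro ω ⟨hz, hwon⟩
    obtain ⟨hn, hj⟩ := hpulls _ hz
    exact ⟨harm.arm_eq_of_mem_duelWon hopt hn hj hwon, hz⟩

end Comparison

section PullThreshold

variable {α σ D : ℝ} {b n : ℕ}

/-- The number of pulls of an arm from which on its confidence width stays at most `D / 2` up to
round `b`. -/
noncomputable def pullThreshold (α σ D : ℝ) (b : ℕ) : ℝ := 8 * α * σ ^ 2 * Real.log b / D ^ 2

lemma pullThreshold_nonneg (hα : 0 ≤ α) : 0 ≤ pullThreshold α σ D b := by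
  have := Real.log_natCast_nonneg b
  unfold pullThreshold
  positivity

lemma pullThreshold_pos (hα : 0 < α) (hσ : σ ≠ 0) (hD : D ≠ 0) (hb : 1 < b) :
    0 < pullThreshold α σ D b := by
  have : 0 < Real.log b := Real.log_pos (by exact_mod_cast hb)
  unfold pullThreshold
  positivity

lemma width_mul_sq (hα : 0 ≤ α) (hD : D ≠ 0) (b n : ℕ) :
    (width α σ b n * n) ^ 2 = D ^ 2 / 4 * (pullThreshold α σ D b * n) := by
  rw [mul_pow, width_sq hα, pullThreshold]
  rcases eq_or_ne n 0 with rfl | hn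
  · simp
  have hn' : (n : ℝ) ≠ 0 := Nat.cast_ne_zero.2 hn
  field_simp [hn']
  ring

lemma width_mul_le (hα : 0 ≤ α) (hD : 0 < D) {x : ℝ} (hx : 0 ≤ x)
    (h : pullThreshold α σ D b * n ≤ x ^ 2) : width α σ b n * n ≤ D / 2 * x := by
  refine abs_le_of_sq_le_sq' ?_ (by positivity) |>.2
  rw [width_mul_sq hα hD.ne']
  nlinarith [sq_nonneg D]

end PullThreshold

section ChargeRegion

variable {K : ℕ} {β σ J y : ℝ} {z : DuelRecord}

/-- Twice the inverse of the probability that the Thompson sample of an arm with `n` pulls and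
empirical mean `v` exceeds `y`, if `v < y`: the extra charge for the optimal arm when its empirical
mean is too low. -/
noncomputable def missCost (β σ y : ℝ) (n : ℕ) (v : ℝ) : ENNReal :=
  if v < y then 2 / stdGauss {g | y < v + √(β * σ ^ 2 / n) * g} else 0

lemma measurable_missCost (β σ y : ℝ) : Measurable (fun p : ℕ × ℝ => missCost β σ y p.1 p.2) := by
  refine measurable_from_prod_countable_right fun n => ?_
  have hexceed : MeasurableSet {p : ℝ × ℝ | y < p.1 + √(β * σ ^ 2 / n) * p.2} :=
    measurableSet_lt (by fun_prop) (by fun_prop)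
  exact Measurable.ite measurableSet_Iio
    (measurable_const.div (measurable_measure_prodMk_left hexceed)) measurable_const

/-- The ratio of the numbers of pulls needed for a comparison with the optimal arm, which is also
the charge per pull of the optimal arm: `1` for two arms and `2` otherwise. -/
def chargeFactor (K : ℕ) : ℕ := if K = 2 then 1 else 2

lemma one_le_chargeFactor (K : ℕ) : 1 ≤ chargeFactor K := by
  unfold chargeFactor
  split_ifs <;> norm_num

/-- The records for which the optimal arm loses a duel at most `chargeFactor K + missCost` times as
often as it wins it. Here `J` is the threshold for the pulls of the optimal arm and `y` separates
the two means. -/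
def chargeRegion (K : ℕ) (J y : ℝ) : Set DuelRecord :=
  {(n, j, u, v, a) | 0 < j ∧ (j : ℝ) < J ∧ j ≤ n ∧ u ≤ y ∧
    ((K = 2 ∧ a = ⊥) ∨ (K ≠ 2 ∧ j * (y - v) ≤ n * (y - u)))}

lemma measurableSet_chargeRegion (K : ℕ) (J y : ℝ) : MeasurableSet (chargeRegion K J y) := by
  have hj : Measurable fun z : DuelRecord => z.2.1 := measurable_snd.fst
  refine (measurableSet_lt measurable_const hj).inter <|
    (measurableSet_lt (f := fun z : DuelRecord => (z.2.1 : ℝ)) (by fun_prop)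
      measurable_const).inter <|
    (measurableSet_le hj measurable_fst).inter <|
    (measurableSet_le (f := fun z : DuelRecord => z.2.2.1) (by fun_prop) measurable_const).inter <|
    ((MeasurableSet.const _).inter ?_).union ((MeasurableSet.const _).inter ?_)
  · exact measurable_snd.snd.snd.snd (measurableSet_singleton ⊥)
  · exact measurableSet_le (f := fun z : DuelRecord => (z.2.1 : ℝ) * (y - z.2.2.2.1))
      (g := fun z => z.1 * (y - z.2.2.1)) (by fun_prop) (by fun_prop)

lemma stdGaussPair_duelLost_le (hβ : 0 < β) (hσ : σ ≠ 0) (hz : z ∈ chargeRegion K J y) :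
    stdGaussPair (duelLost β σ z) ≤
      (chargeFactor K + missCost β σ y z.2.1 z.2.2.2.1) * stdGaussPair (duelWon β σ z) := by
  obtain ⟨n, j, u, v, a⟩ := z
  obtain ⟨hj, -, hjn, huy, hcase⟩ := hz
  have hj' : (0 : ℝ) < j := by exact_mod_cast hj
  have hn' : (0 : ℝ) < n := by exact_mod_cast hj.trans_le hjn
  have hs₁ : 0 < √(β * σ ^ 2 / n) := Real.sqrt_pos.2 (by positivity)
  have hs₂ : 0 < √(β * σ ^ 2 / j) := Real.sqrt_pos.2 (by positivity)
  have hs : √(β * σ ^ 2 / n) ≤ √(β * σ ^ 2 / j) :=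
    Real.sqrt_le_sqrt (div_le_div_of_nonneg_left (by positivity) hj' (by exact_mod_cast hjn))
  rcases lt_or_ge v y with hv | hv
  · refine (measure_firstWins_le_div hs₁ hs₂ huy hv ?_).trans (mul_le_mul_left ?_ _)
    · refine hcase.imp And.right fun h => ⟨hs, ?_⟩
      rw [Real.sq_sqrt (by positivity), Real.sq_sqrt (by positivity), div_div_eq_mul_div,
        div_div_eq_mul_div]
      gcongr ?_ / _
      linarith [h.2]
    · simp only [missCost, if_pos hv]
      exact le_add_self
  · rcases hcase with ⟨hK, rfl⟩ | ⟨hK, -⟩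
    · refine (measure_firstWins_bot_le hs₂.ne' (huy.trans hv)).trans (le_mul_of_one_le_left' ?_)
      simp [chargeFactor, hK]
    · refine (measure_firstWins_le_two_mul hs₁ hs (huy.trans hv)).trans (mul_le_mul_left ?_ _)
      simp [chargeFactor, hK]

end ChargeRegion

section Charge

variable {Θ Ω : Type*} {K : ℕ} {μ : Fin K → Θ → ℝ} {θs : Θ} {ks l : Fin K} {α β σ D : ℝ}
  {X : Fin K → ℕ → Ω → ℝ} {G : ℕ → Fin K → Ω → ℝ} {arm : ℕ → Ω → Fin K} {s b : ℕ} {ω : Ω}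

lemma empMean_le_of_pullThreshold_le (hg : θs ∈ confSet μ α σ X arm s ω) (hα : 0 ≤ α) (hD : 0 < D)
    (hgap : D ≤ gapMin μ θs ks) (hl : l ≠ ks) (hs : s ≤ b) (hn : 0 < pulls arm l s ω)
    (hJn : pullThreshold α σ D b ≤ pulls arm l s ω) :
    empMean X arm l s ω ≤ μ ks θs - D / 2 := by
  have hn' : (0 : ℝ) < pulls arm l s ω := by exact_mod_cast hn
  have hwidth : width α σ b (pulls arm l s ω) * pulls arm l s ω ≤ D / 2 * pulls arm l s ω :=
    width_mul_le hα hD hn'.le (by nlinarith)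
  linarith [le_of_mul_le_mul_right hwidth hn', (abs_lt.1 (hg l hn)).1,
    width_mono (σ := σ) hα hs (pulls arm l s ω), gapMin_le (μ := μ) (θs := θs) hl]

lemma mul_sub_empMean_le_mul_sub_empMean (hg : θs ∈ confSet μ α σ X arm s ω) (hα : 0 ≤ α)
    (hD : 0 < D) (hgap : D ≤ gapMin μ θs ks) (hl : l ≠ ks) (hs : s ≤ b)
    (hJn : 2 * pullThreshold α σ D b ≤ pulls arm l s ω) (hj : 0 < pulls arm ks s ω)
    (hjJ : pulls arm ks s ω < pullThreshold α σ D b) :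
    pulls arm ks s ω * (μ ks θs - D / 2 - empMean X arm ks s ω) ≤
      pulls arm l s ω * (μ ks θs - D / 2 - empMean X arm l s ω) := by
  set J := pullThreshold α σ D b
  have hj' : (0 : ℝ) < pulls arm ks s ω := by exact_mod_cast hj
  have hn' : (0 : ℝ) < pulls arm l s ω := by linarith
  have hopt : μ ks θs - empMean X arm ks s ω ≤ width α σ b (pulls arm ks s ω) :=
    (abs_lt.1 (hg ks hj)).2.le.trans (width_mono hα hs _)
  have harm : D - width α σ b (pulls arm l s ω) ≤ μ ks θs - empMean X arm l s ω := by
    linarith [(abs_lt.1 (hg l (by exact_mod_cast hn'))).1, gapMin_le (μ := μ) (θs := θs) hl,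
      width_mono (σ := σ) hα hs (pulls arm l s ω)]
  -- AM-GM: `√(J x) ≤ J / 4 + x` and `√(J x) ≤ J + x / 4`
  have hwidth_opt : width α σ b (pulls arm ks s ω) * pulls arm ks s ω ≤
      D / 2 * (J / 4 + pulls arm ks s ω) :=
    width_mul_le hα hD (by linarith) (by nlinarith [sq_nonneg (J / 4 - pulls arm ks s ω)])
  have hwidth_arm : width α σ b (pulls arm l s ω) * pulls arm l s ω ≤
      D / 2 * (J + pulls arm l s ω / 4) :=
    width_mul_le hα hD (by linarith) (by nlinarith [sq_nonneg (J - pulls arm l s ω / 4)])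
  calc pulls arm ks s ω * (μ ks θs - D / 2 - empMean X arm ks s ω)
      ≤ pulls arm ks s ω * (width α σ b (pulls arm ks s ω) - D / 2) :=
        mul_le_mul_of_nonneg_left (by linarith) hj'.le
    _ ≤ pulls arm l s ω * (D / 2 - width α σ b (pulls arm l s ω)) := by nlinarith
    _ ≤ pulls arm l s ω * (μ ks θs - D / 2 - empMean X arm l s ω) :=
        mul_le_mul_of_nonneg_left (by linarith) hn'.le

lemma duelRecord_mem_chargeRegion (hg : θs ∈ confSet μ α σ X arm s ω) (hα : 0 ≤ α) (hD : 0 < D)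
    (hgap : D ≤ gapMin μ θs ks) (hl : l ≠ ks) (hs : s ≤ b)
    (hJn : chargeFactor K * pullThreshold α σ D b ≤ pulls arm l s ω)
    (hj : 0 < pulls arm ks s ω) (hjJ : pulls arm ks s ω < pullThreshold α σ D b) :
    duelRecord μ θs α β σ X G arm l ks s ω ∈
      chargeRegion K (pullThreshold α σ D b) (μ ks θs - D / 2) := by
  have hone : (1 : ℝ) ≤ chargeFactor K := by exact_mod_cast one_le_chargeFactor K
  have hJn' : pullThreshold α σ D b ≤ pulls arm l s ω :=
    (le_mul_of_one_le_left (pullThreshold_nonneg hα) hone).trans hJn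
  have hjn : pulls arm ks s ω ≤ pulls arm l s ω := by exact_mod_cast hjJ.le.trans hJn'
  refine ⟨hj, hjJ, hjn,
    empMean_le_of_pullThreshold_le hg hα hD hgap hl hs (hj.trans_le hjn) hJn', ?_⟩
  by_cases hK : K = 2
  · exact Or.inl ⟨hK, rivalSample_eq_bot hK hl hg⟩
  · refine Or.inr ⟨hK, mul_sub_empMean_le_mul_sub_empMean hg hα hD hgap hl hs ?_ hj hjJ⟩
    simpa [chargeFactor, hK] using hJn

variable [MeasurableSpace Ω] {P : Measure Ω} [IsProbabilityMeasure P]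

lemma IsTSC.measure_arm_eq_le (harm : IsTSC P μ α β σ X G arm) (hX : ∀ k i, Measurable (X k i))
    (hopt : IsOptimal μ θs ks) (hl : l ≠ ks) (hα : 0 ≤ α) (hβ : 0 < β) (hσ : σ ≠ 0) (hD : 0 < D)
    (hgap : D ≤ gapMin μ θs ks) (hs : s ≤ b) :
    P {ω | arm s ω = l ∧ θs ∈ confSet μ α σ X arm s ω ∧
        chargeFactor K * pullThreshold α σ D b ≤ pulls arm l s ω ∧
        0 < pulls arm ks s ω ∧ pulls arm ks s ω < pullThreshold α σ D b} ≤
      ∫⁻ ω in {ω | arm s ω = ks ∧ 0 < pulls arm ks s ω ∧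
          pulls arm ks s ω < pullThreshold α σ D b},
        (chargeFactor K +
          missCost β σ (μ ks θs - D / 2) (pulls arm ks s ω) (empMean X arm ks s ω)) ∂P := by
  have hcharge : Measurable fun z : DuelRecord =>
      (chargeFactor K : ENNReal) + missCost β σ (μ ks θs - D / 2) z.2.1 z.2.2.2.1 :=
    measurable_const.add ((measurable_missCost β σ _).comp
      (measurable_snd.fst.prodMk measurable_snd.snd.snd.fst))
  refine (measure_mono ?_).trans ((harm.measure_arm_eq_le_setLIntegral hX hopt hl s
    (measurableSet_chargeRegion K (pullThreshold α σ D b) (μ ks θs - D / 2)) hcharge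
    (fun z hz => ⟨hz.1.trans_le hz.2.2.1, hz.1⟩)
    fun z hz => stdGaussPair_duelLost_le hβ hσ hz).trans (lintegral_mono_set ?_))
  · rintro ω ⟨harm_eq, hg, hJn, hj, hjJ⟩
    exact ⟨harm_eq, hg, duelRecord_mem_chargeRegion hg hα hD hgap hl hs hJn hj hjJ⟩
  · rintro ω ⟨harm_eq, hj, hjJ, -⟩
    exact ⟨harm_eq, hj, hjJ⟩

end Charge

section MillsRatio

lemma gaussianPDFReal_one_apply (m x : ℝ) :
    gaussianPDFReal m 1 x = (√(2 * Real.pi))⁻¹ * Real.exp (-(x - m) ^ 2 / 2) := by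
  simp [gaussianPDFReal]

lemma half_le_gaussianReal_Ioi (m : ℝ) : 1 / 2 ≤ gaussianReal m 1 (Set.Ioi m) := by
  have : NullSingletonClass (gaussianReal m 1) := nullSingletonClass_gaussianReal one_ne_zero
  have hreflect : stdGauss.map (fun x => m - x) = gaussianReal m 1 := by
    rw [gaussianReal_map_const_sub, sub_zero]
  have hpre : (fun x => m - x) ⁻¹' Set.Ici m = Set.Iic 0 := by
    ext x
    simp
  rw [measure_congr Ioi_ae_eq_Ici, ← hreflect, Measure.map_apply (by fun_prop) measurableSet_Ici,
    hpre]
  exact half_le_stdGauss_Iic le_rfl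

lemma hasDerivAt_neg_gaussianPDFReal_div {x : ℝ} (hx : 1 + x ≠ 0) :
    HasDerivAt (fun x => -(gaussianPDFReal 0 1 x / (1 + x)))
      (gaussianPDFReal 0 1 x * (x / (1 + x) + 1 / (1 + x) ^ 2)) x := by
  have hexponent : HasDerivAt (fun x : ℝ => -(x - 0) ^ 2 / 2) (-x) x := by
    refine ((((hasDerivAt_id x).sub_const 0).pow 2).neg.div_const 2).congr_deriv ?_
    simp only [id, sub_zero]
    ring
  simp only [gaussianPDFReal_one_apply]
  refine ((hexponent.exp.const_mul _).div ((hasDerivAt_id x).const_add 1) hx).neg.congr_deriv ?_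
  simp only [id]
  field_simp
  ring

lemma tendsto_neg_gaussianPDFReal_div :
    Tendsto (fun x => -(gaussianPDFReal 0 1 x / (1 + x))) atTop (nhds 0) := by
  have hbound : Tendsto (fun x : ℝ => (√(2 * Real.pi))⁻¹ / (1 + x)) atTop (nhds 0) :=
    tendsto_const_nhds.div_atTop (tendsto_atTop_add_const_left _ _ tendsto_id)
  suffices h : Tendsto (fun x => gaussianPDFReal 0 1 x / (1 + x)) atTop (nhds 0) by
    simpa only [neg_zero] using h.neg
  refine squeeze_zero' ?_ ?_ hbound
  · filter_upwards [eventually_ge_atTop 0] with x hx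
    exact div_nonneg (gaussianPDFReal_nonneg 0 1 x) (by linarith)
  · filter_upwards [eventually_ge_atTop 0] with x hx
    gcongr
    rw [gaussianPDFReal_one_apply]
    exact mul_le_of_le_one_right (by positivity)
      (Real.exp_le_one_iff.2 (by linarith [sq_nonneg (x - 0)]))

lemma gaussianPDFReal_div_le_stdGauss_Ioi {x : ℝ} (hx : 0 ≤ x) :
    ENNReal.ofReal (gaussianPDFReal 0 1 x / (1 + x)) ≤ stdGauss (Set.Ioi x) := by
  have hderiv : ∀ u ∈ Set.Ici x, HasDerivAt (fun u => -(gaussianPDFReal 0 1 u / (1 + u)))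
      (gaussianPDFReal 0 1 u * (u / (1 + u) + 1 / (1 + u) ^ 2)) u := fun u hu =>
    hasDerivAt_neg_gaussianPDFReal_div (by linarith [hx.trans hu])
  have hnonneg : ∀ u ∈ Set.Ioi x,
      0 ≤ gaussianPDFReal 0 1 u * (u / (1 + u) + 1 / (1 + u) ^ 2) := by
    intro u hu
    have hu' : 0 < u := hx.trans_lt hu
    exact mul_nonneg (gaussianPDFReal_nonneg 0 1 u) (by positivity)
  have hlim := tendsto_neg_gaussianPDFReal_div
  rw [stdGauss, gaussianReal_apply_eq_integral 0 one_ne_zero]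
  refine ENNReal.ofReal_le_ofReal ?_
  calc gaussianPDFReal 0 1 x / (1 + x)
      = ∫ u in Set.Ioi x, gaussianPDFReal 0 1 u * (u / (1 + u) + 1 / (1 + u) ^ 2) := by
        rw [integral_Ioi_of_hasDerivAt_of_nonneg' hderiv hnonneg hlim]
        ring
    _ ≤ ∫ u in Set.Ioi x, gaussianPDFReal 0 1 u := by
        refine setIntegral_mono_on (integrableOn_Ioi_deriv_of_nonneg' hderiv hnonneg hlim)
          (integrable_gaussianPDFReal 0 1).integrableOn measurableSet_Ioi fun u hu => ?_
        have hu' : 0 < u := hx.trans_lt hu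
        refine mul_le_of_le_one_right (gaussianPDFReal_nonneg 0 1 u) ?_
        rw [div_add_div _ _ (by positivity) (by positivity), div_le_one (by positivity)]
        nlinarith [sq_nonneg u, pow_pos hu' 3]

lemma gaussianPDFReal_div_gaussianPDFReal (x u : ℝ) :
    gaussianPDFReal x 1 u / gaussianPDFReal 0 1 x = Real.exp (u * x - u ^ 2 / 2) := by
  rw [gaussianPDFReal_one_apply, gaussianPDFReal_one_apply,
    mul_div_mul_left _ _ (by positivity), ← Real.exp_sub]
  congr 1
  ring

-- By the Mills ratio the left side is at most `(1 + x) / φ(x)`, and the density of `N(x, 1)`, half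
-- of whose mass lies above `x`, is `φ(x) exp (u x - u² / 2)`.
lemma inv_stdGauss_Ioi_le {x : ℝ} (hx : 0 ≤ x) :
    (stdGauss (Set.Ioi x))⁻¹ ≤ 2 * ∫⁻ u in Set.Ioi (0 : ℝ),
      ENNReal.ofReal ((1 + u) * Real.exp (u * x - u ^ 2 / 2)) := by
  have hpdf := gaussianPDFReal_pos 0 1 x one_ne_zero
  set q := gaussianPDFReal 0 1 x / (1 + x) with hq
  have hq_pos : 0 < q := by positivity
  calc (stdGauss (Set.Ioi x))⁻¹ ≤ ENNReal.ofReal q⁻¹ := by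
        rw [ENNReal.ofReal_inv_of_pos hq_pos]
        exact ENNReal.inv_le_inv.2 (gaussianPDFReal_div_le_stdGauss_Ioi hx)
    _ = 2 * (ENNReal.ofReal q⁻¹ * (1 / 2)) := by
        rw [mul_left_comm, one_div, ENNReal.mul_inv_cancel (by simp) (by simp), mul_one]
    _ ≤ 2 * (ENNReal.ofReal q⁻¹ * ∫⁻ u in Set.Ioi x, gaussianPDF x 1 u) := by
        rw [← gaussianReal_apply x one_ne_zero]
        gcongr
        exact half_le_gaussianReal_Ioi x
    _ = 2 * ∫⁻ u in Set.Ioi x, ENNReal.ofReal q⁻¹ * gaussianPDF x 1 u := by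
        rw [lintegral_const_mul _ (measurable_gaussianPDF x 1)]
    _ ≤ 2 * ∫⁻ u in Set.Ioi x, ENNReal.ofReal ((1 + u) * Real.exp (u * x - u ^ 2 / 2)) := by
        refine mul_le_mul_right (setLIntegral_mono' measurableSet_Ioi fun u hu => ?_) 2
        rw [gaussianPDF, ← ENNReal.ofReal_mul (by positivity), hq, inv_div, div_mul_eq_mul_div,
          mul_div_assoc, gaussianPDFReal_div_gaussianPDFReal]
        exact ENNReal.ofReal_le_ofReal (mul_le_mul_of_nonneg_right
          (add_le_add_right (le_of_lt hu) 1) (Real.exp_pos _).le)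
    _ ≤ 2 * ∫⁻ u in Set.Ioi (0 : ℝ),
          ENNReal.ofReal ((1 + u) * Real.exp (u * x - u ^ 2 / 2)) :=
        mul_le_mul_right (lintegral_mono_set (Set.Ioi_subset_Ioi hx)) 2

lemma lintegral_one_add_mul_exp {c : ℝ} (hc : 0 < c) :
    ∫⁻ u in Set.Ioi (0 : ℝ), ENNReal.ofReal ((1 + u) * Real.exp (-(c * u))) =
      ENNReal.ofReal (1 / c + 1 / c ^ 2) := by
  have hderiv : ∀ x ∈ Set.Ici (0 : ℝ), HasDerivAt
      (fun u => -(Real.exp (-(c * u)) * ((1 + u) / c + 1 / c ^ 2)))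
      ((1 + x) * Real.exp (-(c * x))) x := by
    intro x _
    have hexponent : HasDerivAt (fun u : ℝ => -(c * u)) (-c) x :=
      ((hasDerivAt_id x).const_mul c).neg.congr_deriv (by simp)
    have hfactor : HasDerivAt (fun u : ℝ => (1 + u) / c + 1 / c ^ 2) (1 / c) x := by
      simpa using (((hasDerivAt_id x).const_add 1).div_const c).add_const (1 / c ^ 2)
    refine (hexponent.exp.mul hfactor).neg.congr_deriv ?_
    field_simp
    ring
  have hnonneg : ∀ x ∈ Set.Ioi (0 : ℝ), 0 ≤ (1 + x) * Real.exp (-(c * x)) := fun x hx =>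
    mul_nonneg (by linarith [Set.mem_Ioi.1 hx]) (Real.exp_pos _).le
  have hlim : Tendsto (fun u : ℝ => -(Real.exp (-(c * u)) * ((1 + u) / c + 1 / c ^ 2)))
      atTop (nhds 0) := by
    have hcu : Tendsto (fun u : ℝ => c * u) atTop atTop := tendsto_id.const_mul_atTop hc
    have h₀ := (Real.tendsto_pow_mul_exp_neg_atTop_nhds_zero 0).comp hcu
    have h₁ := (Real.tendsto_pow_mul_exp_neg_atTop_nhds_zero 1).comp hcu
    have h := ((h₀.const_mul (1 / c + 1 / c ^ 2)).add (h₁.const_mul (1 / c ^ 2))).neg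
    simp only [mul_zero, add_zero, neg_zero] at h
    refine h.congr fun u => ?_
    simp only [Function.comp_apply, pow_zero, pow_one]
    field_simp
    ring
  rw [← ofReal_integral_eq_lintegral_ofReal
      (integrableOn_Ioi_deriv_of_nonneg' hderiv hnonneg hlim)
      ((ae_restrict_iff' measurableSet_Ioi).2 (Eventually.of_forall hnonneg)),
    integral_Ioi_of_hasDerivAt_of_nonneg' hderiv hnonneg hlim]
  simp

end MillsRatio

section ExpectedMissCost

lemma stdGauss_Ioi_le_stdGauss_lt_add_mul {β σ y v : ℝ} {n : ℕ} (hβ : 1 ≤ β) (hσ : 0 < σ)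
    (hn : 0 < n) (hv : v ≤ y) :
    stdGauss (Set.Ioi ((y - v) * √n / σ)) ≤ stdGauss {g | y < v + √(β * σ ^ 2 / n) * g} := by
  have hn' : (0 : ℝ) < n := Nat.cast_pos.2 hn
  have hdeficit : 0 ≤ (y - v) * √n / σ :=
    div_nonneg (mul_nonneg (sub_nonneg.2 hv) (Real.sqrt_nonneg _)) hσ.le
  have hscale : σ / √n ≤ √(β * σ ^ 2 / n) := by
    refine Real.le_sqrt_of_sq_le ?_
    rw [div_pow, Real.sq_sqrt hn'.le]
    gcongr
    exact le_mul_of_one_le_left (sq_nonneg σ) hβ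
  refine measure_mono fun g hg => ?_
  have hg_nonneg : 0 ≤ g := hdeficit.trans (Set.mem_Ioi.1 hg).le
  suffices y - v < √(β * σ ^ 2 / n) * g from sub_lt_iff_lt_add'.1 this
  calc y - v = σ / √n * ((y - v) * √n / σ) := by field_simp
    _ < σ / √n * g := mul_lt_mul_of_pos_left hg (by positivity)
    _ ≤ √(β * σ ^ 2 / n) * g := mul_le_mul_of_nonneg_right hscale hg_nonneg

-- The factor `exp (a / 4 * V)`, at least `1` where `v < y`, is free here, but it makes the
-- expectation over `v` decay like `exp (-(7 / 32) a²)`.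
lemma missCost_le {β σ y v a : ℝ} {n : ℕ} (hβ : 1 ≤ β) (hσ : 0 < σ) (hn : 0 < n) (ha : 0 ≤ a) :
    missCost β σ y n v ≤ 4 * ∫⁻ u in Set.Ioi (0 : ℝ), ENNReal.ofReal
      ((1 + u) * Real.exp ((u + a / 4) * ((y - v) * √n / σ) - u ^ 2 / 2)) := by
  unfold missCost
  split_ifs with hv
  · set V := (y - v) * √n / σ
    have hV : 0 ≤ V := div_nonneg (mul_nonneg (sub_nonneg.2 hv.le) (Real.sqrt_nonneg _)) hσ.le
    calc 2 / stdGauss {g | y < v + √(β * σ ^ 2 / n) * g}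
        ≤ 2 * (stdGauss (Set.Ioi V))⁻¹ := by
          rw [div_eq_mul_inv]
          exact mul_le_mul' le_rfl
            (ENNReal.inv_le_inv.2 (stdGauss_Ioi_le_stdGauss_lt_add_mul hβ hσ hn hv.le))
      _ ≤ 2 * (2 * ∫⁻ u in Set.Ioi (0 : ℝ),
            ENNReal.ofReal ((1 + u) * Real.exp (u * V - u ^ 2 / 2))) :=
          mul_le_mul' le_rfl (inv_stdGauss_Ioi_le hV)
      _ = 4 * ∫⁻ u in Set.Ioi (0 : ℝ),
            ENNReal.ofReal ((1 + u) * Real.exp (u * V - u ^ 2 / 2)) := by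
          rw [← mul_assoc]
          norm_num
      _ ≤ 4 * ∫⁻ u in Set.Ioi (0 : ℝ),
            ENNReal.ofReal ((1 + u) * Real.exp ((u + a / 4) * V - u ^ 2 / 2)) := by
          refine mul_le_mul' le_rfl (setLIntegral_mono' measurableSet_Ioi fun u hu => ?_)
          have hu' : 0 ≤ 1 + u := by linarith [Set.mem_Ioi.1 hu]
          refine ENNReal.ofReal_le_ofReal (mul_le_mul_of_nonneg_left ?_ hu')
          gcongr
          linarith
  · exact zero_le

lemma four_mul_inv_add_inv_sq_le {a : ℝ} (ha : a ≠ 0) :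
    4 * (1 / (3 / 4 * a) + 1 / (3 / 4 * a) ^ 2) ≤ 4 / 3 + 112 / 9 / a ^ 2 := by
  have hdiff : 4 / 3 + 112 / 9 / a ^ 2 - 4 * (1 / (3 / 4 * a) + 1 / (3 / 4 * a) ^ 2) =
      4 / 3 * (1 - 2 / a) ^ 2 := by
    field_simp
    ring
  nlinarith [sq_nonneg (1 - 2 / a)]

variable {Ω : Type*} [MeasurableSpace Ω] {P : Measure Ω} {K : ℕ} {X : Fin K → ℕ → Ω → ℝ}
  {m : Fin K → ℝ} {σ : ℝ}

lemma IsRewardTable.lintegral_exp_deficit_le (hX : IsRewardTable P X m σ) (hσ : σ ≠ 0) (k : Fin K)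
    {n : ℕ} (hn : 0 < n) {a y : ℝ} (ha : (m k - y) * √n / σ = a) (u : ℝ) :
    ∫⁻ ω, ENNReal.ofReal
        (Real.exp (u * ((y - (∑ i ∈ Finset.range n, X k i ω) / n) * √n / σ))) ∂P ≤
      ENNReal.ofReal (Real.exp (u ^ 2 / 2 - u * a)) := by
  have hn' : (0 : ℝ) < n := Nat.cast_pos.2 hn
  have hsq : √(n : ℝ) ^ 2 = n := Real.sq_sqrt hn'.le
  have hsqrt : √(n : ℝ) ≠ 0 := (Real.sqrt_pos.2 hn').ne'
  have hsub := hX.hasSubgaussianMGF_sum k n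
  have hmgf := hsub.mgf_le (-(u / (σ * √n)))
  have hvariance : (n : ℝ) * σ ^ 2 * (u / (σ * √n)) ^ 2 = u ^ 2 := by
    rw [div_pow, mul_pow, hsq]
    field_simp [hn'.ne']
  have hsplit : ∀ ω, Real.exp (u * ((y - (∑ i ∈ Finset.range n, X k i ω) / n) * √n / σ)) =
      Real.exp (-(u * a)) *
        Real.exp (-(u / (σ * √n)) * ∑ i ∈ Finset.range n, (X k i ω - m k)) := by
    intro ω
    rw [← Real.exp_add, ← ha]
    congr 1
    simp only [Finset.sum_sub_distrib, Finset.sum_const, Finset.card_range, nsmul_eq_mul]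
    field_simp [hsqrt]
    rw [hsq]
    field_simp
    ring
  simp_rw [hsplit]
  rw [← ofReal_integral_eq_lintegral_ofReal ((hsub.integrable_exp_mul _).const_mul _)
    (Eventually.of_forall fun ω => by positivity), integral_const_mul]
  refine ENNReal.ofReal_le_ofReal ?_
  calc Real.exp (-(u * a)) *
        ∫ ω, Real.exp (-(u / (σ * √n)) * ∑ i ∈ Finset.range n, (X k i ω - m k)) ∂P
      ≤ Real.exp (-(u * a)) * Real.exp (u ^ 2 / 2) := by
        refine mul_le_mul_of_nonneg_left (hmgf.trans_eq ?_) (Real.exp_pos _).le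
        simp [Real.coe_toNNReal _ (sq_nonneg σ), hvariance]
    _ = Real.exp (u ^ 2 / 2 - u * a) := by
        rw [← Real.exp_add]
        congr 1
        ring

lemma IsRewardTable.lintegral_missCost_integrand_le (hX : IsRewardTable P X m σ) (hσ : σ ≠ 0)
    (k : Fin K) {n : ℕ} (hn : 0 < n) {a y : ℝ} (ha : (m k - y) * √n / σ = a) {u : ℝ}
    (hu : 0 ≤ u) :
    ∫⁻ ω, ENNReal.ofReal ((1 + u) * Real.exp ((u + a / 4) *
        ((y - (∑ i ∈ Finset.range n, X k i ω) / n) * √n / σ) - u ^ 2 / 2)) ∂P ≤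
      ENNReal.ofReal (Real.exp (-(7 / 32 * a ^ 2))) *
        ENNReal.ofReal ((1 + u) * Real.exp (-(3 / 4 * a * u))) := by
  have hsplit : ∀ x : ℝ, ENNReal.ofReal ((1 + u) * Real.exp ((u + a / 4) * x - u ^ 2 / 2)) =
      ENNReal.ofReal ((1 + u) * Real.exp (-(u ^ 2 / 2))) *
        ENNReal.ofReal (Real.exp ((u + a / 4) * x)) := by
    intro x
    rw [← ENNReal.ofReal_mul (by positivity), mul_assoc, ← Real.exp_add]
    congr 3
    ring
  have := hX.measurable k
  simp_rw [hsplit]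
  rw [lintegral_const_mul _ (by fun_prop)]
  refine (mul_le_mul' le_rfl (hX.lintegral_exp_deficit_le hσ k hn ha _)).trans_eq ?_
  rw [← ENNReal.ofReal_mul (by positivity), ← ENNReal.ofReal_mul (by positivity),
    mul_assoc, ← Real.exp_add, mul_left_comm, ← Real.exp_add]
  congr 3
  ring

lemma IsRewardTable.lintegral_missCost_le [IsProbabilityMeasure P] (hX : IsRewardTable P X m σ)
    (hσ : 0 < σ) (k : Fin K) {β : ℝ} (hβ : 1 ≤ β) {n : ℕ} (hn : 0 < n) {a y : ℝ}
    (ha : (m k - y) * √n / σ = a) (ha_pos : 0 < a) :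
    ∫⁻ ω, missCost β σ y n ((∑ i ∈ Finset.range n, X k i ω) / n) ∂P ≤
      ENNReal.ofReal (Real.exp (-(7 / 32 * a ^ 2)) * (4 / 3 + 112 / 9 / a ^ 2)) := by
  let F : Ω → ℝ → ENNReal := fun ω u => ENNReal.ofReal ((1 + u) * Real.exp ((u + a / 4) *
    ((y - (∑ i ∈ Finset.range n, X k i ω) / n) * √n / σ) - u ^ 2 / 2))
  have hF : Measurable (Function.uncurry F) := by
    have := hX.measurable k
    unfold F Function.uncurry
    fun_prop
  calc ∫⁻ ω, missCost β σ y n ((∑ i ∈ Finset.range n, X k i ω) / n) ∂P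
      ≤ ∫⁻ ω, 4 * (∫⁻ u in Set.Ioi (0 : ℝ), F ω u) ∂P :=
        lintegral_mono fun ω => missCost_le hβ hσ hn ha_pos.le
    _ = 4 * ∫⁻ u in Set.Ioi (0 : ℝ), ∫⁻ ω, F ω u ∂P := by
        rw [← lintegral_lintegral_swap hF.aemeasurable]
        exact lintegral_const_mul _ hF.lintegral_prod_right'
    _ ≤ 4 * ∫⁻ u in Set.Ioi (0 : ℝ), ENNReal.ofReal (Real.exp (-(7 / 32 * a ^ 2))) *
          ENNReal.ofReal ((1 + u) * Real.exp (-(3 / 4 * a * u))) :=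
        mul_le_mul' le_rfl (setLIntegral_mono' measurableSet_Ioi fun u hu =>
          hX.lintegral_missCost_integrand_le hσ.ne' k hn ha (Set.mem_Ioi.1 hu).le)
    _ = ENNReal.ofReal (Real.exp (-(7 / 32 * a ^ 2)) *
          (4 * (1 / (3 / 4 * a) + 1 / (3 / 4 * a) ^ 2))) := by
        rw [lintegral_const_mul _ (by fun_prop), lintegral_one_add_mul_exp (by positivity),
          ENNReal.ofReal_mul (by positivity), ENNReal.ofReal_mul (by positivity),
          ENNReal.ofReal_ofNat, mul_left_comm]
    _ ≤ ENNReal.ofReal (Real.exp (-(7 / 32 * a ^ 2)) * (4 / 3 + 112 / 9 / a ^ 2)) :=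
        ENNReal.ofReal_le_ofReal (mul_le_mul_of_nonneg_left
          (four_mul_inv_add_inv_sq_le ha_pos.ne') (Real.exp_pos _).le)

end ExpectedMissCost

section MissCostSum

lemma sum_Icc_pow_le {x : ℝ} (hx₀ : 0 ≤ x) (hx₁ : x < 1) (M : ℕ) :
    ∑ j ∈ Finset.Icc 1 M, x ^ j ≤ x / (1 - x) := by
  have hsum : HasSum (fun j => x ^ (j + 1)) (x / (1 - x)) := by
    simpa [pow_succ, mul_comm, div_eq_mul_inv]
      using (hasSum_geometric_of_lt_one hx₀ hx₁).mul_left x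
  rw [← Finset.Ico_add_one_right_eq_Icc, ← Finset.sum_Ico_add' (fun j => x ^ j) 0 M 1]
  exact sum_le_hasSum _ (fun j _ => by positivity) hsum

lemma sum_Icc_pow_div_le {x : ℝ} (hx₀ : 0 ≤ x) (hx₁ : x < 1) (M : ℕ) :
    ∑ j ∈ Finset.Icc 1 M, x ^ j / j ≤ -Real.log (1 - x) := by
  have hsum : HasSum (fun j : ℕ => x ^ (j + 1) / ((j + 1 : ℕ) : ℝ)) (-Real.log (1 - x)) := by
    simpa using Real.hasSum_pow_div_log_of_abs_lt_one ((abs_of_nonneg hx₀).trans_lt hx₁)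
  rw [← Finset.Ico_add_one_right_eq_Icc, ← Finset.sum_Ico_add' (fun j : ℕ => x ^ j / (j : ℝ)) 0 M 1]
  exact sum_le_hasSum _ (fun j _ => by positivity) hsum

lemma sum_exp_mul_add_div_le {b A B : ℝ} (hb : 0 < b) (hA : 0 ≤ A) (hB : 0 ≤ B) (M : ℕ) :
    ∑ j ∈ Finset.Icc 1 M, Real.exp (-(b * j)) * (A + B / j) ≤
      A * (1 / (Real.exp b - 1)) + B * Real.log (1 + 1 / (Real.exp b - 1)) := by
  set x := Real.exp (-b) with hx
  have hx_pos : 0 < x := Real.exp_pos _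
  have hx_lt : x < 1 := Real.exp_lt_one_iff.2 (neg_lt_zero.2 hb)
  have hx_ne : 1 - x ≠ 0 := (sub_pos.2 hx_lt).ne'
  have hgeom : x / (1 - x) = 1 / (Real.exp b - 1) := by
    rw [← neg_neg b, Real.exp_neg, ← hx]
    field_simp
  have hlog : -Real.log (1 - x) = Real.log (1 + 1 / (Real.exp b - 1)) := by
    rw [← hgeom, ← Real.log_inv]
    congr 1
    field_simp [hx_ne]
    ring
  calc ∑ j ∈ Finset.Icc 1 M, Real.exp (-(b * j)) * (A + B / j)
      = A * ∑ j ∈ Finset.Icc 1 M, x ^ j + B * ∑ j ∈ Finset.Icc 1 M, x ^ j / j := by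
        rw [Finset.mul_sum, Finset.mul_sum, ← Finset.sum_add_distrib]
        refine Finset.sum_congr rfl fun j _ => ?_
        rw [← neg_mul, mul_comm, hx, mul_comm (-b), Real.exp_nat_mul]
        ring
    _ ≤ A * (x / (1 - x)) + B * -Real.log (1 - x) :=
        add_le_add (mul_le_mul_of_nonneg_left (sum_Icc_pow_le hx_pos.le hx_lt M) hA)
          (mul_le_mul_of_nonneg_left (sum_Icc_pow_div_le hx_pos.le hx_lt M) hB)
    _ = A * (1 / (Real.exp b - 1)) + B * Real.log (1 + 1 / (Real.exp b - 1)) := by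
        rw [hgeom, hlog]

lemma one_div_exp_sub_one_le {b c : ℝ} (hc : 0 < c) (hb : 0 ≤ b) (h : c ≤ b + b ^ 2 / 2) :
    1 / (Real.exp b - 1) ≤ 1 / c :=
  one_div_le_one_div_of_le hc (by linarith [Real.quadratic_le_exp_of_nonneg hb])

lemma missCost_sum_bound_le_one {b r : ℝ} (hbr : b * r = 7 / 128) (hb : 51 / 25 ≤ b) :
    4 / 3 * (1 / (Real.exp b - 1)) + 448 / 9 * r * Real.log (1 + 1 / (Real.exp b - 1)) ≤ 1 := by
  have hq : 1 / (Real.exp b - 1) ≤ 1 / 4 :=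
    one_div_exp_sub_one_le (by norm_num) (by linarith) (by nlinarith)
  have hq_nonneg : 0 ≤ 1 / (Real.exp b - 1) :=
    one_div_nonneg.2 (by linarith [Real.add_one_le_exp b])
  have hr_nonneg : 0 ≤ r := (pos_of_mul_pos_right (by rw [hbr]; norm_num) (by linarith : 0 ≤ b)).le
  have hr : r ≤ 27 / 1000 := by nlinarith
  have hlog : Real.log (1 + 1 / (Real.exp b - 1)) ≤ 1 / 4 := by
    linarith [Real.log_le_sub_one_of_pos (show 0 < 1 + 1 / (Real.exp b - 1) by linarith)]
  nlinarith [mul_le_mul_of_nonneg_left hlog hr_nonneg, hr]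

lemma missCost_sum_bound_le_half {b r t : ℝ} (hr : 0 < r) (hbr : b * r = 7 / 128) (ht : 3 ≤ t)
    (hrt : 108 * Real.log t * r ≤ t) (hbt : 59 / 10 * Real.log t ≤ b * t) :
    4 / 3 * (1 / (Real.exp b - 1)) + 448 / 9 * r * Real.log (1 + 1 / (Real.exp b - 1)) ≤
      t / 2 := by
  have hb : 0 < b := pos_of_mul_pos_left (by rw [hbr]; norm_num) hr.le
  have hlog_t : 1 ≤ Real.log t := by
    rw [Real.le_log_iff_exp_le (by linarith)]
    linarith [Real.exp_one_lt_three]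
  have hq : 1 / (Real.exp b - 1) ≤ t / (59 / 10 * Real.log t) := by
    rw [← one_div_div (59 / 10 * Real.log t)]
    refine one_div_exp_sub_one_le (by positivity) hb.le ?_
    rw [div_le_iff₀ (by linarith)]
    nlinarith [sq_nonneg b]
  have hqt : 1 / (Real.exp b - 1) ≤ 17 / 100 * t := by
    refine hq.trans ?_
    rw [div_le_iff₀ (by positivity)]
    nlinarith
  have hq_nonneg : 0 ≤ 1 / (Real.exp b - 1) :=
    one_div_nonneg.2 (by linarith [Real.add_one_le_exp b])
  have hlog : Real.log (1 + 1 / (Real.exp b - 1)) ≤ Real.log t - 62 / 125 := by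
    calc Real.log (1 + 1 / (Real.exp b - 1)) ≤ Real.log (t * (63 / 125)) :=
          Real.log_le_log (by linarith) (by linarith)
      _ = Real.log t + Real.log (63 / 125) := Real.log_mul (by linarith) (by norm_num)
      _ ≤ Real.log t - 62 / 125 := by
          linarith [Real.log_le_sub_one_of_pos (show (0 : ℝ) < 63 / 125 by norm_num)]
  have hlog_nonneg := Real.log_nonneg (le_add_of_nonneg_right (a := 1) hq_nonneg)
  calc 4 / 3 * (1 / (Real.exp b - 1)) + 448 / 9 * r * Real.log (1 + 1 / (Real.exp b - 1))
      ≤ 4 / 3 * (t / (59 / 10 * Real.log t)) +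
          448 / 9 * (t / (108 * Real.log t)) * (Real.log t - 62 / 125) := by
        have hr' : r ≤ t / (108 * Real.log t) := by
          rw [le_div_iff₀ (by positivity)]
          linarith
        gcongr
    _ = (40 / 177 + 112 / 243 * (Real.log t - 62 / 125)) * t / Real.log t := by
        field_simp
        ring
    _ ≤ t / 2 := by
        rw [div_le_iff₀ (by linarith)]
        nlinarith

lemma missCost_sum_bound_le {t : ℕ} (ht : 2 ≤ t) {r : ℝ} (hr : 0 < r)
    (hrt : 108 * Real.log t * r ≤ t) :
    4 / 3 * (1 / (Real.exp (7 / (128 * r)) - 1)) +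
      448 / 9 * r * Real.log (1 + 1 / (Real.exp (7 / (128 * r)) - 1)) ≤ t / 2 := by
  set b := 7 / (128 * r) with hb_def
  have hb : 0 < b := by positivity
  have hbr : b * r = 7 / 128 := by
    rw [hb_def]
    field_simp
  have hlog : 0 ≤ Real.log t := Real.log_natCast_nonneg t
  have hbt : 59 / 10 * Real.log t ≤ b * t := by
    nlinarith [mul_le_mul_of_nonneg_left hrt hb.le]
  rcases ht.eq_or_lt with rfl | h3
  · push_cast at hbt ⊢
    rw [div_self two_ne_zero]
    exact missCost_sum_bound_le_one hbr (by linarith [Real.log_two_gt_d9])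
  · exact missCost_sum_bound_le_half hr hbr (by exact_mod_cast h3) hrt hbt

end MissCostSum

section TotalMissCost

lemma sum_ite_pulls_le {Ω : Type*} {K : ℕ} {arm : ℕ → Ω → Fin K} (f : ℕ → ENNReal)
    (ks : Fin K) (T : ℕ) (ω : Ω) :
    (∑ s ∈ Finset.range T,
        if arm s ω = ks ∧ 0 < pulls arm ks s ω then f (pulls arm ks s ω) else 0) ≤
      ∑ j ∈ Finset.Icc 1 T, f j := by
  set S := (Finset.range T).filter fun s => arm s ω = ks ∧ 0 < pulls arm ks s ω with hS
  have hinj : Set.InjOn (fun s => pulls arm ks s ω) S := by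
    intro a ha b hb hab
    simp only [hS, Finset.coe_filter, Set.mem_ofPred_eq] at ha hb
    exact pulls_inj ha.2.1 hb.2.1 hab
  rw [← Finset.sum_filter, ← hS, ← Finset.sum_image (f := f) hinj]
  refine Finset.sum_le_sum_of_subset fun j hj => ?_
  obtain ⟨s, hs, rfl⟩ := Finset.mem_image.1 hj
  rw [hS, Finset.mem_filter, Finset.mem_range] at hs
  exact Finset.mem_Icc.2 ⟨hs.2.2, pulls_le.trans hs.1.le⟩

variable {Ω : Type*} [MeasurableSpace Ω] {P : Measure Ω} {K : ℕ} {β σ D y : ℝ}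
  {X : Fin K → ℕ → Ω → ℝ} {arm : ℕ → Ω → Fin K} {m : Fin K → ℝ}

lemma IsRewardTable.sum_lintegral_missCost_le [IsProbabilityMeasure P] (hX : IsRewardTable P X m σ)
    (hσ : 0 < σ) (k : Fin K) (hβ : 1 ≤ β) {τ : ℕ} (hτ : 2 ≤ τ) (hD : 0 < D)
    (hDτ : 108 * (σ ^ 2 * Real.log τ) ≤ D ^ 2 * τ) (M : ℕ) :
    ∑ j ∈ Finset.Icc 1 M, ∫⁻ ω,
        missCost β σ (m k - D / 2) j ((∑ i ∈ Finset.range j, X k i ω) / j) ∂P ≤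
      ENNReal.ofReal (τ / 2) := by
  set r := σ ^ 2 / D ^ 2 with hr
  have hr_pos : 0 < r := by positivity
  have hr_mul : r * D ^ 2 = σ ^ 2 := by
    rw [hr]
    field_simp
  have hrτ : 108 * Real.log τ * r ≤ τ := by
    rw [hr, mul_div_assoc', div_le_iff₀ (by positivity)]
    linarith
  have hterm : ∀ j ∈ Finset.Icc 1 M, ∫⁻ ω,
      missCost β σ (m k - D / 2) j ((∑ i ∈ Finset.range j, X k i ω) / j) ∂P ≤
      ENNReal.ofReal (Real.exp (-(7 / (128 * r) * j)) * (4 / 3 + 448 / 9 * r / j)) := by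
    intro j hj
    have hj_pos : 0 < j := (Finset.mem_Icc.1 hj).1
    have hj' : (0 : ℝ) < j := Nat.cast_pos.2 hj_pos
    refine (hX.lintegral_missCost_le hσ k hβ hj_pos (a := D / 2 * √j / σ)
      (by rw [sub_sub_cancel]) (by positivity)).trans_eq ?_
    have ha : (D / 2 * √(j : ℝ) / σ) ^ 2 = j / (4 * r) := by
      rw [div_pow, mul_pow, Real.sq_sqrt hj'.le, ← hr_mul]
      field_simp
      norm_num
    rw [ha]
    congr 3 <;> field_simp <;> norm_num
  refine (Finset.sum_le_sum hterm).trans ?_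
  rw [← ENNReal.ofReal_sum_of_nonneg fun j _ => by positivity]
  exact ENNReal.ofReal_le_ofReal ((sum_exp_mul_add_div_le (by positivity) (by norm_num)
    (by positivity) M).trans (missCost_sum_bound_le hτ hr_pos hrτ))

/-- The expected miss cost of round `s + 1`, if that round pulls the optimal arm `ks`. -/
noncomputable def roundMissCost (P : Measure Ω) (β σ y : ℝ) (X : Fin K → ℕ → Ω → ℝ)
    (arm : ℕ → Ω → Fin K) (ks : Fin K) (s : ℕ) : ENNReal :=
  ∫⁻ ω in {ω | arm s ω = ks ∧ 0 < pulls arm ks s ω},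
    missCost β σ y (pulls arm ks s ω) (empMean X arm ks s ω) ∂P

lemma sum_roundMissCost_le (harm : ∀ t, Measurable (arm t)) (hX : ∀ k i, Measurable (X k i))
    (ks : Fin K) (T : ℕ) :
    ∑ s ∈ Finset.range T, roundMissCost P β σ y X arm ks s ≤
      ∑ j ∈ Finset.Icc 1 T, ∫⁻ ω,
        missCost β σ y j ((∑ i ∈ Finset.range j, X ks i ω) / j) ∂P := by
  classical
  have hpulled : ∀ s, MeasurableSet {ω | arm s ω = ks ∧ 0 < pulls arm ks s ω} := fun s =>
    (harm s (measurableSet_singleton ks)).inter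
      (measurable_pulls (fun r _ => harm r) ks (measurableSet_Ioi (a := 0)))
  have hcost : ∀ s, Measurable fun ω =>
      missCost β σ y (pulls arm ks s ω) (empMean X arm ks s ω) := fun s =>
    (measurable_missCost β σ y).comp ((measurable_pulls (fun r _ => harm r) ks).prodMk
      (measurable_empMean (fun r _ => harm r) hX ks))
  have hcost_fixed : ∀ j : ℕ, Measurable fun ω =>
      missCost β σ y j ((∑ i ∈ Finset.range j, X ks i ω) / j) := fun j =>
    (measurable_missCost β σ y).comp (measurable_const.prodMk
      ((Finset.measurable_sum _ fun i _ => hX ks i).div_const _))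
  unfold roundMissCost
  rw [← lintegral_finsetSum _ fun j _ => hcost_fixed j]
  simp_rw [← lintegral_indicator (hpulled _)]
  rw [← lintegral_finsetSum _ fun s _ => (hcost s).indicator (hpulled s)]
  refine lintegral_mono fun ω => ?_
  simp only [Set.indicator_apply, Set.mem_ofPred_eq]
  exact sum_ite_pulls_le
    (fun j => missCost β σ y j ((∑ i ∈ Finset.range j, X ks i ω) / j)) ks T ω

end TotalMissCost

section DuelEvent

variable {Θ Ω : Type*} [MeasurableSpace Ω] {P : Measure Ω} {K : ℕ} {μ : Fin K → Θ → ℝ} {θs : Θ}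
  {ks k l : Fin K} {α β σ D J : ℝ} {X : Fin K → ℕ → Ω → ℝ} {G : ℕ → Fin K → Ω → ℝ}
  {arm : ℕ → Ω → Fin K} {s t₀ t₁ b : ℕ} {ω : Ω}

lemma IsTSC.pulls_best_pos (harm : IsTSC P μ α β σ X G arm) (hopt : IsOptimal μ θs ks)
    (hg : θs ∈ confSet μ α σ X arm s ω) (hn : 0 < pulls arm (arm s ω) s ω) :
    0 < pulls arm ks s ω := by
  by_contra! h
  have hmax := harm.argmax s ω ks (hopt.mem_competitiveSet hg)
  rw [tsSample, if_pos (Nat.le_zero.1 h), tsSample_of_pos hn] at hmax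
  exact hmax.not_gt (EReal.coe_lt_top _)

lemma IsTSC.pulls_best_lt (harm : IsTSC P μ α β σ X G arm) (hα : 0 ≤ α) (hD : 0 < D)
    (hdeg : ENNReal.ofReal D ≤ degree μ θs ks k) (hJ : 0 < pullThreshold α σ D b) (hs : s ≤ b)
    (hg : θs ∈ confSet μ α σ X arm s ω) (hk : arm s ω = k) :
    pulls arm ks s ω < pullThreshold α σ D b := by
  set n := pulls arm ks s ω
  rcases Nat.eq_zero_or_pos n with hn | hn
  · simpa [hn] using hJ
  have hn' : (0 : ℝ) < n := by exact_mod_cast hn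
  have hwidth : D < 2 * width α σ b n :=
    (lt_two_mul_width_of_mem_competitiveSet hdeg hg (hk ▸ harm.mem s ω) hn).trans_le
      (mul_le_mul_of_nonneg_left (width_mono hα hs n) zero_le_two)
  by_contra! hJn
  have := width_mul_le (σ := σ) hα hD hn'.le (by nlinarith)
  nlinarith

/-- Arm `l` is pulled in round `s + 1` while the confidence set is correct, arm `l` has been pulled
at least `chargeFactor K * J` times, and `ks` has been pulled at least once, but less than `J`
times. These are the pulls that are charged to pulls of `ks`. -/
def duelEvent (μ : Fin K → Θ → ℝ) (θs : Θ) (α σ : ℝ) (X : Fin K → ℕ → Ω → ℝ)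
    (arm : ℕ → Ω → Fin K) (ks : Fin K) (J : ℝ) (l : Fin K) (s : ℕ) : Set Ω :=
  {ω | arm s ω = l ∧ θs ∈ confSet μ α σ X arm s ω ∧ chargeFactor K * J ≤ pulls arm l s ω ∧
    0 < pulls arm ks s ω ∧ pulls arm ks s ω < J}

lemma measurableSet_duelEvent (harm : ∀ t, Measurable (arm t)) (hX : ∀ k i, Measurable (X k i))
    (J : ℝ) (l : Fin K) (s : ℕ) : MeasurableSet (duelEvent μ θs α σ X arm ks J l s) :=
  (harm s (measurableSet_singleton l)).inter <|
    (measurableSet_mem_confSet (fun r _ => harm r) hX θs).inter <|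
    (measurableSet_pulls harm l s {n | chargeFactor K * J ≤ n}).inter <|
    (measurableSet_pulls harm ks s {n | 0 < n}).inter <|
    measurableSet_pulls harm ks s {n | n < J}

lemma IsTSC.mem_duelEvent (harm : IsTSC P μ α β σ X G arm) (hopt : IsOptimal μ θs ks)
    (hg : θs ∈ confSet μ α σ X arm s ω) (hl : arm s ω = l)
    (hJl : chargeFactor K * J ≤ pulls arm l s ω) (hJ : pulls arm ks s ω < J) :
    ω ∈ duelEvent μ θs α σ X arm ks J l s := by
  have hJ0 : 0 < J := (Nat.cast_nonneg _).trans_lt hJ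
  have hone : (1 : ℝ) ≤ chargeFactor K := by exact_mod_cast one_le_chargeFactor K
  have hpulled : (0 : ℝ) < pulls arm l s ω := by nlinarith [hJ0]
  refine ⟨hl, hg, hJl, harm.pulls_best_pos hopt hg ?_, hJ⟩
  rw [hl]
  exact_mod_cast hpulled

open scoped Classical in
lemma IsTSC.card_filter_arm_eq_le (harm : IsTSC P μ α β σ X G arm) (hopt : IsOptimal μ θs ks)
    (hg : ∀ s ∈ Finset.Ico t₀ t₁, θs ∈ confSet μ α σ X arm s ω) (hJ : pulls arm ks t₁ ω < J)
    (l : Fin K) :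
    ((Finset.Ico t₀ t₁).filter (arm · ω = l)).card ≤ ⌈chargeFactor K * J⌉₊ +
      ((Finset.Ico t₀ t₁).filter (ω ∈ duelEvent μ θs α σ X arm ks J l ·)).card := by
  refine (Finset.card_le_card fun s hs => ?_).trans ((Finset.card_union_le _ _).trans
    (Nat.add_le_add_right (card_filter_arm_eq_and_pulls_mem_Ico_le arm l ω
      (Finset.Ico t₀ t₁) 0 ⌈chargeFactor K * J⌉₊) _))
  obtain ⟨hsW, hsl⟩ := Finset.mem_filter.1 hs
  rw [Finset.mem_union, Finset.mem_filter, Finset.mem_filter]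
  refine (lt_or_ge (pulls arm l s ω) ⌈chargeFactor K * J⌉₊).imp
    (fun h => ⟨hsW, hsl, Nat.zero_le _, h⟩)
    fun h => ⟨hsW, harm.mem_duelEvent hopt (hg s hsW) hsl (Nat.ceil_le.1 h) ?_⟩
  exact (Nat.cast_le.2 (pulls_mono (Finset.mem_Ico.1 hsW).2.le)).trans_lt hJ

open scoped Classical in
lemma IsTSC.le_card_filter_mem_duelEvent (harm : IsTSC P μ α β σ X G arm)
    (hopt : IsOptimal μ θs ks) (hg : ∀ s ∈ Finset.Ico t₀ t₁, θs ∈ confSet μ α σ X arm s ω)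
    (hJ : pulls arm ks t₁ ω < J) :
    t₁ - t₀ - J - (K - 1) * (chargeFactor K * J + 1) ≤
      (((Finset.univ.erase ks ×ˢ Finset.Ico t₀ t₁).filter fun p =>
        ω ∈ duelEvent μ θs α σ X arm ks J p.1 p.2).card : ℝ) := by
  set W := Finset.Ico t₀ t₁
  set N := ((Finset.univ.erase ks ×ˢ W).filter fun p =>
    ω ∈ duelEvent μ θs α σ X arm ks J p.1 p.2).card with hN
  have hbest : (W.filter (arm · ω = ks)).card ≤ pulls arm ks t₁ ω :=
    Finset.card_le_card (Finset.filter_subset_filter _ fun s hs =>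
      Finset.mem_range.2 (Finset.mem_Ico.1 hs).2)
  have hrest : ∑ l ∈ Finset.univ.erase ks, (W.filter (arm · ω = l)).card ≤
      (K - 1) * ⌈chargeFactor K * J⌉₊ + N := by
    refine (Finset.sum_le_sum fun l _ => harm.card_filter_arm_eq_le hopt hg hJ l).trans_eq ?_
    rw [Finset.sum_add_distrib, Finset.sum_const, Finset.card_erase_of_mem (Finset.mem_univ ks),
      Finset.card_fin, smul_eq_mul, hN, Finset.card_filter, Finset.sum_product]
    simp_rw [Finset.card_filter]
    rfl
  have hcount : t₁ - t₀ ≤ pulls arm ks t₁ ω + ((K - 1) * ⌈chargeFactor K * J⌉₊ + N) := by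
    rw [← Nat.card_Ico, Finset.card_eq_sum_card_fiberwise (f := (arm · ω)) (t := Finset.univ)
      (by simp), ← Finset.add_sum_erase _ _ (Finset.mem_univ ks)]
    exact add_le_add hbest hrest
  have hcount' : (t₁ : ℝ) ≤ t₀ + (pulls arm ks t₁ ω + ((K - 1) * ⌈chargeFactor K * J⌉₊ + N)) := by
    have hK : 1 ≤ K := ks.pos
    rw [← Nat.cast_one (R := ℝ), ← Nat.cast_sub hK]
    exact_mod_cast Nat.sub_le_iff_le_add'.1 hcount
  have hK' : (1 : ℝ) ≤ K := by exact_mod_cast ks.pos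
  have hJ0 : 0 ≤ J := (Nat.cast_nonneg _).trans hJ.le
  have hceil : (⌈chargeFactor K * J⌉₊ : ℝ) ≤ chargeFactor K * J + 1 :=
    (Nat.ceil_lt_add_one (by positivity)).le
  nlinarith

end DuelEvent

section Charging

variable {Θ Ω : Type*} [MeasurableSpace Ω] {P : Measure Ω} [IsProbabilityMeasure P] {K : ℕ}
  {μ : Fin K → Θ → ℝ} {θs : Θ} {ks l : Fin K} {α β σ D : ℝ} {X : Fin K → ℕ → Ω → ℝ}
  {G : ℕ → Fin K → Ω → ℝ} {arm : ℕ → Ω → Fin K} {s t₀ t₁ b : ℕ}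

lemma IsTSC.measureReal_duelEvent_le (harm : IsTSC P μ α β σ X G arm)
    (hX : ∀ k i, Measurable (X k i)) (hopt : IsOptimal μ θs ks) (hl : l ≠ ks) (hα : 0 ≤ α)
    (hβ : 0 < β) (hσ : σ ≠ 0) (hD : 0 < D) (hgap : D ≤ gapMin μ θs ks) (hs : s ≤ b)
    (hfin : roundMissCost P β σ (μ ks θs - D / 2) X arm ks s ≠ ⊤) :
    P.real (duelEvent μ θs α σ X arm ks (pullThreshold α σ D b) l s) ≤
      chargeFactor K * P.real {ω | arm s ω = ks ∧ 0 < pulls arm ks s ω ∧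
        pulls arm ks s ω < pullThreshold α σ D b} +
      (roundMissCost P β σ (μ ks θs - D / 2) X arm ks s).toReal := by
  set A := {ω | arm s ω = ks ∧ 0 < pulls arm ks s ω ∧ pulls arm ks s ω < pullThreshold α σ D b}
  have hcharge : P (duelEvent μ θs α σ X arm ks (pullThreshold α σ D b) l s) ≤
      chargeFactor K * P A + roundMissCost P β σ (μ ks θs - D / 2) X arm ks s := by
    refine (harm.measure_arm_eq_le hX hopt hl hα hβ hσ hD hgap hs).trans ?_
    rw [lintegral_add_left measurable_const, setLIntegral_const]
    have hsub : A ⊆ {ω | arm s ω = ks ∧ 0 < pulls arm ks s ω} := fun ω hω => ⟨hω.1, hω.2.1⟩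
    exact add_le_add_right (lintegral_mono_set hsub) _
  have hA : chargeFactor K * P A ≠ ⊤ := ENNReal.mul_ne_top (by simp) (measure_ne_top P A)
  have hreal := ENNReal.toReal_mono (ENNReal.add_ne_top.2 ⟨hA, hfin⟩) hcharge
  rw [ENNReal.toReal_add hA hfin, ENNReal.toReal_mul] at hreal
  simpa only [Measure.real, ENNReal.toReal_natCast] using hreal

lemma sum_measureReal_arm_eq_and_pulls_lt_le (harm : ∀ t, Measurable (arm t)) (ks : Fin K) {J : ℝ}
    (hJ : 0 ≤ J) {S : Finset ℕ} (hS : ∀ s ∈ S, t₀ ≤ s) :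
    ∑ s ∈ S, P.real {ω | arm s ω = ks ∧ 0 < pulls arm ks s ω ∧ pulls arm ks s ω < J} ≤
      J * P.real {ω | pulls arm ks t₀ ω < J} := by
  refine sum_measureReal_le_mul
    (fun s => (harm s (measurableSet_singleton ks)).inter
      ((measurableSet_pulls harm ks s {n | 0 < n}).inter
        (measurableSet_pulls harm ks s {n | n < J})))
    (measurableSet_pulls harm ks t₀ {n | n < J})
    (fun s hs ω hω => (Nat.cast_le.2 (pulls_mono (hS s hs))).trans_lt hω.2.2) fun ω => ?_
  have hcount := card_filter_arm_eq_and_pulls_mem_Ico_le arm ks ω S 1 ⌈J⌉₊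
  have hfloor : ⌈J⌉₊ - 1 ≤ ⌊J⌋₊ := Nat.sub_le_iff_le_add.2 (Nat.ceil_le_floor_add_one J)
  simp only [Nat.lt_ceil, Nat.succ_le_iff] at hcount
  calc _ ≤ (⌊J⌋₊ : ℝ) := by
        refine Nat.cast_le.2 (le_trans (le_of_eq ?_) (hcount.trans hfloor))
        congr
    _ ≤ J := Nat.floor_le hJ

lemma IsTSC.sum_measureReal_duelEvent_le (harm : IsTSC P μ α β σ X G arm)
    (hX : ∀ k i, Measurable (X k i)) (hopt : IsOptimal μ θs ks) (hl : l ≠ ks) (hα : 0 ≤ α)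
    (hβ : 0 < β) (hσ : σ ≠ 0) (hD : 0 < D) (hgap : D ≤ gapMin μ θs ks) (hb : t₁ ≤ b)
    (hfin : ∀ s, roundMissCost P β σ (μ ks θs - D / 2) X arm ks s ≠ ⊤) :
    ∑ s ∈ Finset.Ico t₀ t₁,
        P.real (duelEvent μ θs α σ X arm ks (pullThreshold α σ D b) l s) ≤
      chargeFactor K * pullThreshold α σ D b *
          P.real {ω | pulls arm ks t₀ ω < pullThreshold α σ D b} +
        ∑ s ∈ Finset.Ico t₀ t₁, (roundMissCost P β σ (μ ks θs - D / 2) X arm ks s).toReal := by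
  refine (Finset.sum_le_sum fun s hs => harm.measureReal_duelEvent_le hX hopt hl hα hβ hσ hD hgap
    ((Finset.mem_Ico.1 hs).2.le.trans hb) (hfin s)).trans ?_
  rw [Finset.sum_add_distrib, ← Finset.mul_sum, mul_assoc]
  gcongr
  exact sum_measureReal_arm_eq_and_pulls_lt_le harm.measurable ks (pullThreshold_nonneg hα)
    fun s hs => (Finset.mem_Ico.1 hs).1

lemma IsTSC.mul_measureReal_confSet_and_pulls_best_lt_le (harm : IsTSC P μ α β σ X G arm)
    (hX : ∀ k i, Measurable (X k i)) (hopt : IsOptimal μ θs ks) (hα : 0 ≤ α) (hβ : 0 < β)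
    (hσ : σ ≠ 0) (hD : 0 < D) (hgap : D ≤ gapMin μ θs ks) (hb : t₁ ≤ b)
    (hfin : ∀ s, roundMissCost P β σ (μ ks θs - D / 2) X arm ks s ≠ ⊤) {H : ℝ}
    (hH : ∑ s ∈ Finset.Ico t₀ t₁, (roundMissCost P β σ (μ ks θs - D / 2) X arm ks s).toReal ≤ H)
    {J : ℝ} (hJ : J = pullThreshold α σ D b) :
    (t₁ - t₀ - J - (K - 1) * (chargeFactor K * J + 1)) *
        P.real {ω | (∀ s ∈ Finset.Ico t₀ t₁, θs ∈ confSet μ α σ X arm s ω) ∧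
          pulls arm ks t₁ ω < J} ≤
      (K - 1) * (chargeFactor K * J + H) := by
  classical
  set W := Finset.Ico t₀ t₁
  set R := (Finset.univ : Finset (Fin K)).erase ks with hR
  have hduels : ∀ l ∈ R, ∑ s ∈ W, P.real (duelEvent μ θs α σ X arm ks J l s) ≤
      chargeFactor K * J + H := by
    intro l hl
    have hJ0 : 0 ≤ J := hJ ▸ pullThreshold_nonneg hα
    refine hJ ▸ (harm.sum_measureReal_duelEvent_le hX hopt (Finset.ne_of_mem_erase hl)
      hα hβ hσ hD hgap hb hfin).trans (add_le_add ?_ hH)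
    exact mul_le_of_le_one_right (hJ ▸ by positivity) measureReal_le_one
  calc _ ≤ ∑ p ∈ R ×ˢ W, P.real (duelEvent μ θs α σ X arm ks J p.1 p.2) :=
        mul_measureReal_le_sum (E := fun p : Fin K × ℕ => duelEvent μ θs α σ X arm ks J p.1 p.2)
          (fun p => measurableSet_duelEvent harm.measurable hX J p.1 p.2)
          fun ω hω => harm.le_card_filter_mem_duelEvent hopt hω.1 hω.2
    _ ≤ R.card • (chargeFactor K * J + H) := by
        rw [Finset.sum_product]
        exact Finset.sum_le_card_nsmul _ _ _ hduels
    _ = (K - 1) * (chargeFactor K * J + H) := by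
        rw [hR, Finset.card_erase_of_mem (Finset.mem_univ ks), Finset.card_fin, nsmul_eq_mul,
          Nat.cast_sub ks.pos, Nat.cast_one]

lemma IsTSC.measureReal_pulls_best_lt_le (harm : IsTSC P μ α β σ X G arm)
    (hX : IsRewardTable P X (fun k => μ k θs) σ) (hopt : IsOptimal μ θs ks) (hα : 0 ≤ α)
    (hβ : 0 < β) (hσ : σ ≠ 0) (hD : 0 < D) (hgap : D ≤ gapMin μ θs ks) (ht₀ : 0 < t₀)
    (hb : t₁ ≤ b) (hfin : ∀ s, roundMissCost P β σ (μ ks θs - D / 2) X arm ks s ≠ ⊤) {H : ℝ}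
    (hH : ∑ s ∈ Finset.Ico t₀ t₁, (roundMissCost P β σ (μ ks θs - D / 2) X arm ks s).toReal ≤ H)
    {J q : ℝ} (hJ : J = pullThreshold α σ D b)
    (hq : q = t₁ - t₀ - J - (K - 1) * (chargeFactor K * J + 1)) (hq0 : 0 < q) :
    P.real {ω | pulls arm ks t₁ ω < J} ≤
      ∑ s ∈ Finset.Ico t₀ t₁, 2 * K * (s : ℝ) ^ (1 - α) +
        (K - 1) * (chargeFactor K * J + H) / q := by
  set W := Finset.Ico t₀ t₁
  set A := {ω | (∀ s ∈ W, θs ∈ confSet μ α σ X arm s ω) ∧ pulls arm ks t₁ ω < J}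
  have hmarkov : P.real A ≤ (K - 1) * (chargeFactor K * J + H) / q := by
    rw [le_div_iff₀' hq0, hq]
    exact harm.mul_measureReal_confSet_and_pulls_best_lt_le hX.measurable hopt hα hβ hσ hD hgap
      hb hfin hH hJ
  have hsub : {ω | pulls arm ks t₁ ω < J} ⊆
      {ω | ∃ s ∈ W, θs ∉ confSet μ α σ X arm s ω} ∪ A := fun ω hω => by
    by_cases hbad : ∃ s ∈ W, θs ∉ confSet μ α σ X arm s ω
    · exact Or.inl hbad
    · push Not at hbad
      exact Or.inr ⟨hbad, hω⟩
  refine (measureReal_mono hsub (measure_ne_top _ _)).trans ((measureReal_union_le _ _).trans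
    (add_le_add (measureReal_exists_not_mem_confSet_le hX hσ hα arm W fun s hs => ?_) hmarkov))
  exact ht₀.trans_le (Finset.mem_Ico.1 hs).1

end Charging

section Blocks

variable {Θ Ω : Type*} [MeasurableSpace Ω] {P : Measure Ω} [IsProbabilityMeasure P] {K : ℕ}
  {μ : Fin K → Θ → ℝ} {θs : Θ} {ks k : Fin K} {α β σ D : ℝ} {X : Fin K → ℕ → Ω → ℝ}
  {G : ℕ → Fin K → Ω → ℝ} {arm : ℕ → Ω → Fin K}

open scoped Classical in
lemma sum_measureReal_le_of_subset_pulls_mem_Ico {E : ℕ → Set Ω} {A : Set Ω} {S : Finset ℕ}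
    {a b : ℕ} (hE : ∀ s, MeasurableSet (E s)) (hA : MeasurableSet A)
    (hEA : ∀ s ∈ S, E s ⊆ A)
    (hEk : ∀ s ∈ S, E s ⊆ {ω | arm s ω = k ∧ a ≤ pulls arm k s ω ∧ pulls arm k s ω < b}) :
    ∑ s ∈ S, P.real (E s) ≤ (b - a : ℕ) * P.real A := by
  refine sum_measureReal_le_mul hE hA hEA fun ω => Nat.cast_le.2 ?_
  refine (Finset.card_le_card fun s hs => ?_).trans
    (card_filter_arm_eq_and_pulls_mem_Ico_le arm k ω S a b)
  obtain ⟨hsS, hsE⟩ := Finset.mem_filter.1 hs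
  exact Finset.mem_filter.2 ⟨hsS, hEk s hsS hsE⟩

lemma sum_measureReal_arm_eq_and_pulls_lt_ceil_le (harm : ∀ t, Measurable (arm t)) (k : Fin K)
    (S : Finset ℕ) {c : ℝ} (hc : 0 ≤ c) :
    ∑ s ∈ S, P.real {ω | arm s ω = k ∧ pulls arm k s ω < ⌈c⌉₊} ≤ c + 1 := by
  refine (sum_measureReal_le_of_subset_pulls_mem_Ico (a := 0) (b := ⌈c⌉₊) (A := Set.univ)
    (fun s => (harm s (measurableSet_singleton k)).inter
      (measurableSet_pulls harm k s {n | n < ⌈c⌉₊})) .univ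
    (fun _ _ => Set.subset_univ _) fun s _ ω hω => ⟨hω.1, Nat.zero_le _, hω.2⟩).trans ?_
  rw [probReal_univ, mul_one, Nat.sub_zero]
  exact (Nat.ceil_lt_add_one hc).le

lemma natCast_ceil_sub_ceil_le {x y : ℝ} (hx : 0 ≤ x) (hxy : x ≤ y) :
    ((⌈y⌉₊ - ⌈x⌉₊ : ℕ) : ℝ) ≤ y + 1 - x := by
  rw [Nat.cast_sub (Nat.ceil_mono hxy)]
  linarith [Nat.ceil_lt_add_one (hx.trans hxy), Nat.le_ceil x]

lemma IsTSC.sum_measureReal_arm_eq_and_mem_Ico_le (harm : IsTSC P μ α β σ X G arm)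
    (hX : ∀ k i, Measurable (X k i)) (hopt : IsOptimal μ θs ks) (hk : k ≠ ks)
    (hα : 0 ≤ α) (hβ : 0 < β) (hσ : σ ≠ 0) (hD : 0 < D) (hgap : D ≤ gapMin μ θs ks)
    (hdeg : ENNReal.ofReal D ≤ degree μ θs ks k) {J : ℝ} {a b : ℕ}
    (hJ : J = pullThreshold α σ D b) (hJ0 : 0 < J) (N : ℕ)
    (hfin : ∀ s, roundMissCost P β σ (μ ks θs - D / 2) X arm ks s ≠ ⊤) :
    ∑ s ∈ Finset.Ico a b, P.real {ω | arm s ω = k ∧ θs ∈ confSet μ α σ X arm s ω} ≤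
      ∑ s ∈ Finset.Ico a b, P.real {ω | arm s ω = k ∧ pulls arm k s ω < N} +
      ((⌈chargeFactor K * J⌉₊ - N : ℕ) + chargeFactor K * J) * P.real {ω | pulls arm ks a ω < J} +
      ∑ s ∈ Finset.Ico a b, (roundMissCost P β σ (μ ks θs - D / 2) X arm ks s).toReal := by
  set N' := ⌈chargeFactor K * J⌉₊
  let A := {ω | pulls arm ks a ω < J}
  let M : ℕ → Set Ω := fun s => {ω | arm s ω = k ∧
    (N ≤ pulls arm k s ω ∧ pulls arm k s ω < N') ∧ pulls arm ks s ω < J}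
  have hM : ∑ s ∈ Finset.Ico a b, P.real (M s) ≤ (N' - N : ℕ) * P.real A :=
    sum_measureReal_le_of_subset_pulls_mem_Ico
      (fun s => (harm.measurable s (measurableSet_singleton k)).inter
        ((measurableSet_pulls harm.measurable k s {n | N ≤ n ∧ n < N'}).inter
        (measurableSet_pulls harm.measurable ks s {n | n < J})))
      (measurableSet_pulls harm.measurable ks a {n | n < J})
      (fun s hs ω hω =>
        (Nat.cast_le.2 (pulls_mono (Finset.mem_Ico.1 hs).1)).trans_lt hω.2.2)
      fun s _ ω hω => ⟨hω.1, hω.2.1⟩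
  have hduel : ∑ s ∈ Finset.Ico a b, P.real (duelEvent μ θs α σ X arm ks J k s) ≤
      chargeFactor K * J * P.real A +
        ∑ s ∈ Finset.Ico a b, (roundMissCost P β σ (μ ks θs - D / 2) X arm ks s).toReal := by
    subst hJ
    exact harm.sum_measureReal_duelEvent_le hX hopt hk hα hβ hσ hD hgap le_rfl hfin
  have hsub : ∀ s ∈ Finset.Ico a b, {ω | arm s ω = k ∧ θs ∈ confSet μ α σ X arm s ω} ⊆
      {ω | arm s ω = k ∧ pulls arm k s ω < N} ∪ M s ∪ duelEvent μ θs α σ X arm ks J k s := by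
    rintro s hs ω ⟨hω, hg⟩
    have hlt : pulls arm ks s ω < J := hJ ▸ harm.pulls_best_lt hα hD hdeg (hJ ▸ hJ0)
      (Finset.mem_Ico.1 hs).2.le hg hω
    rcases lt_or_ge (pulls arm k s ω) N with hN | hN
    · exact Or.inl (Or.inl ⟨hω, hN⟩)
    rcases lt_or_ge (pulls arm k s ω) N' with hN' | hN'
    · exact Or.inl (Or.inr ⟨hω, ⟨hN, hN'⟩, hlt⟩)
    · exact Or.inr (harm.mem_duelEvent hopt hg hω (Nat.ceil_le.1 hN') hlt)
  refine (Finset.sum_le_sum fun s hs => (measureReal_mono (hsub s hs) (measure_ne_top _ _)).trans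
    ((measureReal_union_le _ _).trans (add_le_add (measureReal_union_le _ _) le_rfl))).trans ?_
  rw [Finset.sum_add_distrib, Finset.sum_add_distrib, add_mul]
  linarith

lemma pullThreshold_mono (hα : 0 ≤ α) : Monotone (pullThreshold α σ D) := fun a b hab => by
  have := log_natCast_mono hab
  unfold pullThreshold
  gcongr

lemma IsTSC.sum_measureReal_arm_eq_and_mem_le_of_blocks (harm : IsTSC P μ α β σ X G arm)
    (hX : ∀ k i, Measurable (X k i)) (hopt : IsOptimal μ θs ks) (hk : k ≠ ks)
    (hα : 0 ≤ α) (hβ : 0 < β) (hσ : σ ≠ 0) (hD : 0 < D) (hgap : D ≤ gapMin μ θs ks)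
    (hdeg : ENNReal.ofReal D ≤ degree μ θs ks k) {t : ℕ → ℕ} (ht : Monotone t) {J : ℕ → ℝ}
    (hJ : ∀ i, J i = pullThreshold α σ D (t i)) (hJ0 : ∀ i, 0 < J i)
    (hfin : ∀ s, roundMissCost P β σ (μ ks θs - D / 2) X arm ks s ≠ ⊤) (I : ℕ) :
    ∑ s ∈ Finset.range (t (I + 1)), P.real {ω | arm s ω = k ∧ θs ∈ confSet μ α σ X arm s ω} ≤
      ∑ s ∈ Finset.range (t (I + 1)),
        P.real {ω | arm s ω = k ∧ pulls arm k s ω < ⌈chargeFactor K * J 1⌉₊} +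
      chargeFactor K * J 1 +
      ∑ i ∈ Finset.range I, (2 * chargeFactor K * J (i + 2) + 1 - chargeFactor K * J 1) *
        P.real {ω | pulls arm ks (t (i + 1)) ω < J (i + 2)} +
      ∑ s ∈ Finset.range (t (I + 1)),
        (roundMissCost P β σ (μ ks θs - D / 2) X arm ks s).toReal := by
  have hblock := fun i a => harm.sum_measureReal_arm_eq_and_mem_Ico_le hX hopt hk hα hβ hσ hD hgap
    hdeg (a := a) (hJ i) (hJ0 i) ⌈chargeFactor K * J 1⌉₊ hfin
  have hJ1 : 0 ≤ chargeFactor K * J 1 := mul_nonneg (Nat.cast_nonneg _) (hJ0 1).le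
  induction I with
  | zero =>
    have hfirst := hblock 1 0
    have hle : chargeFactor K * J 1 * P.real {ω | pulls arm ks 0 ω < J 1} ≤ chargeFactor K * J 1 :=
      mul_le_of_le_one_right hJ1 measureReal_le_one
    rw [Nat.sub_self, Nat.cast_zero, zero_add] at hfirst
    simp only [zero_add, Finset.range_eq_Ico, Finset.Ico_self, Finset.sum_empty, add_zero]
    linarith
  | succ I ih =>
    have hsplit (g : ℕ → ℝ) : ∑ s ∈ Finset.range (t (I + 2)), g s =
        ∑ s ∈ Finset.range (t (I + 1)), g s + ∑ s ∈ Finset.Ico (t (I + 1)) (t (I + 2)), g s :=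
      (Finset.sum_range_add_sum_Ico g (ht (Nat.le_succ _))).symm
    have hJle : chargeFactor K * J 1 ≤ chargeFactor K * J (I + 2) := by
      rw [hJ, hJ]
      exact mul_le_mul_of_nonneg_left (pullThreshold_mono hα (ht (by lia))) (Nat.cast_nonneg _)
    have hceil := mul_le_mul_of_nonneg_right (natCast_ceil_sub_ceil_le hJ1 hJle)
      (measureReal_nonneg (μ := P) (s := {ω | pulls arm ks (t (I + 1)) ω < J (I + 2)}))
    have hnext := hblock (I + 2) (t (I + 1))
    rw [hsplit, hsplit (fun s => P.real {ω | arm s ω = k ∧ _}), hsplit (fun s => ENNReal.toReal _),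
      Finset.sum_range_succ _ I]
    linarith

lemma IsTSC.sum_measureReal_arm_eq_and_mem_le (harm : IsTSC P μ α β σ X G arm)
    (hX : ∀ k i, Measurable (X k i)) (hopt : IsOptimal μ θs ks) (hk : k ≠ ks)
    (hα : 0 ≤ α) (hβ : 0 < β) (hσ : σ ≠ 0) (hD : 0 < D) (hgap : D ≤ gapMin μ θs ks)
    (hdeg : ENNReal.ofReal D ≤ degree μ θs ks k) {t : ℕ → ℕ} (ht : Monotone t) {J : ℕ → ℝ}
    (hJ : ∀ i, J i = pullThreshold α σ D (t i)) (hJ0 : ∀ i, 0 < J i)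
    (hfin : ∀ s, roundMissCost P β σ (μ ks θs - D / 2) X arm ks s ≠ ⊤) {H : ℝ}
    (hH : ∀ T, ∑ s ∈ Finset.range T,
      (roundMissCost P β σ (μ ks θs - D / 2) X arm ks s).toReal ≤ H) (I : ℕ) :
    ∑ s ∈ Finset.range (t (I + 1)), P.real {ω | arm s ω = k ∧ θs ∈ confSet μ α σ X arm s ω} ≤
      2 * chargeFactor K * J 1 + 1 +
      ∑ i ∈ Finset.range I, (2 * chargeFactor K * J (i + 2) + 1 - chargeFactor K * J 1) *
        P.real {ω | pulls arm ks (t (i + 1)) ω < J (i + 2)} + H := by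
  have hblocks := harm.sum_measureReal_arm_eq_and_mem_le_of_blocks hX hopt hk hα hβ hσ hD hgap hdeg
    ht hJ hJ0 hfin I
  have hfirst := sum_measureReal_arm_eq_and_pulls_lt_ceil_le (P := P) harm.measurable k
    (Finset.range (t (I + 1))) (mul_nonneg (Nat.cast_nonneg (chargeFactor K)) (hJ0 1).le)
  linarith [hH (t (I + 1))]

end Blocks

section BlockThreshold

variable {K τ m n : ℕ} {α σ D : ℝ}

lemma pullThreshold_mul (hm : m ≠ 0) (hn : n ≠ 0) :
    pullThreshold α σ D (m * n) = pullThreshold α σ D m + pullThreshold α σ D n := by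
  unfold pullThreshold
  rw [Nat.cast_mul, Real.log_mul (Nat.cast_ne_zero.2 hm) (Nat.cast_ne_zero.2 hn)]
  ring

lemma pullThreshold_pow (m i : ℕ) :
    pullThreshold α σ D (m ^ i) = i * pullThreshold α σ D m := by
  unfold pullThreshold
  rw [Nat.cast_pow, Real.log_pow]
  ring

lemma pullThreshold_le_mul_pullThreshold_two (hα : 0 ≤ α) (hK : 1 ≤ K) :
    pullThreshold α σ D K ≤ (K - 1) * pullThreshold α σ D 2 := by
  have hpow : K ≤ 2 ^ (K - 1) := by
    have := Nat.lt_two_pow_self (n := K - 1)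
    lia
  refine (pullThreshold_mono hα hpow).trans_eq ?_
  rw [pullThreshold_pow, Nat.cast_sub hK, Nat.cast_one]

lemma log_two_mul_natCast_le (hτ : 2 ≤ τ) : Real.log 2 * τ ≤ (τ / 2 + 1) * Real.log τ := by
  have hlog2 : 0 < Real.log 2 := Real.log_pos one_lt_two
  rcases Nat.lt_or_ge τ 4 with hτ4 | hτ4
  · interval_cases τ
    · norm_num
      linarith
    · have hlog3 : Real.log ((2 : ℝ) ^ 6) ≤ Real.log ((3 : ℝ) ^ 5) :=
        Real.log_le_log (by norm_num) (by norm_num)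
      rw [Real.log_pow, Real.log_pow] at hlog3
      push_cast at *
      linarith
  · have hlog4 : Real.log ((2 : ℝ) ^ 2) ≤ Real.log τ :=
      Real.log_le_log (by norm_num) (by norm_num; exact_mod_cast hτ4)
    rw [Real.log_pow, Nat.cast_two] at hlog4
    nlinarith [Nat.cast_nonneg (α := ℝ) τ]

lemma mul_pullThreshold_eq (hD : D ≠ 0)
    (hDτ : D ^ 2 * τ = 27 * (K * α * σ ^ 2 * Real.log τ)) :
    K * pullThreshold α σ D τ = 8 / 27 * τ := by
  unfold pullThreshold
  field_simp
  linarith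

lemma mul_pullThreshold_two_le (hτ : 2 ≤ τ) (hD : D ≠ 0)
    (hDτ : D ^ 2 * τ = 27 * (K * α * σ ^ 2 * Real.log τ)) :
    K * pullThreshold α σ D 2 ≤ 8 / 27 * (τ / 2 + 1) := by
  have hlog : 0 < Real.log τ := Real.log_pos (by exact_mod_cast hτ)
  refine le_of_mul_le_mul_right ?_ hlog
  calc K * pullThreshold α σ D 2 * Real.log τ = Real.log 2 * (K * pullThreshold α σ D τ) := by
        unfold pullThreshold
        push_cast
        ring
    _ = 8 / 27 * (Real.log 2 * τ) := by
        rw [mul_pullThreshold_eq hD hDτ]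
        ring
    _ ≤ 8 / 27 * (τ / 2 + 1) * Real.log τ := by
        rw [mul_assoc]
        exact mul_le_mul_of_nonneg_left (log_two_mul_natCast_le hτ) (by norm_num)

/-- The first round of the `i`-th block of rounds in the analysis of TS-C: consecutive blocks double
in length, so that the total cost of the comparisons is summable over the blocks. -/
def blockStart (K τ i : ℕ) : ℕ := 2 ^ i * (4 * K ^ 2 * τ ^ 2)

lemma blockStart_mono : Monotone (blockStart K τ) := fun _ _ hij =>
  Nat.mul_le_mul_right _ (Nat.pow_le_pow_right two_pos hij)

lemma natCast_blockStart (K τ i : ℕ) : (blockStart K τ i : ℝ) = 2 ^ i * (4 * K ^ 2 * τ ^ 2) := by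
  simp [blockStart]

lemma mul_lt_blockStart (hK : 2 ≤ K) (hτ : 2 ≤ τ) (i : ℕ) : K * τ < blockStart K τ i := by
  have hKτ : 4 ≤ K * τ := Nat.mul_le_mul hK hτ
  refine lt_of_lt_of_le ?_ (blockStart_mono (Nat.zero_le i))
  unfold blockStart
  nlinarith

lemma lt_blockStart (hK : 2 ≤ K) (hτ : 2 ≤ τ) (i : ℕ) : i < blockStart K τ i := by
  refine Nat.lt_two_pow_self.trans_le (Nat.le_mul_of_pos_right _ ?_)
  positivity

lemma pullThreshold_blockStart_succ (hK : K ≠ 0) (hτ : τ ≠ 0) (i : ℕ) :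
    pullThreshold α σ D (blockStart K τ (i + 1)) =
      pullThreshold α σ D (blockStart K τ 1) + i * pullThreshold α σ D 2 := by
  have hsplit : blockStart K τ (i + 1) = 2 ^ i * blockStart K τ 1 := by
    unfold blockStart
    ring
  rw [hsplit, pullThreshold_mul (by positivity) (by unfold blockStart; positivity),
    pullThreshold_pow, add_comm]

lemma mul_pullThreshold_blockStart_one_le (hα : 0 ≤ α) (hK : 1 ≤ K) (hτ : 2 ≤ τ) (hD : D ≠ 0)
    (hDτ : D ^ 2 * τ = 27 * (K * α * σ ^ 2 * Real.log τ)) :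
    K * pullThreshold α σ D (blockStart K τ 1) ≤
      8 / 27 * ((2 * K + 1) * (τ / 2 + 1) + 2 * τ) := by
  have hfactor : blockStart K τ 1 = 2 ^ 3 * (K ^ 2 * τ ^ 2) := by
    unfold blockStart
    ring
  have hsum : pullThreshold α σ D (blockStart K τ 1) = 3 * pullThreshold α σ D 2 +
      2 * pullThreshold α σ D K + 2 * pullThreshold α σ D τ := by
    rw [hfactor, pullThreshold_mul (by positivity) (by positivity),
      pullThreshold_mul (by positivity) (by positivity), pullThreshold_pow, pullThreshold_pow,
      pullThreshold_pow, add_assoc]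
    norm_num
  have hKle := pullThreshold_le_mul_pullThreshold_two (σ := σ) (D := D) hα hK
  calc K * pullThreshold α σ D (blockStart K τ 1)
      ≤ K * (3 * pullThreshold α σ D 2 + 2 * ((K - 1) * pullThreshold α σ D 2) +
          2 * pullThreshold α σ D τ) := by
        rw [hsum]
        gcongr
    _ = (2 * K + 1) * (K * pullThreshold α σ D 2) + 2 * (K * pullThreshold α σ D τ) := by ring
    _ ≤ (2 * K + 1) * (8 / 27 * (τ / 2 + 1)) + 2 * (8 / 27 * τ) := by
        rw [mul_pullThreshold_eq hD hDτ]
        have := mul_le_mul_of_nonneg_left (mul_pullThreshold_two_le hτ hD hDτ)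
          (by positivity : (0 : ℝ) ≤ 2 * K + 1)
        linarith
    _ = 8 / 27 * ((2 * K + 1) * (τ / 2 + 1) + 2 * τ) := by ring

end BlockThreshold

section BlockBudget

variable {K τ : ℕ} {J : ℕ → ℝ} {e : ℝ}

lemma sum_affine_mul_affine_div_two_pow_le {w₀ w₁ v₀ v₁ : ℝ} (hw₀ : 0 ≤ w₀) (hw₁ : 0 ≤ w₁)
    (hv₀ : 0 ≤ v₀) (hv₁ : 0 ≤ v₁) (I : ℕ) :
    ∑ i ∈ Finset.range I, (w₀ + w₁ * (i + 1)) * (v₀ + v₁ * (i + 1)) / 2 ^ i ≤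
      2 * (w₀ * v₀) + 4 * (w₀ * v₁ + w₁ * v₀) + 12 * (w₁ * v₁) := by
  have hsum : ∑ i ∈ Finset.range I, (w₀ + w₁ * (i + 1)) * (v₀ + v₁ * (i + 1)) / 2 ^ i =
      2 * (w₀ * v₀) + 4 * (w₀ * v₁ + w₁ * v₀) + 12 * (w₁ * v₁) -
        (2 * (w₀ * v₀) + (w₀ * v₁ + w₁ * v₀) * (2 * I + 4) +
          w₁ * v₁ * (2 * I ^ 2 + 8 * I + 12)) / 2 ^ I := by
    induction I with
    | zero =>
      simp only [Finset.sum_range_zero, Nat.cast_zero]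
      ring
    | succ I ih =>
      rw [Finset.sum_range_succ, ih]
      push_cast
      field_simp
      ring
  rw [hsum]
  exact sub_le_self _ (by positivity)

-- The pull threshold `8 α σ² log b / D²` at `D = 3 √(3 K α σ² log τ / τ)` equals
-- `8 / 27 * (τ / K) * (log b / log τ)`: this is the origin of the constant `8 / 27`.
lemma chargeFactor_mul_le_of_mul_le (hK : 2 ≤ K) (hτ : 2 ≤ τ) {x : ℝ}
    (hx : K * x ≤ 8 / 27 * ((2 * K + 1) * (τ / 2 + 1) + 2 * τ)) :
    chargeFactor K * x ≤ 16 / 9 * τ := by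
  have hτ' : (2 : ℝ) ≤ τ := by exact_mod_cast hτ
  rcases hK.eq_or_lt with rfl | hK3
  · simp only [chargeFactor, if_true, Nat.cast_one]
    push_cast at hx
    linarith
  · have hK3' : (3 : ℝ) ≤ K := by exact_mod_cast hK3
    simp only [chargeFactor, hK3.ne', if_false, Nat.cast_two]
    have : K * x ≤ K * (8 / 9 * τ) := by nlinarith
    linarith [le_of_mul_le_mul_left this (by linarith)]

lemma chargeFactor_mul_le_of_mul_le_half (hK : 2 ≤ K) (hτ : 2 ≤ τ)
    (he : K * e ≤ 8 / 27 * (τ / 2 + 1)) : chargeFactor K * e ≤ 16 / 81 * τ := by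
  have hτ' : (2 : ℝ) ≤ τ := by exact_mod_cast hτ
  rcases hK.eq_or_lt with rfl | hK3
  · simp only [chargeFactor, if_true, Nat.cast_one]
    push_cast at he
    linarith
  · have hK3' : (3 : ℝ) ≤ K := by exact_mod_cast hK3
    simp only [chargeFactor, hK3.ne', if_false, Nat.cast_two]
    have : K * e ≤ K * (8 / 81 * τ) := by nlinarith
    linarith [le_of_mul_le_mul_left this (by linarith)]

lemma mul_two_mul_sq_add_le (hK : 1 ≤ K) (hτ : 0 < τ) {a d A B ρ : ℝ} (ha : 0 ≤ a)
    (haA : a ≤ A * τ) (hd : 0 ≤ d) (hdB : d ≤ B * τ) (hρ : K - 1 ≤ ρ * (3.2 * K ^ 2)) :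
    (K - 1) / (3.2 * K ^ 2 * τ ^ 2) * (2 * a ^ 2 + 12 * (a * d) + 24 * d ^ 2) ≤
      ρ * (2 * A ^ 2 + 12 * (A * B) + 24 * B ^ 2) := by
  have hK' : (0 : ℝ) ≤ K - 1 := sub_nonneg.2 (by exact_mod_cast hK)
  have hquad : 2 * a ^ 2 + 12 * (a * d) + 24 * d ^ 2 ≤
      (2 * A ^ 2 + 12 * (A * B) + 24 * B ^ 2) * τ ^ 2 := by
    calc 2 * a ^ 2 + 12 * (a * d) + 24 * d ^ 2
        ≤ 2 * (A * τ) ^ 2 + 12 * ((A * τ) * (B * τ)) + 24 * (B * τ) ^ 2 := by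
          have := ha.trans haA
          gcongr
      _ = (2 * A ^ 2 + 12 * (A * B) + 24 * B ^ 2) * τ ^ 2 := by ring
  have hquad0 : 0 ≤ 2 * a ^ 2 + 12 * (a * d) + 24 * d ^ 2 := by positivity
  rw [div_mul_eq_mul_div, div_le_iff₀ (by positivity)]
  calc (K - 1) * (2 * a ^ 2 + 12 * (a * d) + 24 * d ^ 2)
      ≤ ρ * (3.2 * K ^ 2) * ((2 * A ^ 2 + 12 * (A * B) + 24 * B ^ 2) * τ ^ 2) :=
        mul_le_mul hρ hquad hquad0 (hK'.trans hρ)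
    _ = ρ * (2 * A ^ 2 + 12 * (A * B) + 24 * B ^ 2) * (3.2 * K ^ 2 * τ ^ 2) := by ring

lemma chargeFactor_budget_le (hK : 2 ≤ K) (hτ : 2 ≤ τ) {x : ℝ} (hx : 0 ≤ x) (he0 : 0 ≤ e)
    (hKx : K * x ≤ 8 / 27 * ((2 * K + 1) * (τ / 2 + 1) + 2 * τ))
    (hKe : K * e ≤ 8 / 27 * (τ / 2 + 1)) {a d : ℝ} (ha : a = chargeFactor K * x + τ / 2)
    (hd : d = chargeFactor K * e) :
    2 * chargeFactor K * x + 1 + τ / 2 +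
      (K - 1) / (3.2 * K ^ 2 * τ ^ 2) * (2 * a ^ 2 + 12 * (a * d) + 24 * d ^ 2) ≤
    K * τ + 2 * K - 1 := by
  have hτ' : (2 : ℝ) ≤ τ := by exact_mod_cast hτ
  have ha0 : 0 ≤ a := ha ▸ by positivity
  have hd0 : 0 ≤ d := hd ▸ by positivity
  rcases hK.eq_or_lt with rfl | hK3
  · rw [chargeFactor, if_pos rfl, Nat.cast_one] at ha hd ⊢
    push_cast at hKx hKe
    have hquad := mul_two_mul_sq_add_le (K := 2) (ρ := 5 / 64) one_le_two (two_pos.trans_le hτ) ha0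
      (A := 83 / 54) (by linarith) hd0 (B := 4 / 27) (by linarith) (by norm_num)
    push_cast at hquad ⊢
    linarith
  · have hK3' : (3 : ℝ) ≤ K := by exact_mod_cast hK3
    have hquad := mul_two_mul_sq_add_le (K := K) (τ := τ) (ρ := 5 / 72) (one_le_two.trans hK)
      (two_pos.trans_le hτ) ha0
      (A := 41 / 18) (by linarith [chargeFactor_mul_le_of_mul_le hK hτ hKx]) hd0 (B := 16 / 81)
      (hd ▸ chargeFactor_mul_le_of_mul_le_half hK hτ hKe) (by nlinarith)
    have hx' : x ≤ 8 / 27 * (11 / 6 * τ + 7 / 3) := by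
      refine le_of_mul_le_mul_left (hKx.trans ?_) (by linarith : (0 : ℝ) < K)
      nlinarith
    simp only [chargeFactor, hK3.ne', if_false, Nat.cast_two]
    nlinarith

lemma blockWeight_nonneg (he0 : 0 ≤ e) (hJ0 : 0 ≤ J 1) (hJ : ∀ i : ℕ, J (i + 1) = J 1 + i * e)
    (i : ℕ) :
    0 ≤ 2 * chargeFactor K * J (i + 2) + 1 - chargeFactor K * J 1 := by
  rw [hJ (i + 1)]
  have : 0 ≤ chargeFactor K * J 1 + 2 * chargeFactor K * ((i + 1 : ℕ) * e) + 1 := by positivity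
  linarith

lemma blockWeight_le (hτ : 2 ≤ τ) (hJ : ∀ i : ℕ, J (i + 1) = J 1 + i * e)
    (i : ℕ) : 2 * chargeFactor K * J (i + 2) + 1 - chargeFactor K * J 1 ≤
    (chargeFactor K * J 1 + τ / 2) + 2 * (chargeFactor K * e) * (i + 1) := by
  have hτ' : (2 : ℝ) ≤ τ := by exact_mod_cast hτ
  rw [hJ (i + 1)]
  push_cast
  linarith

lemma blockWeight_le_two_mul_sq_mul_blockStart (hK : 2 ≤ K) (hτ : 2 ≤ τ)
    (hJ : ∀ i : ℕ, J (i + 1) = J 1 + i * e)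
    (hKJ : K * J 1 ≤ 8 / 27 * ((2 * K + 1) * (τ / 2 + 1) + 2 * τ))
    (hKe : K * e ≤ 8 / 27 * (τ / 2 + 1)) (i : ℕ) :
    2 * chargeFactor K * J (i + 2) + 1 - chargeFactor K * J 1 ≤
      2 * K ^ 2 * blockStart K τ i := by
  have hτ' : (2 : ℝ) ≤ τ := by exact_mod_cast hτ
  have hK' : (2 : ℝ) ≤ K := by exact_mod_cast hK
  have hpow : (i + 1 : ℝ) ≤ 2 ^ i := by exact_mod_cast Nat.lt_two_pow_self (n := i)
  have hx := chargeFactor_mul_le_of_mul_le hK hτ hKJ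
  have hy := chargeFactor_mul_le_of_mul_le_half hK hτ hKe
  have hone : (1 : ℝ) ≤ 2 ^ i := one_le_pow₀ one_le_two
  rw [natCast_blockStart]
  calc 2 * chargeFactor K * J (i + 2) + 1 - chargeFactor K * J 1
      ≤ (chargeFactor K * J 1 + τ / 2) + 2 * (chargeFactor K * e) * (i + 1) :=
        blockWeight_le hτ hJ i
    _ ≤ (16 / 9 * τ + τ / 2) * 2 ^ i + 2 * (16 / 81 * τ) * 2 ^ i := by
        refine add_le_add (le_trans (by linarith) (le_mul_of_one_le_right (by positivity) hone)) ?_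
        gcongr
    _ ≤ 8 * (τ * 2 ^ i) := by nlinarith [(by positivity : (0 : ℝ) < τ * 2 ^ i)]
    _ ≤ 8 * (τ * 2 ^ i) * (K ^ 4 * τ) :=
        le_mul_of_one_le_right (by positivity)
          (one_le_mul_of_one_le_of_one_le (one_le_pow₀ (by linarith)) (by linarith))
    _ = 2 * K ^ 2 * (2 ^ i * (4 * K ^ 2 * τ ^ 2)) := by ring

lemma le_blockStart_sub_blockStart_sub (hK : 2 ≤ K) (hτ : 2 ≤ τ) (he0 : 0 ≤ e) (hJ0 : 0 ≤ J 1)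
    (hJ : ∀ i : ℕ, J (i + 1) = J 1 + i * e)
    (hKJ : K * J 1 ≤ 8 / 27 * ((2 * K + 1) * (τ / 2 + 1) + 2 * τ))
    (hKe : K * e ≤ 8 / 27 * (τ / 2 + 1)) (i : ℕ) :
    3.2 * K ^ 2 * τ ^ 2 * 2 ^ i ≤ (blockStart K τ (i + 1) : ℝ) - blockStart K τ i - J (i + 2) -
      (K - 1) * (chargeFactor K * J (i + 2) + 1) := by
  have hτ' : (2 : ℝ) ≤ τ := by exact_mod_cast hτ
  have hK' : (2 : ℝ) ≤ K := by exact_mod_cast hK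
  have hpow : (i + 1 : ℝ) ≤ 2 ^ i := by exact_mod_cast Nat.lt_two_pow_self (n := i)
  have : (1 : ℝ) ≤ 2 ^ i := one_le_pow₀ one_le_two
  have hc : (1 : ℝ) ≤ chargeFactor K := by exact_mod_cast one_le_chargeFactor K
  have hx := chargeFactor_mul_le_of_mul_le hK hτ hKJ
  have hy := chargeFactor_mul_le_of_mul_le_half hK hτ hKe
  have hJi : chargeFactor K * J (i + 2) + 1 ≤ 3.2 * τ * 2 ^ i := by
    have : chargeFactor K * e * (i + 1) ≤ 16 / 81 * τ * 2 ^ i := by gcongr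
    rw [hJ (i + 1)]
    push_cast
    nlinarith
  have hJ_le : J (i + 2) ≤ chargeFactor K * J (i + 2) := by
    refine le_mul_of_one_le_left ?_ hc
    rw [hJ (i + 1)]
    positivity
  have hloss : J (i + 2) + (K - 1) * (chargeFactor K * J (i + 2) + 1) ≤
      0.8 * K ^ 2 * τ ^ 2 * 2 ^ i := by
    calc J (i + 2) + (K - 1) * (chargeFactor K * J (i + 2) + 1)
        ≤ K * (chargeFactor K * J (i + 2) + 1) := by linarith
      _ ≤ K * (3.2 * τ * 2 ^ i) := by gcongr
      _ = 0.8 * (4 * (K * τ * 2 ^ i)) := by ring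
      _ ≤ 0.8 * (K * τ * (K * τ * 2 ^ i)) := by
          gcongr
          nlinarith
      _ = 0.8 * K ^ 2 * τ ^ 2 * 2 ^ i := by ring
  rw [natCast_blockStart, natCast_blockStart, pow_succ (2 : ℝ) i]
  linarith

lemma sum_blockWeight_mul_le (hK : 2 ≤ K) (hτ : 2 ≤ τ) (he0 : 0 ≤ e) (hJ0 : 0 ≤ J 1)
    (hJ : ∀ i : ℕ, J (i + 1) = J 1 + i * e)
    (hKJ : K * J 1 ≤ 8 / 27 * ((2 * K + 1) * (τ / 2 + 1) + 2 * τ))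
    (hKe : K * e ≤ 8 / 27 * (τ / 2 + 1))
    {q : ℕ → ℝ} (hq : ∀ i, 3.2 * K ^ 2 * τ ^ 2 * 2 ^ i ≤ q i) (I : ℕ) :
    2 * chargeFactor K * J 1 + 1 +
      ∑ i ∈ Finset.range I, (2 * chargeFactor K * J (i + 2) + 1 - chargeFactor K * J 1) *
        ((K - 1) * (chargeFactor K * J (i + 2) + τ / 2) / q i) + τ / 2 ≤ K * τ + 2 * K - 1 := by
  have hK1 : (0 : ℝ) ≤ K - 1 := sub_nonneg.2 (by exact_mod_cast one_le_two.trans hK)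
  set a := chargeFactor K * J 1 + τ / 2 with ha
  set d := chargeFactor K * e with hd
  have ha0 : 0 ≤ a := by positivity
  have hd0 : 0 ≤ d := by positivity
  have hterm (i : ℕ) : (2 * chargeFactor K * J (i + 2) + 1 - chargeFactor K * J 1) *
        ((K - 1) * (chargeFactor K * J (i + 2) + τ / 2) / q i) ≤
      (K - 1) / (3.2 * K ^ 2 * τ ^ 2) * ((a + 2 * d * (i + 1)) * (a + d * (i + 1)) / 2 ^ i) := by
    have hcost : chargeFactor K * J (i + 2) + τ / 2 = a + d * (i + 1) := by
      rw [hJ (i + 1), ha, hd]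
      push_cast
      ring
    calc _ ≤ (a + 2 * d * (i + 1)) *
          ((K - 1) * (a + d * (i + 1)) / (3.2 * K ^ 2 * τ ^ 2 * 2 ^ i)) := by
          rw [hcost]
          have hgap : (0 : ℝ) < 3.2 * K ^ 2 * τ ^ 2 * 2 ^ i := by positivity
          have := hgap.trans_le (hq i)
          exact mul_le_mul (blockWeight_le hτ hJ i)
            (div_le_div_of_nonneg_left (by positivity) hgap (hq i)) (by positivity) (by positivity)
      _ = _ := by
          field_simp
  have hsum := mul_le_mul_of_nonneg_left
    (sum_affine_mul_affine_div_two_pow_le ha0 (by positivity : 0 ≤ 2 * d) ha0 hd0 I)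
    (by positivity : 0 ≤ (K - 1) / (3.2 * K ^ 2 * τ ^ 2 : ℝ))
  have hbudget := chargeFactor_budget_le hK hτ hJ0 he0 hKJ hKe ha hd
  have hterms := Finset.sum_le_sum fun i (_ : i ∈ Finset.range I) => hterm i
  rw [← Finset.mul_sum] at hterms
  linarith

end BlockBudget

section BadRounds

variable {Θ Ω : Type*} [MeasurableSpace Ω] {P : Measure Ω} [IsProbabilityMeasure P] {K : ℕ}
  {μ : Fin K → Θ → ℝ} {θs : Θ} {α σ : ℝ} {X : Fin K → ℕ → Ω → ℝ} {arm : ℕ → Ω → Fin K}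

lemma integral_pulls_le_sum_add_sum (harm : ∀ t, Measurable (arm t)) (k : Fin K)
    (A : ℕ → Set Ω) (T : ℕ) :
    ∫ ω, (pulls arm k T ω : ℝ) ∂P ≤ ∑ t ∈ Finset.range T, P.real {ω | arm t ω = k ∧ ω ∉ A t} +
      ∑ t ∈ Finset.range T, P.real {ω | arm t ω = k ∧ ω ∈ A t} := by
  rw [integral_pulls harm, ← Finset.sum_add_distrib]
  refine Finset.sum_le_sum fun t _ => ?_
  refine (measureReal_mono (fun ω hω => ?_) (measure_ne_top _ _)).trans (measureReal_union_le _ _)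
  exact (em (ω ∈ A t)).symm.imp (⟨hω, ·⟩) (⟨hω, ·⟩)

lemma integral_pulls_le_natCast (harm : ∀ t, Measurable (arm t)) (k : Fin K) (T : ℕ) :
    ∫ ω, (pulls arm k T ω : ℝ) ∂P ≤ T := by
  rw [integral_pulls harm]
  simpa using Finset.sum_le_sum fun t (_ : t ∈ Finset.range T) =>
    measureReal_le_one (μ := P) (s := {ω | arm t ω = k})

-- Round `0` is never bad, and round `1` contributes at most a single pull, whereas the series
-- allows for `2 K` of them: this is where the term `2 K - 1` is saved.
lemma sum_measureReal_arm_eq_and_not_mem_le (hX : IsRewardTable P X (fun k => μ k θs) σ)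
    (hσ : σ ≠ 0) (hα : 0 ≤ α) (k : Fin K) {T : ℕ} (hT : 2 ≤ T) :
    ∑ t ∈ Finset.range T, P.real {ω | arm t ω = k ∧ θs ∉ confSet μ α σ X arm t ω} ≤
      ∑ t ∈ Finset.Icc 1 T, 2 * K * (t : ℝ) ^ (1 - α) - (2 * K - 1) := by
  set p : ℕ → ℝ := fun t => P.real {ω | arm t ω = k ∧ θs ∉ confSet μ α σ X arm t ω}
  have hp_zero : p 0 = 0 := by
    have hempty : {ω | arm 0 ω = k ∧ θs ∉ confSet μ α σ X arm 0 ω} = ∅ :=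
      Set.eq_empty_of_forall_notMem fun ω hω =>
        hω.2 fun l hl => absurd hl (by simp [pulls])
    simp only [p, hempty, measureReal_empty]
  have hp_one : p 1 ≤ 1 := measureReal_le_one
  have hp_le : ∀ t ∈ Finset.Ico 2 T, p t ≤ 2 * K * (t : ℝ) ^ (1 - α) := fun t ht =>
    (measureReal_mono (fun ω hω => hω.2) (measure_ne_top _ _)).trans
      (measureReal_not_mem_confSet_le hX hσ hα arm (two_pos.trans_le (Finset.mem_Ico.1 ht).1))
  have hIcc : ∑ t ∈ Finset.Icc 1 T, 2 * K * (t : ℝ) ^ (1 - α) =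
      2 * K + ∑ t ∈ Finset.Ioc 1 T, 2 * K * (t : ℝ) ^ (1 - α) := by
    rw [← Finset.add_sum_Ioc_eq_sum_Icc (by lia)]
    simp
  have htail : ∑ t ∈ Finset.Ico 2 T, 2 * K * (t : ℝ) ^ (1 - α) ≤
      ∑ t ∈ Finset.Ioc 1 T, 2 * K * (t : ℝ) ^ (1 - α) := by
    refine Finset.sum_le_sum_of_subset_of_nonneg (fun t ht => ?_) fun _ _ _ => by positivity
    rw [Finset.mem_Ico] at ht
    exact Finset.mem_Ioc.2 ⟨ht.1, ht.2.le⟩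
  rw [Finset.range_eq_Ico, ← Finset.sum_Ico_consecutive p (Nat.zero_le 2) hT,
    ← Finset.range_eq_Ico, Finset.sum_range_succ, Finset.sum_range_one, hp_zero, hIcc]
  linarith [Finset.sum_le_sum hp_le]

end BadRounds

section TotalCost

variable {Ω : Type*} [MeasurableSpace Ω] {P : Measure Ω} [IsProbabilityMeasure P] {K : ℕ}
  {m : Fin K → ℝ} {α β σ D : ℝ} {X : Fin K → ℕ → Ω → ℝ} {arm : ℕ → Ω → Fin K} {τ : ℕ}

lemma ne_top_of_forall_sum_range_le {f : ℕ → ENNReal} {c : ENNReal} (hc : c ≠ ⊤)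
    (hf : ∀ T, ∑ s ∈ Finset.range T, f s ≤ c) (s : ℕ) : f s ≠ ⊤ :=
  ne_top_of_le_ne_top hc <|
    (Finset.single_le_sum (fun _ _ => zero_le) (Finset.self_mem_range_succ s)).trans (hf (s + 1))

lemma sum_toReal_le_of_forall_sum_range_le {f : ℕ → ENNReal} {c : ℝ} (hc : 0 ≤ c)
    (hf : ∀ T, ∑ s ∈ Finset.range T, f s ≤ ENNReal.ofReal c) (S : Finset ℕ) :
    ∑ s ∈ S, (f s).toReal ≤ c := by
  have hfin := ne_top_of_forall_sum_range_le ENNReal.ofReal_ne_top hf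
  rw [← ENNReal.toReal_sum fun s _ => hfin s]
  exact ENNReal.toReal_le_of_le_ofReal hc
    ((Finset.sum_le_sum_of_subset S.subset_range_sup_succ).trans (hf _))

lemma IsRewardTable.sum_roundMissCost_le (hX : IsRewardTable P X m σ)
    (harm : ∀ t, Measurable (arm t)) (hσ : 0 < σ) (hβ : 1 ≤ β) (hα : 2 ≤ α) (hK : 2 ≤ K)
    (hτ : 2 ≤ τ) (hD : 0 < D) (hDτ : D ^ 2 * τ = 27 * (K * α * σ ^ 2 * Real.log τ))
    (k : Fin K) (T : ℕ) :
    ∑ s ∈ Finset.range T, roundMissCost P β σ (m k - D / 2) X arm k s ≤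
      ENNReal.ofReal (τ / 2) := by
  refine (StructuredBandit.sum_roundMissCost_le harm hX.measurable k T).trans
    (hX.sum_lintegral_missCost_le hσ k hβ hτ hD ?_ T)
  have hfour : (2 : ℝ) * 2 ≤ K * α := by
    gcongr
    exact_mod_cast hK
  have hlog : 0 ≤ σ ^ 2 * Real.log τ := by positivity
  nlinarith

end TotalCost

section BlockSums

variable {K τ : ℕ} {α : ℝ}

lemma sum_range_sum_Ico {M : Type*} [AddCommMonoid M] {t : ℕ → ℕ} (ht : Monotone t) (g : ℕ → M)
    (I : ℕ) : ∑ i ∈ Finset.range I, ∑ s ∈ Finset.Ico (t i) (t (i + 1)), g s =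
      ∑ s ∈ Finset.Ico (t 0) (t I), g s := by
  induction I with
  | zero => simp
  | succ I ih =>
    rw [Finset.sum_range_succ, ih,
      Finset.sum_Ico_consecutive _ (ht (Nat.zero_le _)) (ht (Nat.le_succ _))]

lemma exists_le_blockStart_succ (hK : 2 ≤ K) (hτ : 2 ≤ τ) (T : ℕ) :
    ∃ I, T ≤ blockStart K τ (I + 1) ∧
      Finset.Ico (blockStart K τ 0) (blockStart K τ I) ⊆ Finset.Icc (K * τ) T := by
  have hex : ∃ n, T ≤ blockStart K τ (n + 1) :=
    ⟨T, (lt_blockStart hK hτ T).le.trans (blockStart_mono T.le_succ)⟩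
  classical
  refine ⟨Nat.find hex, Nat.find_spec hex, fun s hs => ?_⟩
  rw [Finset.mem_Ico] at hs
  refine Finset.mem_Icc.2 ⟨(mul_lt_blockStart hK hτ 0).le.trans hs.1, ?_⟩
  rcases hfind : Nat.find hex with _ | n
  · rw [hfind] at hs
    lia
  · have := Nat.find_min hex (m := n) (by lia)
    rw [hfind] at hs
    lia

lemma two_mul_sq_mul_mul_rpow_le (hK : 1 ≤ K) (hα : 2 ≤ α) {s : ℕ} (hs : 0 < s) :
    2 * K ^ 2 * s * (2 * K * (s : ℝ) ^ (1 - α)) ≤ K ^ 3 * (4 * ((s : ℝ) / K) ^ (2 - α)) := by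
  have hs' : (0 : ℝ) < s := by exact_mod_cast hs
  have hK' : (1 : ℝ) ≤ K := by exact_mod_cast hK
  have hKα : (K : ℝ) ^ (2 - α) ≤ 1 := Real.rpow_le_one_of_one_le_of_nonpos hK' (by linarith)
  calc 2 * K ^ 2 * s * (2 * K * (s : ℝ) ^ (1 - α))
      = K ^ 3 * (4 * (s : ℝ) ^ (2 - α)) := by
        rw [show (2 : ℝ) - α = 1 + (1 - α) by ring, Real.rpow_add hs', Real.rpow_one]
        ring
    _ ≤ K ^ 3 * (4 * ((s : ℝ) / K) ^ (2 - α)) := by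
        rw [Real.div_rpow hs'.le (Nat.cast_nonneg K)]
        gcongr
        exact le_div_self (by positivity) (by positivity) hKα

end BlockSums

section TSBound

variable {Θ Ω : Type*} [MeasurableSpace Ω] {P : Measure Ω} [IsProbabilityMeasure P] {K : ℕ}
  {μ : Fin K → Θ → ℝ} {θs : Θ} {ks k : Fin K} {α β σ D : ℝ} {X : Fin K → ℕ → Ω → ℝ}
  {G : ℕ → Fin K → Ω → ℝ} {arm : ℕ → Ω → Fin K} {τ : ℕ}

lemma IsTSC.mul_measureReal_pulls_best_lt_le (harm : IsTSC P μ α β σ X G arm)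
    (hX : IsRewardTable P X (fun k => μ k θs) σ) (hopt : IsOptimal μ θs ks) (hα : 2 ≤ α)
    (hβ : 0 < β) (hσ : σ ≠ 0) (hD : 0 < D) (hgap : D ≤ gapMin μ θs ks) {t₀ t₁ b : ℕ} (ht₀ : 0 < t₀)
    (hb : t₁ ≤ b) (hfin : ∀ s, roundMissCost P β σ (μ ks θs - D / 2) X arm ks s ≠ ⊤) {H : ℝ}
    (hH : ∑ s ∈ Finset.Ico t₀ t₁, (roundMissCost P β σ (μ ks θs - D / 2) X arm ks s).toReal ≤ H)
    {J q : ℝ} (hJ : J = pullThreshold α σ D b)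
    (hq : q = t₁ - t₀ - J - (K - 1) * (chargeFactor K * J + 1)) (hq0 : 0 < q) {w : ℝ} (hw0 : 0 ≤ w)
    (hw : w ≤ 2 * K ^ 2 * t₀) :
    w * P.real {ω | pulls arm ks t₁ ω < J} ≤
      w * ((K - 1) * (chargeFactor K * J + H) / q) +
        ∑ s ∈ Finset.Ico t₀ t₁, (K : ℝ) ^ 3 * (4 * ((s : ℝ) / K) ^ (2 - α)) := by
  have hprob := harm.measureReal_pulls_best_lt_le hX hopt (by linarith) hβ hσ hD hgap ht₀ hb hfin hH
    hJ hq hq0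
  refine (mul_le_mul_of_nonneg_left hprob hw0).trans ?_
  rw [mul_add, add_comm, Finset.mul_sum]
  refine add_le_add_right (Finset.sum_le_sum fun s hs => ?_) _
  have hs := (Finset.mem_Ico.1 hs).1
  calc w * (2 * K * (s : ℝ) ^ (1 - α)) ≤ 2 * K ^ 2 * s * (2 * K * (s : ℝ) ^ (1 - α)) := by
        have : (t₀ : ℝ) ≤ s := by exact_mod_cast hs
        gcongr
        exact hw.trans (by gcongr)
    _ ≤ _ := two_mul_sq_mul_mul_rpow_le ks.pos hα (ht₀.trans_le hs)

lemma IsTSC.sum_measureReal_arm_eq_and_mem_le_sum (harm : IsTSC P μ α β σ X G arm)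
    (hX : IsRewardTable P X (fun k => μ k θs) σ) (hopt : IsOptimal μ θs ks) (hk : k ≠ ks)
    (hσ : 0 < σ) (hα : 2 ≤ α) (hβ : 1 ≤ β) (hτ : 2 ≤ τ) (hD : 0 < D)
    (hDτ : D ^ 2 * τ = 27 * (K * α * σ ^ 2 * Real.log τ)) (hsep : IsSeparated μ θs ks k D) (I : ℕ) :
    ∑ s ∈ Finset.range (blockStart K τ (I + 1)),
        P.real {ω | arm s ω = k ∧ θs ∈ confSet μ α σ X arm s ω} ≤
      K * τ + 2 * K - 1 + ∑ s ∈ Finset.Ico (blockStart K τ 0) (blockStart K τ I),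
        (K : ℝ) ^ 3 * (4 * ((s : ℝ) / K) ^ (2 - α)) := by
  have hK := two_le_of_ne hk
  have hα0 : 0 < α := two_pos.trans_le hα
  have hβ0 : 0 < β := one_pos.trans_le hβ
  have hcost := hX.sum_roundMissCost_le harm.measurable hσ hβ hα hK hτ hD hDτ ks
  have hfin := ne_top_of_forall_sum_range_le ENNReal.ofReal_ne_top hcost
  have hH := sum_toReal_le_of_forall_sum_range_le (by positivity) hcost
  set J : ℕ → ℝ := fun i => pullThreshold α σ D (blockStart K τ i)
  have hJ (i : ℕ) : J (i + 1) = J 1 + i * pullThreshold α σ D 2 :=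
    pullThreshold_blockStart_succ (by lia) (by lia) i
  have hJ0 (i : ℕ) : 0 < J i :=
    pullThreshold_pos hα0 hσ.ne' hD.ne' ((mul_lt_blockStart hK hτ i).trans_le' (by nlinarith))
  have he0 : 0 ≤ pullThreshold α σ D 2 := pullThreshold_nonneg hα0.le
  have hKJ := mul_pullThreshold_blockStart_one_le hα0.le (one_le_two.trans hK) hτ hD.ne' hDτ
  have hKe := mul_pullThreshold_two_le hτ hD.ne' hDτ
  have hq := le_blockStart_sub_blockStart_sub hK hτ he0 (hJ0 1).le hJ hKJ hKe
  have hgood := harm.sum_measureReal_arm_eq_and_mem_le hX.measurable hopt hk hα0.le hβ0 hσ.ne' hD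
    hsep.1 hsep.2 blockStart_mono (fun _ => rfl) hJ0 hfin (fun T => hH (Finset.range T)) I
  have hblock (i : ℕ) := harm.mul_measureReal_pulls_best_lt_le hX hopt hα hβ0 hσ.ne' hD hsep.1
    ((Nat.zero_le _).trans_lt (mul_lt_blockStart hK hτ i)) (blockStart_mono (i + 1).le_succ) hfin
    (hH _) rfl rfl ((by positivity : (0 : ℝ) < 3.2 * K ^ 2 * τ ^ 2 * 2 ^ i).trans_le (hq i))
    (blockWeight_nonneg he0 (hJ0 1).le hJ i)
    (blockWeight_le_two_mul_sq_mul_blockStart hK hτ hJ hKJ hKe i)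
  have hblocks := Finset.sum_le_sum fun i (_ : i ∈ Finset.range I) => hblock i
  rw [Finset.sum_add_distrib, sum_range_sum_Ico blockStart_mono] at hblocks
  have hbudget := sum_blockWeight_mul_le hK hτ he0 (hJ0 1).le hJ hKJ hKe hq I
  linarith

lemma IsTSC.integral_pulls_le_of_two_le (harm : IsTSC P μ α β σ X G arm)
    (hX : IsRewardTable P X (fun k => μ k θs) σ) (hopt : IsOptimal μ θs ks) (hk : k ≠ ks)
    (hσ : 0 < σ) (hα : 2 ≤ α) (hβ : 1 ≤ β) (hτ : 2 ≤ τ) (hD : 0 < D)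
    (hDτ : D ^ 2 * τ = 27 * (K * α * σ ^ 2 * Real.log τ)) (hsep : IsSeparated μ θs ks k D)
    {T : ℕ} (hT : 2 ≤ T) :
    ∫ ω, (pulls arm k T ω : ℝ) ∂P ≤ K * τ + ∑ t ∈ Finset.Icc 1 T, 2 * K * (t : ℝ) ^ (1 - α) +
      (K : ℝ) ^ 3 * ∑ t ∈ Finset.Icc (K * τ) T, 4 * ((t : ℝ) / K) ^ (2 - α) := by
  obtain ⟨I, hTI, hI⟩ := exists_le_blockStart_succ (two_le_of_ne hk) hτ T
  have hsplit := integral_pulls_le_sum_add_sum (P := P) harm.measurable k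
    (fun t => {ω | θs ∈ confSet μ α σ X arm t ω}) T
  have hbad := sum_measureReal_arm_eq_and_not_mem_le hX hσ.ne' (α := α) (arm := arm)
    (by linarith) k hT
  have hgood := (Finset.sum_le_sum_of_subset_of_nonneg (Finset.range_mono hTI)
    fun s _ _ => measureReal_nonneg (μ := P)
      (s := {ω | arm s ω = k ∧ θs ∈ confSet μ α σ X arm s ω})).trans
    (harm.sum_measureReal_arm_eq_and_mem_le_sum hX hopt hk hσ hα hβ hτ hD hDτ hsep I)
  have hblocks := Finset.sum_le_sum_of_subset_of_nonneg hI fun s _ _ =>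
    (by positivity : 0 ≤ (K : ℝ) ^ 3 * (4 * ((s : ℝ) / K) ^ (2 - α)))
  rw [← Finset.mul_sum (Finset.Icc _ _)] at hblocks
  simp only [Set.mem_ofPred_eq] at hsplit
  linarith

lemma IsTSC.integral_pulls_le (harm : IsTSC P μ α β σ X G arm)
    (hX : IsRewardTable P X (fun k => μ k θs) σ) (hopt : IsOptimal μ θs ks) (hσ : 0 < σ)
    (hβ : 1 ≤ β) (hτ : 2 ≤ τ) (hk : k ≠ ks)
    (hsep : IsSeparated μ θs ks k (3 * Real.sqrt (3 * (K * α * σ ^ 2 * Real.log τ / τ)))) (T : ℕ) :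
    ∫ ω, (pulls arm k T ω : ℝ) ∂P ≤ tsBound K α β τ T := by
  have hK := two_le_of_ne hk
  suffices hmain : ∫ ω, (pulls arm k T ω : ℝ) ∂P ≤
      K * τ + ∑ t ∈ Finset.Icc 1 T, 2 * K * (t : ℝ) ^ (1 - α) +
        (K : ℝ) ^ 3 * ∑ t ∈ Finset.Icc (K * τ) T, 4 * ((t : ℝ) / K) ^ (2 - α) from
    hmain.trans (le_add_of_nonneg_right (by positivity))
  have hseries : 0 ≤ ∑ t ∈ Finset.Icc 1 T, 2 * K * (t : ℝ) ^ (1 - α) := by positivity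
  rcases le_or_gt α 2 with hα | hα
  · have htriv := sum_measureReal_le_of_le_two (P := P) (fun t => {ω | arm t ω = k})
      (K := K) (a := τ) (by lia) (by lia) hα (c := 4) (by norm_num) T
    rw [integral_pulls harm.measurable]
    linarith
  rcases le_or_gt T (K * τ) with hT | hT
  · have htriv := integral_pulls_le_natCast (P := P) harm.measurable k T
    have hT' : (T : ℝ) ≤ K * τ := by exact_mod_cast hT
    have hpow : 0 ≤ (K : ℝ) ^ 3 * ∑ t ∈ Finset.Icc (K * τ) T, 4 * ((t : ℝ) / K) ^ (2 - α) := by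
      positivity
    linarith
  have hlog : 0 < Real.log τ := Real.log_pos (by exact_mod_cast hτ)
  refine harm.integral_pulls_le_of_two_le hX hopt hk hσ hα.le hβ hτ (by positivity) ?_ hsep
    (by nlinarith)
  rw [mul_pow, Real.sq_sqrt (by positivity)]
  field_simp
  norm_num

end TSBound

end StructuredBandit

theorem theorem2 {Θ Ω : Type*} [MeasurableSpace Ω] (P : MeasureTheory.Measure Ω)
    [MeasureTheory.IsProbabilityMeasure P] {K : ℕ}
    (μ : Fin K → Θ → ℝ) (θs : Θ) (ks : Fin K) (hks : ∀ l, l ≠ ks → μ l θs < μ ks θs)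
    (σ : ℝ) (hσ : 0 < σ) (X : Fin K → ℕ → Ω → ℝ)
    (hX : StructuredBandit.IsRewardTable P X (fun k => μ k θs) σ)
    (k : Fin K) (hk : StructuredBandit.NonCompetitive μ θs ks k) (α : ℝ) (hα : 0 < α) :
    (∀ arm : ℕ → Ω → Fin K, StructuredBandit.IsUCBC μ α σ X arm →
      (∀ T : ℕ, ∫ ω, (StructuredBandit.pulls arm k T ω : ℝ) ∂P ≤
        StructuredBandit.ucbBound K α (StructuredBandit.tZero μ θs ks k α σ) T) ∧
      (3 < α →
        (fun T : ℕ => StructuredBandit.ucbBound K α (StructuredBandit.tZero μ θs ks k α σ) T)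
          =O[atTop] (fun _ => (1 : ℝ)) ∧
        (fun T : ℕ => ∫ ω, (StructuredBandit.pulls arm k T ω : ℝ) ∂P)
          =O[atTop] (fun _ => (1 : ℝ)))) ∧
    (∀ β : ℝ, 1 < β → ∀ (G : ℕ → Fin K → Ω → ℝ) (arm : ℕ → Ω → Fin K),
      StructuredBandit.IsTSC P μ α β σ X G arm →
      (∀ T : ℕ, ∫ ω, (StructuredBandit.pulls arm k T ω : ℝ) ∂P ≤
        StructuredBandit.tsBound K α β (StructuredBandit.tB μ θs ks k α β σ) T) ∧
      (3 < α →
        (fun T : ℕ => StructuredBandit.tsBound K α β (StructuredBandit.tB μ θs ks k α β σ) T)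
          =O[atTop] (fun _ => (1 : ℝ)) ∧
        (fun T : ℕ => ∫ ω, (StructuredBandit.pulls arm k T ω : ℝ) ∂P)
          =O[atTop] (fun _ => (1 : ℝ)))) := by
  have hopt := StructuredBandit.isOptimal_of_forall_ne_lt hks
  have hO {f g : ℕ → ℝ} (hf : ∀ T, 0 ≤ f T) (hfg : ∀ T, f T ≤ g T) : f =O[atTop] g :=
    .of_norm_le fun T => (Real.norm_of_nonneg (hf T)).trans_le (hfg T)
  have hnonneg (arm : ℕ → Ω → Fin K) (T : ℕ) :
      0 ≤ ∫ ω, (StructuredBandit.pulls arm k T ω : ℝ) ∂P :=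
    integral_nonneg fun ω => Nat.cast_nonneg _
  refine ⟨fun arm harm => ?_, fun β hβ G arm harm => ?_⟩
  · obtain ⟨h2, hsep⟩ := StructuredBandit.tZero_spec (α := α) (σ := σ) hks hk
    have hle := harm.integral_pulls_le hX hopt hσ.ne' h2 (hk.ne hopt) hsep
    refine ⟨hle, fun h3 => ?_⟩
    have hbound := StructuredBandit.ucbBound_isBigO_one K h3 (StructuredBandit.tZero μ θs ks k α σ)
    exact ⟨hbound, (hO (hnonneg arm) hle).trans hbound⟩
  · obtain ⟨h2, hsep⟩ :=
      StructuredBandit.tB_spec (α := α) hks hk (zero_lt_one.trans hβ) hσ.ne'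
    have hle := harm.integral_pulls_le hX hopt hσ hβ.le h2 (hk.ne hopt) hsep
    refine ⟨hle, fun h3 => ?_⟩
    have hbound := StructuredBandit.tsBound_isBigO_one K h3 hβ (StructuredBandit.tB μ θs ks k α β σ)
    exact ⟨hbound, (hO (hnonneg arm) hle).trans hbound⟩
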